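/- **Disjoint nonforking amalgamation.** Let $\mathbf{K}$ be an abstract elementary class (AEC) with Löwenheim–Skolem–Tarski number $\mathrm{LS}(\mathbf{K})$, ordered by $\le_{\mathbf{K}}$, and let $\lambda$ be a cardinal. $\mathbf{K}_\lambda$ is the class of models of cardinality $\lambda$; $\mathbf{S}(M)$ is the set of orbital (Galois) types over $M$; $f : M \to N$ always denotes a $\mathbf{K}$-embedding. *Definitions.* - For $M \le_{\mathbf{K}} N$ in $\mathbf{K}_\lambda$, $N$ is *universal over* $M$ if every $M' \in \mathbf{K}_\lambda$ with $M \le_{\mathbf{K}} M'$ embeds into $N$ over $M$. A *universal chain* is an increasing continuous chain $\langle M_i : i \le \delta\rangle$ in $\mathbf{K}_\lambda$, with $\delta < \lambda^+$ a limit ordinal, such that $M_{i+1}$ is universal over $M_i$ for all $i < \delta$. A *limit model* is the last member $M_\delta$ of such a chain. - For $M \le_{\mathbf{K}} N$, $p \in \mathbf{S}(N)$ *does not $\lambda$-split over* $M$ if $f(p \restriction N_1) = p \restriction N_2$ whenever $N_1, N_2 \in \mathbf{K}_\lambda$, $M \le_{\mathbf{K}} N_\ell \le_{\mathbf{K}}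 N$ for $\ell = 1,2$, and $f : N_1 \cong N_2$ fixes $M$ pointwise. - $\mathbf{K}$ is *$\lambda$-superstable* if $\lambda \ge \mathrm{LS}(\mathbf{K})$; $\mathbf{K}_\lambda$ is nonempty and has amalgamation, joint embedding and no maximal models; $|\mathbf{S}(M)| \le \lambda$ for every $M \in \mathbf{K}_\lambda$; and for every universal chain $\langle M_i : i \le \delta\rangle$ and every $p \in \mathbf{S}(M_\delta)$ there is $i < \delta$ such that $p$ does not $\lambda$-split over $M_i$. - For limit models $M \le_{\mathbf{K}} N$ in $\mathbf{K}_\lambda$, $p \in \mathbf{S}(N)$ *does not fork over* $M$ if there is $M' \in \mathbf{K}_\lambda$ such that $M$ is universal over $M'$ and $p$ does not $\lambda$-split over $M'$. - A $\lambda$-superstable $\mathbf{K}$ has *$\lambda$-symmetry* if for all limit models $M \le_{\mathbf{K}} N$ in $\mathbf{K}_\lambda$ and all $a, b \in N$ the following are equivalent: (1) there are limit models $M_b \le_{\mathbf{K}} N_b$ in $\mathbf{K}_\lambda$ with $N \le_{\mathbf{K}} N_b$, $M \le_{\mathbf{K}} M_b$, $b \in M_b$, such that $\mathbf{tp}(a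 / M_b; N_b)$ does not fork over $M$; (2) the same statement with $a$ and $b$ exchanged. *Statement.* Assume that $\mathbf{K}$ is $\lambda$-superstable, has $\lambda$-symmetry, and is categorical in $\lambda$ (that is, $\mathbf{K}_\lambda$ has exactly one model up to isomorphism). Let $M_0, M_1, M_2 \in \mathbf{K}_\lambda$ with $M_0 \le_{\mathbf{K}} M_1$ and $M_0 \le_{\mathbf{K}} M_2$, and let $a_1 \in M_1$ and $a_2 \in M_2$. Then there exist $M_3 \in \mathbf{K}_\lambda$ with $M_0 \le_{\mathbf{K}} M_3$ and $\mathbf{K}$-embeddings $f_1 : M_1 \to M_3$ and $f_2 : M_2 \to M_3$, both fixing $M_0$ pointwise, such that 1. $\mathbf{tp}(f_1(a_1) / f_2[M_2]; M_3)$ does not fork over $M_0$; 2. $\mathbf{tp}(f_2(a_2) / f_1[M_1]; M_3)$ does not fork over $M_0$; 3. $f_1[M_1] \cap f_2[M_2] = M_0$. -/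

import Mathlib

open FirstOrder Cardinal

universe u

/-- An abstract class of structures in the (finitary, set-sized) vocabulary `L`.
`Mem M` says that the structure `M` belongs to the class; for a substructure `S` of `N`,
`Strong S` says that `S ≤_K N`. Both respect isomorphisms, and `≤_K` is a partial order on the
class that refines the substructure relation (antisymmetry is inherited from `⊆`). -/
structure AbstractClass (L : FirstOrder.Language.{u, u}) where
  Mem : (M : Type u) → [L.Structure M] → Prop
  Strong : {N : Type u} → [L.Structure N] → L.Substructure N → Prop
  mem_of_strong : ∀ {N : Type u} [L.Structure N] {S : L.Substructure N},
    Strong S → Mem N ∧ Mem S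
  mem_equiv : ∀ {M N : Type u} [L.Structure M] [L.Structure N], (M ≃[L] N) → Mem M → Mem N
  strong_equiv : ∀ {N N' : Type u} [L.Structure N] [L.Structure N'] (e : N ≃[L] N')
    {S : L.Substructure N}, Strong S → Strong (S.map e.toHom)
  strong_refl : ∀ {N : Type u} [L.Structure N], Mem N → Strong (⊤ : L.Substructure N)
  strong_trans : ∀ {N : Type u} [L.Structure N] {S : L.Substructure N} {T : L.Substructure S},
    Strong S → Strong T → Strong (T.map S.subtype.toHom)

namespace AbstractClass

variable {L : FirstOrder.Language.{u, u}} (K : AbstractClass L)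

/-- `f : M → N` is a `K`-embedding: it is an isomorphism onto its range, and `f[M] ≤_K N`. -/
def IsEmb {M N : Type u} [L.Structure M] [L.Structure N] (f : M ↪[L] N) : Prop :=
  K.Strong f.toHom.range

/-- `S ≤_K T`, for two substructures `S`, `T` of a common structure. -/
def Le {N : Type u} [L.Structure N] (S T : L.Substructure N) : Prop :=
  ∃ h : S ≤ T, K.IsEmb (FirstOrder.Language.Substructure.inclusion h)

/-- `M ∈ K_lam`. -/
def MemCard (lam : Cardinal.{u}) (M : Type u) [L.Structure M] : Prop :=
  K.Mem M ∧ #M = lam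

theorem isEmb_equiv {M N : Type u} [L.Structure M] [L.Structure N] (e : M ≃[L] N)
    (h : K.Mem M) : K.IsEmb e.toEmbedding := by
  have h1 := K.strong_equiv e (K.strong_refl h)
  have h2 : e.toEmbedding.toHom.range = (⊤ : L.Substructure M).map e.toHom := by
    ext x; simp
  unfold IsEmb
  rw [h2]
  exact h1

theorem isEmb_comp {M N P : Type u} [L.Structure M] [L.Structure N] [L.Structure P]
    {g : N ↪[L] P} {f : M ↪[L] N} (hg : K.IsEmb g) (hf : K.IsEmb f) :
    K.IsEmb (g.comp f) := by
  have h1 := K.strong_trans hg (K.strong_equiv g.equivRange hf)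
  have h2 : (g.comp f).toHom.range
      = (f.toHom.range.map g.equivRange.toHom).map g.toHom.range.subtype.toHom := by
    ext x
    constructor
    · rintro ⟨y, rfl⟩
      exact ⟨g.equivRange (f y), ⟨f y, ⟨y, rfl⟩, rfl⟩, rfl⟩
    · rintro ⟨_, ⟨_, ⟨y, rfl⟩, rfl⟩, rfl⟩
      exact ⟨y, rfl⟩
  unfold IsEmb
  rw [h2]
  exact h1

/-! ### Abstract elementary classes -/

/-- The cardinals allowed in the Löwenheim-Skolem-Tarski axiom. -/
def IsLSCardinal (κ : Cardinal.{u}) : Prop :=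
  L.card + ℵ₀ ≤ κ ∧
    ∀ (N : Type u) [L.Structure N], K.Mem N → ∀ A : Set N,
      ∃ S : L.Substructure N, K.Strong S ∧ A ⊆ (S : Set N) ∧ #S ≤ #A + κ

/-- The Löwenheim-Skolem-Tarski number `LS(K)`: the least cardinal as in the axiom. -/
noncomputable def LS : Cardinal.{u} := sInf {κ | K.IsLSCardinal κ}

/-- Abstract elementary classes. -/
structure IsAEC : Prop where
  coherence : ∀ {N : Type u} [L.Structure N] {S T : L.Substructure N},
    S ≤ T → K.Strong S → K.Strong T → K.Le S T
  union_mem : ∀ {M : Type u} [L.Structure M] {I : Type u} [Nonempty I]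
    (S : I → L.Substructure M),
    (∀ i j, ∃ k, K.Le (S i) (S k) ∧ K.Le (S j) (S k)) →
    (⋃ i, (S i : Set M)) = Set.univ →
    K.Mem M ∧ ∀ i, K.Strong (S i)
  union_strong : ∀ {N : Type u} [L.Structure N] {I : Type u} [Nonempty I]
    (S : I → L.Substructure N) (T : L.Substructure N),
    (∀ i j, ∃ k, K.Le (S i) (S k) ∧ K.Le (S j) (S k)) →
    (T : Set N) = ⋃ i, (S i : Set N) →
    (∀ i, K.Strong (S i)) → K.Strong T
  exists_ls : ∃ κ, K.IsLSCardinal κ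

/-! ### Orbital (Galois) types -/

/-- A triple `(b, M, N)` with `M ≤_K N` and `b ∈ N`; the inclusion is given as a `K`-embedding. -/
structure PreType (M : Type u) [L.Structure M] where
  N : Type u
  [str : L.Structure N]
  emb : M ↪[L] N
  isEmb : K.IsEmb emb
  pt : N

attribute [instance] PreType.str

/-- Atomic equivalence of triples: the two extensions can be amalgamated over `M` in such a way
that the two distinguished elements are identified. -/
def AtomicEquiv (M : Type u) [L.Structure M] (p q : K.PreType M) : Prop :=
  ∃ (P : Type u) (_ : L.Structure P) (f : p.N ↪[L] P) (g : q.N ↪[L] P),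
    K.IsEmb f ∧ K.IsEmb g ∧ (∀ x : M, f (p.emb x) = g (q.emb x)) ∧ f p.pt = g q.pt

/-- `S(M)`, the orbital types over `M`: triples modulo the equivalence relation generated by
atomic equivalence. -/
def OrbType (M : Type u) [L.Structure M] : Type (u + 1) := Quot (K.AtomicEquiv M)

variable {K}

/-- The orbital type of `b ∈ N` over `M`, where `M` is embedded in `N` by `m`. -/
def tp {M N : Type u} [L.Structure M] [L.Structure N] {m : M ↪[L] N} (hm : K.IsEmb m) (b : N) :
    K.OrbType M :=
  Quot.mk _ ⟨N, m, hm, b⟩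

/-- Restriction of types along a `K`-embedding `g : M' → M` (if `g` is an inclusion, this is
`p ↾ M'`). -/
def OrbType.restrict {M' M : Type u} [L.Structure M'] [L.Structure M] {g : M' ↪[L] M}
    (hg : K.IsEmb g) : K.OrbType M → K.OrbType M' :=
  Quot.map (fun p => ⟨p.N, p.emb.comp g, K.isEmb_comp p.isEmb hg, p.pt⟩) (by
    rintro p q ⟨P, sP, f, h, hf, hh, hx, hb⟩
    exact ⟨P, sP, f, h, hf, hh, fun x => hx (g x), hb⟩)

/-- The image `f(p)` of a type `p ∈ S(M)` under an isomorphism `f : M ≅ M'`. -/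
def OrbType.image {M M' : Type u} [L.Structure M] [L.Structure M'] (f : M ≃[L] M')
    (hM' : K.Mem M') : K.OrbType M → K.OrbType M' :=
  OrbType.restrict (K.isEmb_equiv f.symm hM')

variable (K)

/-- Stability in `lam`: there are at most `lam` types over each model in `K_lam`. -/
def StableIn (lam : Cardinal.{u}) : Prop :=
  ∀ (M : Type u) [L.Structure M], K.MemCard lam M →
    #(K.OrbType M) ≤ Cardinal.lift.{u + 1} lam

/-! ### Properties of `K_lam` -/

def CategoricalIn (lam : Cardinal.{u}) : Prop :=
  (∃ (M : Type u) (_ : L.Structure M), K.MemCard lam M) ∧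
    ∀ (M N : Type u) [L.Structure M] [L.Structure N],
      K.MemCard lam M → K.MemCard lam N → Nonempty (M ≃[L] N)

def AmalgamationIn (lam : Cardinal.{u}) : Prop :=
  ∀ (M₀ M₁ M₂ : Type u) [L.Structure M₀] [L.Structure M₁] [L.Structure M₂]
    (i₁ : M₀ ↪[L] M₁) (i₂ : M₀ ↪[L] M₂),
    K.MemCard lam M₀ → K.MemCard lam M₁ → K.MemCard lam M₂ → K.IsEmb i₁ → K.IsEmb i₂ →
    ∃ (M₃ : Type u) (_ : L.Structure M₃) (f₁ : M₁ ↪[L] M₃) (f₂ : M₂ ↪[L] M₃),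
      K.MemCard lam M₃ ∧ K.IsEmb f₁ ∧ K.IsEmb f₂ ∧ ∀ x, f₁ (i₁ x) = f₂ (i₂ x)

def JointEmbeddingIn (lam : Cardinal.{u}) : Prop :=
  ∀ (M₁ M₂ : Type u) [L.Structure M₁] [L.Structure M₂],
    K.MemCard lam M₁ → K.MemCard lam M₂ →
    ∃ (M₃ : Type u) (_ : L.Structure M₃) (f₁ : M₁ ↪[L] M₃) (f₂ : M₂ ↪[L] M₃),
      K.MemCard lam M₃ ∧ K.IsEmb f₁ ∧ K.IsEmb f₂

def NoMaximalModelsIn (lam : Cardinal.{u}) : Prop :=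
  ∀ (M : Type u) [L.Structure M], K.MemCard lam M →
    ∃ (N : Type u) (_ : L.Structure N) (f : M ↪[L] N),
      K.MemCard lam N ∧ K.IsEmb f ∧ ¬ Function.Surjective f

/-! ### Universal extensions and limit models -/

/-- `N` is universal over `M` (both in `K_lam`), where `M` is embedded in `N` by `m`. -/
def Universal (lam : Cardinal.{u}) {M N : Type u} [L.Structure M] [L.Structure N]
    (m : M ↪[L] N) : Prop :=
  K.MemCard lam M ∧ K.MemCard lam N ∧ K.IsEmb m ∧
    ∀ (M' : Type u) [L.Structure M'] (j : M ↪[L] M'), K.MemCard lam M' → K.IsEmb j →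
      ∃ g : M' ↪[L] N, K.IsEmb g ∧ ∀ x, g (j x) = m x

/-- `⟨C i : i ≤ δ⟩` is an increasing continuous chain in `K_lam`, with last member `C δ = N`, such
that `C (i + 1)` is universal over `C i` for all `i < δ`; here `δ < lam⁺` is a limit ordinal. -/
structure IsUniversalChain (lam : Cardinal.{u}) {N : Type u} [L.Structure N] (δ : Ordinal.{u})
    (C : Ordinal.{u} → L.Substructure N) : Prop where
  isLimit : Order.IsSuccLimit δ
  lt_succ : δ < (Order.succ lam).ord
  mem : ∀ i ≤ δ, K.MemCard lam (C i)
  mono : ∀ i j, i ≤ j → j ≤ δ → K.Le (C i) (C j)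
  cont : ∀ i ≤ δ, Order.IsSuccLimit i → (C i : Set N) = ⋃ j : Set.Iio i, (C j : Set N)
  univ : ∀ i < δ, ∃ h : C i ≤ C (i + 1),
    K.Universal lam (FirstOrder.Language.Substructure.inclusion h)
  top : C δ = ⊤

/-- `N` is limit over its substructure `S` (in `K_lam`). -/
def LimitOver (lam : Cardinal.{u}) {N : Type u} [L.Structure N] (S : L.Substructure N) : Prop :=
  ∃ (δ : Ordinal.{u}) (C : Ordinal.{u} → L.Substructure N),
    K.IsUniversalChain lam δ C ∧ C 0 = S

/-- `N` is a limit model (in `K_lam`). -/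
def IsLimitModel (lam : Cardinal.{u}) (N : Type u) [L.Structure N] : Prop :=
  ∃ S : L.Substructure N, K.LimitOver lam S

/-! ### Splitting, superstability, forking, symmetry -/

variable {K} in
/-- `p ∈ S(N)` does not `lam`-split over `M`, where `M` is embedded in `N` by `m`. The models
`M ≤_K N₁, N₂ ≤_K N` are substructures of `N`, and `f` is an isomorphism fixing `M` pointwise. -/
def NotSplits (lam : Cardinal.{u}) {M N : Type u} [L.Structure M] [L.Structure N]
    (m : M ↪[L] N) (p : K.OrbType N) : Prop :=
  K.IsEmb m ∧
    ∀ (N₁ N₂ : L.Substructure N) (h₁ : K.IsEmb N₁.subtype) (h₂ : K.IsEmb N₂.subtype)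
      (hN₂ : K.MemCard lam N₂), K.MemCard lam N₁ →
      K.Le m.toHom.range N₁ → K.Le m.toHom.range N₂ →
      ∀ f : N₁ ≃[L] N₂, (∀ x : N₁, (x : N) ∈ Set.range m → (f x : N) = x) →
        (p.restrict h₁).image f hN₂.1 = p.restrict h₂

/-- `lam`-superstability. -/
structure Superstable (lam : Cardinal.{u}) : Prop where
  ls_le : K.LS ≤ lam
  nonempty : ∃ (M : Type u) (_ : L.Structure M), K.MemCard lam M
  amalgamation : K.AmalgamationIn lam
  jointEmbedding : K.JointEmbeddingIn lam
  noMaximalModels : K.NoMaximalModelsIn lam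
  stable : K.StableIn lam
  localCharacter : ∀ (N : Type u) [L.Structure N] (δ : Ordinal.{u})
    (C : Ordinal.{u} → L.Substructure N), K.IsUniversalChain lam δ C →
    ∀ p : K.OrbType N, ∃ i < δ, NotSplits lam (C i).subtype p

variable {K} in
/-- `p ∈ S(N)` does not `lam`-fork over `M`, where `M` is embedded in `N` by `m`, and `M` and `N`
are limit models: there is `M₀ ≤_K M` in `K_lam` such that `M` is universal over `M₀` and `p` does
not `lam`-split over `M₀`. -/
def NotForks (lam : Cardinal.{u}) {M N : Type u} [L.Structure M] [L.Structure N]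
    (m : M ↪[L] N) (p : K.OrbType N) : Prop :=
  K.IsLimitModel lam M ∧ K.IsLimitModel lam N ∧ K.IsEmb m ∧
    ∃ M₀ : L.Substructure M, K.Universal lam M₀.subtype ∧ NotSplits lam (m.comp M₀.subtype) p

/-- For substructures `A`, `B` of `N` and `b ∈ N`: `A ≤_K B ≤_K N`, and `tp (b / B; N)` does not
`lam`-fork over `A`. -/
def TpNotForks (lam : Cardinal.{u}) {N : Type u} [L.Structure N] (A B : L.Substructure N)
    (b : N) : Prop :=
  ∃ (h : A ≤ B) (hB : K.IsEmb B.subtype),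
    NotForks lam (FirstOrder.Language.Substructure.inclusion h) (tp hB b)

/-- One half of the symmetry condition, for `M ≤_K N` and `a, b ∈ N`: there are limit models
`M_b ≤_K N_b` with `N ≤_K N_b`, `M ≤_K M_b`, `b ∈ M_b`, such that `tp (a / M_b; N_b)` does not
fork over `M`. The inclusion of `N` in `N_b` is given as a `K`-embedding `n`. -/
def SymmetryHalf (lam : Cardinal.{u}) {N : Type u} [L.Structure N] (M : L.Substructure N)
    (a b : N) : Prop :=
  ∃ (Nb : Type u) (_ : L.Structure Nb) (n : N ↪[L] Nb) (Mb : L.Substructure Nb),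
    K.IsEmb n ∧ K.Strong Mb ∧ K.IsLimitModel lam Nb ∧ K.IsLimitModel lam Mb ∧
      K.Le (M.map n.toHom) Mb ∧ n b ∈ Mb ∧ K.TpNotForks lam (M.map n.toHom) Mb (n a)

/-- `lam`-symmetry. -/
def HasSymmetry (lam : Cardinal.{u}) : Prop :=
  ∀ (N : Type u) [L.Structure N] (M : L.Substructure N),
    K.Strong M → K.IsLimitModel lam N → K.IsLimitModel lam M →
    ∀ a b : N, K.SymmetryHalf lam M a b ↔ K.SymmetryHalf lam M b a

end AbstractClass

namespace AbstractClass

open FirstOrder.Language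

variable {L : FirstOrder.Language.{u, u}} {K : AbstractClass L} {lam : Cardinal.{u}}

/-! ### Strong substructures and `K`-embeddings -/

section Basic

variable {M N P : Type u} [L.Structure M] [L.Structure N] [L.Structure P]

/-! The argument takes place in one model `C`, of size at most `lam⁺`, in which embeddings of models
in `K_lam` extend to larger models in `K_lam` and isomorphisms between submodels in `K_lam` extend
to automorphisms (`exists_monster`). Orbital types over such submodels are then orbits
(`Monster.tp_eq_iff`), and universality, nonsplitting and nonforking become the relations `Univ`,
`NS` and `NF` between submodels of `C`. Categoricity makes every model in `K_lam` a limit model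
(`Monster.isLimitModel`), so the limit clauses in forking and symmetry hold automatically, and any
two submodels in `K_lam` are conjugate.

The nonforking calculus rests on uniqueness (`NF_unique`): if two nonforking extensions differed,
copies of the disagreement could be stacked into an `ω`-chain that violates local character.
Transitivity and continuity follow. With symmetry, two models can be amalgamated so that a chosen
element on either side does not fork over the base (`exists_symmetric_amalgam`).

Disjointness comes from reduced triples: `(M, N, b)` such that `N` meets only in `M` any model over
which `b` does not fork from `M`. They exist over every `M` (`exists_reduced`). In a `lam⁺`-chain of
pairs, each nonreduced stage puts a new element of `N_i` into `M_{i+1}`; a closure argument finds a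
limit stage `β` at which this cannot happen, and `M_β` is conjugate to `M` because both are
`ω`-limits over a common base.

A reduced triple controls one element, while all of `M₁` has to avoid `M₂`. So triples `N ≤ Q ≤ P`
are iterated: `N` gains realizations of types but no element of `P`, and `Q` contains `N` while `a₂`
does not fork over `M₀` in `Q`. A chain of length `lam`, each step itself such a chain, ends in a
model universal over the first `N`. The first `N` contains a copy of `a₁` that does not fork over
`M₀` in `M₂`, and `M₁` is moved into the final model without moving that copy
(`exists_disjoint_amalgam`). -/

theorem isEmb_subtype {S : L.Substructure N} : K.IsEmb S.subtype ↔ K.Strong S := by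
  unfold IsEmb; rw [Substructure.range_subtype]

theorem IsEmb.mem_cod {f : M ↪[L] N} (h : K.IsEmb f) : K.Mem N := (K.mem_of_strong h).1

theorem IsEmb.mem_dom {f : M ↪[L] N} (h : K.IsEmb f) : K.Mem M :=
  K.mem_equiv f.equivRange.symm (K.mem_of_strong h).2

theorem isEmb_refl (h : K.Mem M) : K.IsEmb (Embedding.refl L M) :=
  K.isEmb_equiv (Language.Equiv.refl L M) h

theorem isEmb_inclusion (hK : K.IsAEC) {S T : L.Substructure N} (hS : K.Strong S)
    (hT : K.Strong T) (h : S ≤ T) : K.IsEmb (Substructure.inclusion h) := by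
  obtain ⟨_, h2⟩ := hK.coherence h hS hT
  exact h2

/-- This is the coherence axiom for embeddings: the ranges of `g.comp f` and `g` are nested strong
submodels of `P`, and `f` is their inclusion up to isomorphism. -/
theorem IsEmb.of_comp (hK : K.IsAEC) {g : N ↪[L] P} {f : M ↪[L] N} (hg : K.IsEmb g)
    (hgf : K.IsEmb (g.comp f)) : K.IsEmb f := by
  have hle : (g.comp f).toHom.range ≤ g.toHom.range := by
    rintro _ ⟨y, rfl⟩; exact ⟨f y, rfl⟩
  have h1 := isEmb_inclusion hK hgf hg hle
  have h2 := K.isEmb_comp (K.isEmb_equiv g.equivRange.symm (K.mem_of_strong hg).2)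
    (K.isEmb_comp h1 (K.isEmb_equiv (g.comp f).equivRange hgf.mem_dom))
  convert h2
  ext x
  apply g.injective
  simp only [Embedding.comp_apply, Language.Equiv.coe_toEmbedding]
  rw [← Embedding.equivRange_apply g (g.equivRange.symm _), Language.Equiv.apply_symm_apply]
  rfl

theorem IsEmb.codRestrict (hK : K.IsAEC) {f : M ↪[L] N} (hf : K.IsEmb f) {S : L.Substructure N}
    (hS : K.Strong S) (h : ∀ x, f x ∈ S) : K.IsEmb (f.codRestrict S h) :=
  IsEmb.of_comp hK (isEmb_subtype.2 hS) (by rwa [Embedding.subtype_comp_codRestrict])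

theorem IsEmb.strong_map {f : M ↪[L] N} (hf : K.IsEmb f) {S : L.Substructure M}
    (hS : K.Strong S) : K.Strong (S.map f.toHom) := by
  have h := K.isEmb_comp hf (isEmb_subtype.2 hS)
  unfold IsEmb at h
  convert h
  ext x
  simp [Substructure.mem_map]

theorem IsEmb.strong_comap (hK : K.IsAEC) {f : M ↪[L] N} (hf : K.IsEmb f) {T : L.Substructure N}
    (hT : K.Strong T) (h : T ≤ f.toHom.range) : K.Strong (T.comap f.toHom) := by
  let g : T ↪[L] M := f.equivRange.symm.toEmbedding.comp (Substructure.inclusion h)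
  have hg : ∀ x : T, f (g x) = x := fun x => by
    rw [← Embedding.equivRange_apply]
    simp only [g, Embedding.comp_apply, Language.Equiv.coe_toEmbedding,
      Language.Equiv.apply_symm_apply]
    rfl
  have h1 : f.comp g = T.subtype := by ext x; exact hg x
  have h2 : K.IsEmb g := IsEmb.of_comp hK hf (by rw [h1]; exact isEmb_subtype.2 hT)
  unfold IsEmb at h2
  convert h2
  ext x
  constructor
  · intro hx
    exact ⟨⟨f x, hx⟩, f.injective (hg _)⟩
  · rintro ⟨y, rfl⟩
    change f (g y) ∈ T
    rw [hg]; exact y.2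

theorem mk_map (f : M ↪[L] N) (S : L.Substructure M) : #(S.map f.toHom) = #S :=
  (Cardinal.mk_congr (f.substructureEquivMap S).toEquiv).symm

theorem mk_range (f : M ↪[L] N) : #f.toHom.range = #M :=
  (Cardinal.mk_congr f.equivRange.toEquiv).symm

theorem MemCard.equiv (h : K.MemCard lam M) (e : M ≃[L] N) : K.MemCard lam N :=
  ⟨K.mem_equiv e h.1, by rw [← h.2]; exact (Cardinal.mk_congr e.toEquiv).symm⟩

theorem mem_iSup_iff {ι : Type*} [Nonempty ι] {S : ι → L.Substructure N}
    (hdir : Directed (· ≤ ·) S) {x : N} : x ∈ ⨆ i, S i ↔ ∃ i, x ∈ S i :=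
  Substructure.mem_iSup_of_directed hdir

/-- Coherence turns plain inclusions between strong submodels into `Le`, as the union axiom demands.
Smallness of `ι` lets the index set lie in another universe, as initial segments of ordinals do. -/
theorem strong_iSup (hK : K.IsAEC) {ι : Type*} [Small.{u} ι] [Nonempty ι]
    {S : ι → L.Substructure N} (hdir : Directed (· ≤ ·) S) (hS : ∀ i, K.Strong (S i)) :
    K.Strong (⨆ i, S i) := by
  have e := (equivShrink.{u} ι).symm
  have : Nonempty (Shrink.{u} ι) := e.nonempty
  refine hK.union_strong (fun i : Shrink.{u} ι => S ((equivShrink.{u} ι).symm i)) _ ?_ ?_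
    (fun i => hS _)
  · intro i j
    obtain ⟨k, h1, h2⟩ := hdir ((equivShrink.{u} ι).symm i) ((equivShrink.{u} ι).symm j)
    refine ⟨equivShrink ι k, ?_, ?_⟩
    · exact hK.coherence (by simpa using h1) (hS _) (hS _)
    · exact hK.coherence (by simpa using h2) (hS _) (hS _)
  · ext x
    simp only [SetLike.mem_coe, Set.mem_iUnion]
    rw [mem_iSup_iff hdir]
    constructor
    · rintro ⟨i, hi⟩; exact ⟨equivShrink ι i, by simpa using hi⟩
    · rintro ⟨i, hi⟩; exact ⟨_, hi⟩

end Basic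

/-- `S` is a strong substructure of cardinality `lam`. -/
def IsSub (K : AbstractClass L) (lam : Cardinal.{u}) {N : Type u} [L.Structure N]
    (S : L.Substructure N) : Prop := K.Strong S ∧ #S = lam

/-! ### Submodels of cardinality `lam` and their unions -/

section Card

variable {M N : Type u} [L.Structure M] [L.Structure N]

theorem IsSub.memCard {S : L.Substructure N} (h : K.IsSub lam S) : K.MemCard lam S :=
  ⟨(K.mem_of_strong h.1).2, h.2⟩

theorem IsSub.isEmb {S : L.Substructure N} (h : K.IsSub lam S) : K.IsEmb S.subtype :=
  isEmb_subtype.2 h.1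

theorem IsSub.map {f : M ↪[L] N} (hf : K.IsEmb f) {S : L.Substructure M} (h : K.IsSub lam S) :
    K.IsSub lam (S.map f.toHom) := ⟨hf.strong_map h.1, by rw [mk_map, h.2]⟩

theorem IsEmb.isSub_range {f : M ↪[L] N} (hf : K.IsEmb f) (h : #M = lam) :
    K.IsSub lam f.toHom.range := ⟨hf, by rw [mk_range, h]⟩

theorem IsAEC.isLSCardinal (hK : K.IsAEC) : K.IsLSCardinal K.LS := csInf_mem hK.exists_ls

theorem IsAEC.aleph0_le (hK : K.IsAEC) (h : K.LS ≤ lam) : ℵ₀ ≤ lam :=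
  (le_add_self.trans hK.isLSCardinal.1).trans h

theorem IsAEC.exists_isSub (hK : K.IsAEC) (h : K.LS ≤ lam) (hN : K.Mem N) (hc : lam ≤ #N)
    (A : Set N) (hA : #A ≤ lam) : ∃ S : L.Substructure N, K.IsSub lam S ∧ A ⊆ S := by
  obtain ⟨B, hB⟩ := Cardinal.le_mk_iff_exists_set.1 hc
  obtain ⟨S, h1, h2, h3⟩ := hK.isLSCardinal.2 N hN (A ∪ B)
  have h0 := hK.aleph0_le h
  refine ⟨S, ⟨h1, le_antisymm ?_ ?_⟩, Set.subset_union_left.trans h2⟩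
  · refine h3.trans ?_
    refine Cardinal.add_le_of_le h0 ((Cardinal.mk_union_le _ _).trans ?_) h
    exact Cardinal.add_le_of_le h0 hA hB.le
  · rw [← hB]
    exact Cardinal.mk_le_mk_of_subset (Set.subset_union_right.trans h2)

theorem mk_iUnion_le_of_le {ι : Type*} [Small.{u} ι] (h0 : ℵ₀ ≤ lam)
    (hι : #(Shrink.{u} ι) ≤ lam) {S : ι → Set N} (hS : ∀ i, #(S i) ≤ lam) :
    #(⋃ i, S i) ≤ lam := by
  have : (⋃ i, S i) = ⋃ i : Shrink.{u} ι, S ((equivShrink.{u} ι).symm i) :=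
    ((equivShrink.{u} ι).symm.surjective.iUnion_comp S).symm
  rw [this]
  refine (Cardinal.mk_iUnion_le _).trans ?_
  refine (mul_le_mul' hι (ciSup_le' fun i => hS _)).trans ?_
  rw [Cardinal.mul_eq_self h0]

theorem isSub_iSup (hK : K.IsAEC) (h0 : ℵ₀ ≤ lam) {ι : Type*} [Small.{u} ι] [Nonempty ι]
    (hι : #(Shrink.{u} ι) ≤ lam) {S : ι → L.Substructure N}
    (hdir : Directed (· ≤ ·) S) (hS : ∀ i, K.IsSub lam (S i)) : K.IsSub lam (⨆ i, S i) := by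
  refine ⟨strong_iSup hK hdir fun i => (hS i).1, le_antisymm ?_ ?_⟩
  · have : ((⨆ i, S i : L.Substructure N) : Set N) = ⋃ i, (S i : Set N) := by
      ext x; simp [mem_iSup_iff hdir]
    change #((⨆ i, S i : L.Substructure N) : Set N) ≤ lam
    rw [this]
    exact mk_iUnion_le_of_le h0 hι fun i => (hS i).2.le
  · obtain ⟨i⟩ := ‹Nonempty ι›
    rw [← (hS i).2]
    exact Cardinal.mk_le_mk_of_subset (le_iSup S i : S i ≤ _)

theorem mk_shrink_Iio_le {j : Ordinal.{u}} (hj : j < (Order.succ lam).ord) :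
    #(Shrink.{u} (Set.Iio j)) ≤ lam := by
  rw [← Order.lt_succ_iff, ← Cardinal.lift_lt.{u, u+1}, Cardinal.lift_mk_shrink'',
    Cardinal.mk_Iio_ordinal, Cardinal.lift_lt]
  exact Cardinal.lt_ord.1 hj

end Card

/-! ### Transfinite recursion -/

/-- Transfinite construction of a chain: `G j` is a prescribed kind of extension of `F j`, and
`F j` is a bound of `⟨G i : i < j⟩`. -/
theorem exists_chain {α : Type*} [Nonempty α] (κ : Ordinal.{u}) (r : α → α → Prop)
    (htrans : ∀ x y z, r x y → r y z → r x z) (I J : Ordinal.{u} → α → Prop)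
    (t : Ordinal.{u} → α → α → Prop)
    (ht : ∀ i < κ, ∀ p, I i p → ∃ q, J i q ∧ r p q ∧ t i p q)
    (S : ∀ j : Ordinal.{u}, (Set.Iio j → α) → α → Prop)
    (hS : ∀ j < κ, ∀ g : Set.Iio j → α, (∀ i : Set.Iio j, J i (g i)) →
      (∀ i i' : Set.Iio j, i < i' → r (g i) (g i')) →
      ∃ q, I j q ∧ S j g q ∧ ∀ i, g i = q ∨ r (g i) q) :
    ∃ F G : Ordinal.{u} → α, ∀ j < κ, I j (F j) ∧ J j (G j) ∧ r (F j) (G j) ∧ t j (F j) (G j) ∧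
      S j (fun i => G i) (F j) ∧ (∀ i < j, G i = F j ∨ r (G i) (F j)) ∧
      ∀ i < j, r (F i) (F j) ∧ r (G i) (G j) := by
  classical
  choose! nx hnx using ht
  choose! sp hsp using hS
  -- Only `G` needs recursion: `F j` is computed from the earlier values of `G`.
  let G : Ordinal.{u} → α := fun j => WellFoundedLT.fix (motive := fun _ => α) (fun j rec => nx j (sp j fun i : Set.Iio j => rec i i.2)) j
  let F : Ordinal.{u} → α := fun j => sp j fun i => G i
  have hG : ∀ j, G j = nx j (F j) := fun j => by
    simp only [G, F]
    rw [WellFoundedLT.fix_eq]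
  have main : ∀ j, j < κ → (I j (F j) ∧ J j (G j) ∧ r (F j) (G j) ∧ t j (F j) (G j) ∧
      S j (fun i => G i) (F j) ∧ (∀ i < j, G i = F j ∨ r (G i) (F j)) ∧
      ∀ i < j, r (F i) (F j) ∧ r (G i) (G j)) := by
    intro j
    induction j using WellFoundedLT.induction with
    | _ j ih =>
    intro hj
    have h1 := hsp j hj (fun i => G i) (fun i => (ih i i.2 (i.2.trans hj)).2.1)
      (fun i i' h => ((ih i' i'.2 (i'.2.trans hj)).2.2.2.2.2.2 i h).2)
    have h2 := hnx j hj (F j) h1.1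
    rw [← hG] at h2
    have h3 : ∀ i < j, G i = F j ∨ r (G i) (F j) := fun i hi => h1.2.2 ⟨i, hi⟩
    refine ⟨h1.1, h2.1, h2.2.1, h2.2.2, h1.2.1, h3, fun i hi => ?_⟩
    have h4 := (ih i hi (hi.trans hj)).2.2.1
    constructor
    · rcases h3 i hi with h | h
      · rwa [h] at h4
      · exact htrans _ _ _ h4 h
    · rcases h3 i hi with h | h
      · rw [h]; exact h2.2.1
      · exact htrans _ _ _ h h2.2.1
  exact ⟨F, G, main⟩

/-! ### Structures on subsets of a fixed set, and unions of chains -/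

/-- An `L`-structure whose universe is a subset of `U`. -/
structure PStr (L : FirstOrder.Language.{u, u}) (U : Type u) where
  carrier : Set U
  str : L.Structure carrier

attribute [instance] PStr.str

variable {U : Type u}

/-- The inclusion of `P` in `Q` is a `K`-embedding. -/
def PStr.Ext (K : AbstractClass L) (P Q : PStr L U) : Prop :=
  ∃ f : P.carrier ↪[L] Q.carrier, K.IsEmb f ∧ ∀ x, (f x : U) = x

theorem PStr.Ext.refl {P : PStr L U} (h : K.Mem P.carrier) : P.Ext K P :=
  ⟨Embedding.refl L _, isEmb_refl h, fun _ => rfl⟩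

theorem PStr.Ext.trans {P Q R : PStr L U} (h : P.Ext K Q) (h' : Q.Ext K R) : P.Ext K R := by
  obtain ⟨f, hf, hf'⟩ := h
  obtain ⟨g, hg, hg'⟩ := h'
  exact ⟨g.comp f, K.isEmb_comp hg hf, fun x => by rw [Embedding.comp_apply, hg', hf']⟩

theorem exists_pStr_of_injective {N : Type*} [L.Structure N] (φ : N → U)
    (hφ : Function.Injective φ) :
    ∃ (Q : PStr L U) (e : N ≃[L] Q.carrier), ∀ x, (e x : U) = φ x :=
  let e := Equiv.ofInjective φ hφ
  ⟨⟨Set.range φ, e.inducedStructure⟩, e.inducedStructureEquiv, fun _ => rfl⟩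

/-- The carrier of `P` leaves `#U` points unused, which is room for the new points of `N`.
Extensions thus become literal inclusions of subsets of `U`, so chains need no system of connecting
maps. -/
theorem PStr.exists_extension [Infinite U] (P : PStr L U) {N : Type u} [L.Structure N]
    (j : P.carrier ↪[L] N) (hN : #N < #U) :
    ∃ (Q : PStr L U) (e : N ≃[L] Q.carrier), ∀ x, (e (j x) : U) = x := by
  classical
  have h1 : #P.carrier < #U := (Cardinal.mk_le_of_injective j.injective).trans_lt hN
  have h2 : #N ≤ #(P.carrierᶜ : Set U) := by
    rw [Cardinal.mk_compl_of_infinite _ h1]; exact hN.le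
  obtain ⟨g⟩ := Cardinal.le_def _ _ |>.1 h2
  let φ : N → U := fun n => if h : ∃ x, j x = n then (h.choose : U) else g n
  have hj : ∀ x, φ (j x) = x := fun x => by
    have h : ∃ y, j y = j x := ⟨x, rfl⟩
    simp only [φ, dif_pos h]
    rw [j.injective h.choose_spec]
  have hn : ∀ n, (¬ ∃ x, j x = n) → φ n = g n := fun n h => by simp only [φ, dif_neg h]
  have hφ : Function.Injective φ := by
    intro a b hab
    by_cases ha : ∃ x, j x = a <;> by_cases hb : ∃ x, j x = b
    · obtain ⟨x, rfl⟩ := ha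
      obtain ⟨y, rfl⟩ := hb
      rw [hj, hj] at hab
      rw [Subtype.ext hab]
    · obtain ⟨x, rfl⟩ := ha
      rw [hj, hn b hb] at hab
      exact ((g b).2 (hab ▸ x.2)).elim
    · obtain ⟨x, rfl⟩ := hb
      rw [hj, hn a ha] at hab
      exact ((g a).2 (hab ▸ x.2)).elim
    · rw [hn a ha, hn b hb] at hab
      exact g.injective (Subtype.ext hab)
  obtain ⟨Q, e, he⟩ := exists_pStr_of_injective (L := L) φ hφ
  exact ⟨Q, e, fun x => by rw [he, hj]⟩

/-- The direct limit, copied onto the union of the carriers. The connecting maps commute because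
each is determined by its values in `U`. -/
theorem PStr.exists_union (hK : K.IsAEC) {ι : Type*} [Small.{u} ι] [Nonempty ι] [LinearOrder ι]
    (P : ι → PStr L U) (h : ∀ i j, i ≤ j → (P i).Ext K (P j)) :
    ∃ Q : PStr L U, Q.carrier = ⋃ i, (P i).carrier ∧ ∀ i, (P i).Ext K Q := by
  classical
  choose f hf hfx using h
  let G : ι → Type u := fun i => (P i).carrier
  have hcoh : ∀ i (x : G i), f i i le_rfl x = x := fun i x => Subtype.ext (hfx _ _ _ _)
  have hds : DirectedSystem G fun i j h => f i j h :=
    ⟨fun i x => hcoh i x, fun k j i hij hjk x => Subtype.ext (by rw [hfx, hfx, hfx])⟩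
  let D := Language.DirectLimit G f
  have hex : ∀ z : D, ∃ i, ∃ x : G i, DirectLimit.of L ι G f i x = z := DirectLimit.exists_of
  choose ind rep hrep using hex
  let φ : D → U := fun z => (rep z : U)
  have hφ : ∀ i (x : G i), φ (DirectLimit.of L ι G f i x) = x := by
    intro i x
    obtain ⟨z, hz⟩ : ∃ z, z = DirectLimit.of L ι G f i x := ⟨_, rfl⟩
    rw [← hz]
    have h1 := hrep z
    obtain ⟨k, hk1, hk2⟩ : ∃ k, ind z ≤ k ∧ i ≤ k := ⟨max (ind z) i, le_max_left _ _, le_max_right _ _⟩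
    rw [← DirectLimit.of_f (hij := hk1)] at h1
    rw [← DirectLimit.of_f (hij := hk2), ← h1] at hz
    have h1 := hz
    have h2 := (DirectLimit.of L ι G f k).injective h1
    have h3 := congrArg (Subtype.val) h2
    rw [hfx, hfx] at h3
    exact h3
  have hinj : Function.Injective φ := by
    intro a b hab
    have h1 := hrep a
    have h2 := hrep b
    obtain ⟨k, hk1, hk2⟩ : ∃ k, ind a ≤ k ∧ ind b ≤ k := ⟨max _ _, le_max_left _ _, le_max_right _ _⟩
    rw [← DirectLimit.of_f (hij := hk1)] at h1
    rw [← DirectLimit.of_f (hij := hk2)] at h2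
    rw [← h1, ← h2]
    congr 1
    apply Subtype.ext
    rw [hfx, hfx]
    exact hab
  obtain ⟨Q, E, hE⟩ := exists_pStr_of_injective (L := L) φ hinj
  let u : ∀ i, (P i).carrier ↪[L] Q.carrier := fun i =>
    E.toEmbedding.comp (DirectLimit.of L ι G f i)
  have hu : ∀ i x, ((u i x : Q.carrier) : U) = x := fun i x => (hE _).trans (hφ i x)
  have hQ : Q.carrier = ⋃ i, (P i).carrier := by
    ext x
    simp only [Set.mem_iUnion]
    constructor
    · intro hx
      obtain ⟨z, hz⟩ := E.surjective ⟨x, hx⟩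
      have h1 := hE z
      rw [hz] at h1
      exact ⟨ind z, by rw [show x = φ z from h1]; exact (rep z).2⟩
    · rintro ⟨i, hi⟩
      have h1 := (u i ⟨x, hi⟩).2
      rwa [hu] at h1
  have hcomp : ∀ i j (hij : i ≤ j), (u j).comp (f i j hij) = u i := fun i j hij => by
    ext x
    rw [Embedding.comp_apply, hu, hfx, hu]
  have hle : ∀ i j, i ≤ j → K.Le (u i).toHom.range (u j).toHom.range := by
    intro i j hij
    have h1 : (u i).toHom.range ≤ (u j).toHom.range := by
      rw [← hcomp i j hij]
      rintro _ ⟨x, rfl⟩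
      exact ⟨f i j hij x, rfl⟩
    refine ⟨h1, ?_⟩
    have h2 := K.isEmb_comp (K.isEmb_equiv (u j).equivRange (hf i j hij).mem_cod)
      (K.isEmb_comp (hf i j hij)
        (K.isEmb_equiv (u i).equivRange.symm (K.mem_equiv (u i).equivRange (hf i j hij).mem_dom)))
    convert h2
    ext x
    obtain ⟨y, rfl⟩ := (u i).equivRange.surjective x
    rw [Embedding.comp_apply, Embedding.comp_apply, Language.Equiv.coe_toEmbedding,
      Language.Equiv.coe_toEmbedding, Language.Equiv.symm_apply_apply, Embedding.equivRange_apply,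
      ← Embedding.comp_apply, hcomp]
    rfl
  obtain ⟨i0⟩ := ‹Nonempty ι›
  have : Nonempty (Shrink.{u} ι) := ⟨equivShrink ι i0⟩
  have hmain := hK.union_mem (fun i : Shrink.{u} ι => (u ((equivShrink.{u} ι).symm i)).toHom.range)
    (fun i j => by
      refine ⟨equivShrink ι (max ((equivShrink.{u} ι).symm i) ((equivShrink.{u} ι).symm j)), ?_, ?_⟩
      · apply hle; simp
      · apply hle; simp)
    (by
      ext x
      simp only [Set.mem_iUnion, Set.mem_univ, iff_true]
      have hx : (x : U) ∈ ⋃ i, (P i).carrier := hQ ▸ x.2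
      obtain ⟨i, hi⟩ := Set.mem_iUnion.1 hx
      exact ⟨equivShrink ι i, ⟨x, by simpa using hi⟩, Subtype.ext (hu _ _)⟩)
  refine ⟨Q, hQ, fun i => ⟨u i, ?_, hu i⟩⟩
  have := hmain.2 (equivShrink ι i)
  rwa [Equiv.symm_apply_apply] at this

theorem PStr.memCard_of_union (h0 : ℵ₀ ≤ lam) {ι : Type*} [Small.{u} ι] [Nonempty ι]
    (hι : #(Shrink.{u} ι) ≤ lam) {P : ι → PStr L U} {Q : PStr L U}
    (hP : ∀ i, K.MemCard lam (P i).carrier)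
    (hQ : Q.carrier = ⋃ i, (P i).carrier) (h : ∀ i, (P i).Ext K Q) : K.MemCard lam Q.carrier := by
  obtain ⟨i⟩ := ‹Nonempty ι›
  obtain ⟨f, hf, -⟩ := h i
  refine ⟨hf.mem_cod, le_antisymm ?_ ?_⟩
  · rw [hQ]
    exact mk_iUnion_le_of_le h0 hι fun i => (hP i).2.le
  · rw [← (hP i).2]
    exact Cardinal.mk_le_of_injective f.injective

/-! ### Orbital types and amalgamation -/

theorem IsAEC.exists_isSub_range (hK : K.IsAEC) (hls : K.LS ≤ lam) {X N : Type u} [L.Structure X]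
    [L.Structure N] (hN : K.Mem N) (f : X ↪[L] N) (hX : #X = lam) (A : Set N) (hA : #A ≤ lam) :
    ∃ S : L.Substructure N, K.IsSub lam S ∧ (∀ x, f x ∈ S) ∧ A ⊆ S := by
  obtain ⟨S, h1, h2⟩ := hK.exists_isSub hls hN
    (hX ▸ Cardinal.mk_le_of_injective f.injective) (Set.range f ∪ A)
    ((Cardinal.mk_union_le _ _).trans
      (Cardinal.add_le_of_le (hK.aleph0_le hls) (Cardinal.mk_range_le.trans hX.le) hA))
  exact ⟨S, h1, fun x => h2 (Or.inl ⟨x, rfl⟩), Set.subset_union_right.trans h2⟩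

theorem tp_comp {Y X Z : Type u} [L.Structure Y] [L.Structure X] [L.Structure Z] {w : Y ↪[L] X}
    (hw : K.IsEmb w) {u : X ↪[L] Z} (hu : K.IsEmb u) (x : X) :
    tp (K.isEmb_comp hu hw) (u x) = tp hw x :=
  (Quot.sound ⟨Z, _, u, Embedding.refl L Z, hu, isEmb_refl hu.mem_cod, fun _ => rfl, rfl⟩ :
    tp hw x = _).symm

theorem tp_congr {Y X : Type u} [L.Structure Y] [L.Structure X] {w w' : Y ↪[L] X}
    (hw : K.IsEmb w) (hw' : K.IsEmb w') (h : w = w') (x : X) : tp hw x = tp hw' x := by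
  subst h; rfl

theorem restrict_tp {Y' Y X : Type u} [L.Structure Y'] [L.Structure Y] [L.Structure X]
    {w : Y ↪[L] X} (hw : K.IsEmb w) {g : Y' ↪[L] Y} (hg : K.IsEmb g) (x : X) :
    (tp hw x).restrict hg = tp (K.isEmb_comp hw hg) x := rfl

section

variable (hK : K.IsAEC) (hls : K.LS ≤ lam) (hap : K.AmalgamationIn lam)
  {Y X : Type u} [L.Structure Y] [L.Structure X]

/-- The triple `q` can be amalgamated with `x ∈ X` over `Y`, inside `K_lam`. -/
def AmalgamatesWith (lam : Cardinal.{u}) (w : Y ↪[L] X) (x : X) (q : K.PreType Y) : Prop :=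
  ∃ (S : L.Substructure q.N) (hS : ∀ y, q.emb y ∈ S) (hp : q.pt ∈ S) (Z : Type u)
    (_ : L.Structure Z) (u : X ↪[L] Z) (v : S ↪[L] Z), K.IsSub lam S ∧ K.MemCard lam Z ∧
      K.IsEmb u ∧ K.IsEmb v ∧ (∀ y, v ⟨q.emb y, hS y⟩ = u (w y)) ∧ v ⟨q.pt, hp⟩ = u x

include hK hls hap in
-- Equality of types is only the equivalence generated by atomic steps, and these may pass through
-- models of any size. Each step is cut down to size `lam` by Löwenheim-Skolem and then absorbed by
-- amalgamation in `K_lam`.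
theorem AmalgamatesWith.of_atomicEquiv {w : Y ↪[L] X} {x : X} (hY : #Y = lam)
    {q q' : K.PreType Y} {P : Type u} [L.Structure P] {f : q.N ↪[L] P} {g : q'.N ↪[L] P}
    (hf : K.IsEmb f) (hg : K.IsEmb g) (h : ∀ y, f (q.emb y) = g (q'.emb y))
    (hpt : f q.pt = g q'.pt) (hq : AmalgamatesWith lam w x q) : AmalgamatesWith lam w x q' := by
  obtain ⟨S, hS, hp, Z, _, u, v, hSS, hZ, hu, hv, huv, hx⟩ := hq
  have h0 := hK.aleph0_le hls
  obtain ⟨S', hS', h1, h2⟩ := hK.exists_isSub_range hls q'.isEmb.mem_cod q'.emb hY {q'.pt}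
    (by rw [Cardinal.mk_singleton]; exact Cardinal.one_le_aleph0.trans h0)
  obtain ⟨T, hT, h3, h4⟩ := hK.exists_isSub_range hls hf.mem_cod (f.comp S.subtype) hSS.2
    (Set.range (g.comp S'.subtype)) (Cardinal.mk_range_le.trans hS'.2.le)
  have ha := (K.isEmb_comp hf hSS.isEmb).codRestrict hK hT.1 h3
  have h4' : ∀ x, (g.comp S'.subtype) x ∈ T := fun x => h4 ⟨x, rfl⟩
  have hb := (K.isEmb_comp hg hS'.isEmb).codRestrict hK hT.1 h4'
  obtain ⟨Z', _, t, z, hZ', ht, hz, htz⟩ := hap _ _ _ _ _ hSS.memCard hT.memCard hZ ha hv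
  refine ⟨S', h1, h2 rfl, Z', _, z.comp u, t.comp ((g.comp S'.subtype).codRestrict T h4'),
    hS', hZ', K.isEmb_comp hz hu, K.isEmb_comp ht hb, fun y => ?_, ?_⟩
  · rw [Embedding.comp_apply, Embedding.comp_apply, ← huv, ← htz]
    congr 1
    apply Subtype.ext
    exact (h y).symm
  · rw [Embedding.comp_apply, Embedding.comp_apply, ← hx, ← htz]
    congr 1
    apply Subtype.ext
    exact hpt.symm

include hK hls hap in
/-- Triples of the same type over `Y ∈ K_lam` can be amalgamated inside `K_lam`. -/
theorem exists_amalgam_of_tp_eq (hY : K.MemCard lam Y) (hX : K.MemCard lam X)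
    {D : Type u} [L.Structure D] {w : Y ↪[L] X} (hw : K.IsEmb w) {w' : Y ↪[L] D} (hw' : K.IsEmb w')
    {x : X} {c : D} (h : tp hw x = tp hw' c) {B : L.Substructure D} (hB : K.IsSub lam B)
    (hYB : ∀ y, w' y ∈ B) (hc : c ∈ B) :
    ∃ (Z : Type u) (_ : L.Structure Z) (u : X ↪[L] Z) (v : B ↪[L] Z), K.MemCard lam Z ∧
      K.IsEmb u ∧ K.IsEmb v ∧ (∀ y, v ⟨w' y, hYB y⟩ = u (w y)) ∧ v ⟨c, hc⟩ = u x := by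
  have h0 := hK.aleph0_le hls
  have hinv : ∀ q q' : K.PreType Y, K.AtomicEquiv Y q q' →
      AmalgamatesWith lam w x q = AmalgamatesWith lam w x q' := by
    rintro q q' ⟨P, _, f, g, hf, hg, h1, h2⟩
    exact propext ⟨fun h => h.of_atomicEquiv hK hls hap hY.2 hf hg h1 h2,
      fun h => h.of_atomicEquiv hK hls hap hY.2 hg hf (fun y => (h1 y).symm) h2.symm⟩
  have h1 : AmalgamatesWith lam w x ⟨X, w, hw, x⟩ := by
    have htop : K.IsSub lam (⊤ : L.Substructure X) :=
      ⟨K.strong_refl hX.1, by rw [← hX.2]; exact Cardinal.mk_congr (Substructure.topEquiv).toEquiv⟩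
    exact ⟨⊤, fun _ => trivial, trivial, X, _, Embedding.refl L X,
      (⊤ : L.Substructure X).subtype, htop, hX, isEmb_refl hX.1, htop.isEmb, fun _ => rfl, rfl⟩
  have h2 : AmalgamatesWith lam w x ⟨D, w', hw', c⟩ := by
    -- Invariance under atomic steps makes `AmalgamatesWith` a predicate on types; it holds
    -- trivially for the triple of `x` itself.
    have := congrArg (Quot.lift (AmalgamatesWith lam w x) hinv) h
    exact this.mp h1
  obtain ⟨S, hS, hp, Z, _, u, v, hSS, hZ, hu, hv, huv, hx⟩ := h2
  obtain ⟨T, hT, h3, h4⟩ := hK.exists_isSub_range hls hw'.mem_cod S.subtype hSS.2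
    (B : Set D) hB.2.le
  have hST : S ≤ T := fun s hs => h3 ⟨s, hs⟩
  have hBT : B ≤ T := h4
  obtain ⟨Z', _, t, z, hZ', ht, hz, htz⟩ := hap _ _ _ _ _ hSS.memCard hT.memCard hZ
    (isEmb_inclusion hK hSS.1 hT.1 hST) hv
  refine ⟨Z', _, z.comp u, t.comp (Substructure.inclusion hBT), hZ', K.isEmb_comp hz hu,
    K.isEmb_comp ht (isEmb_inclusion hK hB.1 hT.1 hBT), fun y => ?_, ?_⟩
  · rw [Embedding.comp_apply, Embedding.comp_apply, ← huv, ← htz]; rfl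
  · rw [Embedding.comp_apply, Embedding.comp_apply, ← hx, ← htz]; rfl

include hK hls hap in
/-- Every type over `Y` is realized in some extension of `X`, inside `K_lam`. -/
theorem exists_realizing (hY : K.MemCard lam Y) (hX : K.MemCard lam X) {w : Y ↪[L] X}
    (hw : K.IsEmb w) (p : K.OrbType Y) :
    ∃ (Z : Type u) (_ : L.Structure Z) (u : X ↪[L] Z) (hu : K.IsEmb u) (z : Z),
      K.MemCard lam Z ∧ tp (K.isEmb_comp hu hw) z = p := by
  obtain ⟨q, rfl⟩ := Quot.exists_rep p
  have h0 := hK.aleph0_le hls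
  obtain ⟨S, hS, h1, h2⟩ := hK.exists_isSub_range hls q.isEmb.mem_cod q.emb hY.2 {q.pt}
    (by rw [Cardinal.mk_singleton]; exact Cardinal.one_le_aleph0.trans h0)
  have hs := q.isEmb.codRestrict hK hS.1 h1
  obtain ⟨Z, _, u, v, hZ, hu, hv, huv⟩ := hap _ _ _ _ _ hY hX hS.memCard hw hs
  refine ⟨Z, _, u, hu, v ⟨q.pt, h2 rfl⟩, hZ, ?_⟩
  rw [tp_congr _ (K.isEmb_comp hv hs) (by ext y; exact huv y), tp_comp hs hv,
    ← tp_comp hs hS.isEmb]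
  rfl

end

/-! ### Enumerations, bounds -/

theorem exists_enum {α : Type*} [Nonempty α] (h : Nonempty (α ↪ lam.ord.ToType)) :
    ∃ e : Ordinal.{u} → α, ∀ a, ∃ k < lam.ord, e k = a := by
  obtain ⟨f⟩ := h
  let g : α → Ordinal.{u} := fun a => (Ordinal.ToType.mk.symm (f a)).1
  have hg : Function.Injective g := fun a b hab => f.injective (Ordinal.ToType.mk.symm.injective (Subtype.ext hab))
  refine ⟨Function.invFun g, fun a => ⟨g a, ?_, Function.leftInverse_invFun hg a⟩⟩
  exact (Ordinal.ToType.mk.symm (f a)).2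

theorem exists_enum_of_mk_le {α : Type u} [Nonempty α] (h : #α ≤ lam) :
    ∃ e : Ordinal.{u} → α, ∀ a, ∃ k < lam.ord, e k = a :=
  exists_enum (by rwa [← Cardinal.le_def, Cardinal.mk_toType, Cardinal.card_ord])

theorem exists_enum_orbType {M : Type u} [L.Structure M] [Nonempty (K.OrbType M)]
    (hst : K.StableIn lam) (hM : K.MemCard lam M) :
    ∃ e : Ordinal.{u} → K.OrbType M, ∀ a, ∃ k < lam.ord, e k = a := by
  refine exists_enum ?_
  rw [← Cardinal.lift_mk_le', Cardinal.mk_toType, Cardinal.card_ord]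
  exact (Cardinal.lift_id'.{u, u + 1} _).trans_le (hst M hM)

theorem exists_ordinal_bound (h0 : ℵ₀ ≤ lam) {α : Type u} (hα : #α ≤ lam) (f : α → Ordinal.{u})
    (hf : ∀ a, f a < (Order.succ lam).ord) : ∃ j < (Order.succ lam).ord, ∀ a, f a ≤ j :=
  ⟨⨆ a, f a, Ordinal.iSup_lt_of_lt_cof
    (by rw [(Cardinal.isRegular_succ h0).cof_ord]; exact Order.lt_succ_iff.2 hα) hf, fun a => Ordinal.le_iSup f a⟩

theorem ord_lt_ord_succ : lam.ord < (Order.succ lam).ord :=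
  Cardinal.ord_lt_ord.2 (Order.lt_succ lam)

theorem add_one_lt_ord_succ (h0 : ℵ₀ ≤ lam) {j : Ordinal.{u}} (h : j < (Order.succ lam).ord) :
    j + 1 < (Order.succ lam).ord :=
  (Cardinal.isSuccLimit_ord (h0.trans (Order.le_succ lam))).add_one_lt h

theorem add_one_lt_ord (h0 : ℵ₀ ≤ lam) {j : Ordinal.{u}} (h : j < lam.ord) :
    j + 1 < lam.ord := (Cardinal.isSuccLimit_ord h0).add_one_lt h

/-! ### Models realizing many types -/

section

variable {U : Type u}

/-- Stage `0` returns the initial model; every other stage, successors included, returns the union.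
-/
theorem PStr.exists_sup (hK : K.IsAEC) (h0 : ℵ₀ ≤ lam) {P₀ : PStr L U}
    (hP₀ : K.MemCard lam P₀.carrier) {j : Ordinal.{u}} (hj : j < (Order.succ lam).ord)
    (g : Set.Iio j → PStr L U) (hg : ∀ i, K.MemCard lam (g i).carrier ∧ P₀.Ext K (g i))
    (hgg : ∀ i i', i < i' → (g i).Ext K (g i')) :
    ∃ Q : PStr L U, (K.MemCard lam Q.carrier ∧ P₀.Ext K Q) ∧
      ((0 < j → Q.carrier = ⋃ i, (g i).carrier) ∧ (j = 0 → Q = P₀)) ∧ ∀ i, (g i).Ext K Q := by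
  rcases eq_or_ne j 0 with rfl | h
  · exact ⟨P₀, ⟨hP₀, PStr.Ext.refl hP₀.1⟩, ⟨fun h => (lt_irrefl _ h).elim, fun _ => rfl⟩,
      fun i => by simpa using i.2⟩
  · have h' := pos_iff_ne_zero.2 h
    have : Nonempty (Set.Iio j) := ⟨⟨0, h'⟩⟩
    obtain ⟨Q, hQ1, hQ2⟩ := PStr.exists_union hK g (fun i i' hi => by
      rcases hi.eq_or_lt with rfl | hi
      · exact PStr.Ext.refl (hg i).1.1
      · exact hgg i i' hi)
    exact ⟨Q, ⟨PStr.memCard_of_union h0 (mk_shrink_Iio_le hj) (fun i => (hg i).1) hQ1 hQ2,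
      (hg ⟨0, h'⟩).2.trans (hQ2 _)⟩, ⟨fun _ => hQ1, fun h'' => (h h'').elim⟩, hQ2⟩

variable (hK : K.IsAEC) (hls : K.LS ≤ lam) (hap : K.AmalgamationIn lam) (hst : K.StableIn lam)

theorem infinite_succ_out (h0 : ℵ₀ ≤ lam) : Infinite (Order.succ lam).out := by
  rw [Cardinal.infinite_iff, Cardinal.mk_out]; exact h0.trans (Order.le_succ lam)

include hK hls hap hst in
/-- Every `M ∈ K_lam` has an extension in `K_lam` that realizes all types over `M`. -/
theorem exists_realizing_all {M : Type u} [L.Structure M] (hM : K.MemCard lam M) :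
    ∃ (N : Type u) (_ : L.Structure N) (m : M ↪[L] N) (hm : K.IsEmb m), K.MemCard lam N ∧
      ∀ p : K.OrbType M, ∃ x : N, tp hm x = p := by
  have h0 := hK.aleph0_le hls
  have hMne : Nonempty M := Cardinal.mk_ne_zero_iff.1
    (by rw [hM.2]; exact (Cardinal.aleph0_pos.trans_le h0).ne')
  have : Nonempty (K.OrbType M) := ⟨tp (isEmb_refl hM.1) hMne.some⟩
  obtain ⟨e, he⟩ := exists_enum_orbType hst hM
  let U := (Order.succ lam).out
  have hU : #U = Order.succ lam := Cardinal.mk_out _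
  have : Infinite U := infinite_succ_out h0
  obtain ⟨φ⟩ : Nonempty (M ↪ U) := by
    rw [← Cardinal.le_def, hU, hM.2]; exact Order.le_succ lam
  obtain ⟨P₀, e₀, -⟩ := exists_pStr_of_injective (L := L) φ φ.injective
  have hP₀ : K.MemCard lam P₀.carrier := hM.equiv e₀
  have : Nonempty (PStr L U) := ⟨P₀⟩
  let I : PStr L U → Prop := fun P => K.MemCard lam P.carrier ∧ P₀.Ext K P
  -- Stage `k` realizes the `k`-th type over `M`. By stability `lam` stages exhaust the types, so
  -- the model wanted is the one at stage `lam.ord`.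
  obtain ⟨F, G, hFG⟩ := exists_chain (Order.succ lam).ord (PStr.Ext K (U := U))
    (fun _ _ _ h h' => h.trans h') (fun _ => I) (fun _ => I)
    (fun k P Q => ∃ (m : M ↪[L] Q.carrier) (hm : K.IsEmb m), (∀ y, (m y : U) = e₀ y) ∧
      ∃ x, tp hm x = e k)
    (by
      rintro i - P ⟨hP, f, hf, hfx⟩
      obtain ⟨Z, _, u, hu, z, hZ, hz⟩ := exists_realizing hK hls hap hM hP
        (K.isEmb_comp hf (K.isEmb_equiv e₀ hM.1)) (e i)
      obtain ⟨Q, eQ, heQ⟩ := P.exists_extension u (by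
        rw [hZ.2, hU]; exact Order.lt_succ lam)
      have hE := K.isEmb_equiv eQ hZ.1
      have hPQ : P.Ext K Q := ⟨eQ.toEmbedding.comp u, K.isEmb_comp hE hu, heQ⟩
      refine ⟨Q, ⟨hZ.equiv eQ, PStr.Ext.trans ⟨f, hf, hfx⟩ hPQ⟩, hPQ, _,
        K.isEmb_comp hE (K.isEmb_comp hu (K.isEmb_comp hf (K.isEmb_equiv e₀ hM.1))), ?_, eQ z, ?_⟩
      · intro y
        exact (heQ _).trans (hfx _)
      · exact (tp_comp _ hE z).trans hz)
    (fun _ _ _ => True)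
    (by
      intro j hj g hg hgg
      obtain ⟨Q, h1, -, h2⟩ := PStr.exists_sup hK h0 hP₀ hj g hg hgg
      exact ⟨Q, h1, trivial, fun i => Or.inr (h2 i)⟩)
  obtain ⟨⟨hQ, f, hf, hfx⟩, -, -, -, -, hlt, -⟩ := hFG lam.ord ord_lt_ord_succ
  refine ⟨(F lam.ord).carrier, _, f.comp e₀.toEmbedding, K.isEmb_comp hf (K.isEmb_equiv e₀ hM.1),
    hQ, fun p => ?_⟩
  obtain ⟨k, hk, rfl⟩ := he p
  obtain ⟨-, hGk, -, ⟨m, hm, hmy, x, hx⟩, -⟩ := hFG k (hk.trans ord_lt_ord_succ)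
  obtain ⟨f', hf', hfx'⟩ : (G k).Ext K (F lam.ord) := by
    rcases hlt k hk with h | h
    · rw [h]; exact PStr.Ext.refl hQ.1
    · exact h
  refine ⟨f' x, ?_⟩
  rw [← hx, ← tp_comp hm hf']
  apply tp_congr
  ext y
  rw [Embedding.comp_apply, Embedding.comp_apply, hfx, hfx', hmy]
  rfl

include hK hls hap hst in
/-- There is a model of cardinality at most `lam⁺` that realizes all types over its submodels
in `K_lam`. -/
theorem exists_saturated (hne : ∃ (M : Type u) (_ : L.Structure M), K.MemCard lam M) :
    ∃ (C : Type u) (_ : L.Structure C), K.Mem C ∧ #C ≤ Order.succ lam ∧ lam ≤ #C ∧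
      ∀ (S : L.Substructure C) (hS : K.IsSub lam S) (p : K.OrbType S), ∃ c : C,
        tp hS.isEmb c = p := by
  have h0 := hK.aleph0_le hls
  obtain ⟨M, _, hM⟩ := hne
  let U := (Order.succ lam).out
  have hU : #U = Order.succ lam := Cardinal.mk_out _
  have : Infinite U := infinite_succ_out h0
  obtain ⟨φ⟩ : Nonempty (M ↪ U) := by
    rw [← Cardinal.le_def, hU, hM.2]; exact Order.le_succ lam
  obtain ⟨P₀, e₀, -⟩ := exists_pStr_of_injective (L := L) φ φ.injective
  have hP₀ : K.MemCard lam P₀.carrier := hM.equiv e₀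
  have : Nonempty (PStr L U) := ⟨P₀⟩
  let I : PStr L U → Prop := fun P => K.MemCard lam P.carrier ∧ P₀.Ext K P
  obtain ⟨F, G, hFG⟩ := exists_chain (Order.succ lam).ord (PStr.Ext K (U := U))
    (fun _ _ _ h h' => h.trans h') (fun _ => I) (fun _ => I)
    (fun _ P Q => ∃ (m : P.carrier ↪[L] Q.carrier) (hm : K.IsEmb m), (∀ y, (m y : U) = y) ∧
      ∀ p, ∃ x, tp hm x = p)
    (by
      rintro i - P ⟨hP, hP'⟩
      obtain ⟨Z, _, u, hu, hZ, hz⟩ := exists_realizing_all hK hls hap hst hP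
      obtain ⟨Q, eQ, heQ⟩ := P.exists_extension u (by
        rw [hZ.2, hU]; exact Order.lt_succ lam)
      have hE := K.isEmb_equiv eQ hZ.1
      have hPQ : P.Ext K Q := ⟨eQ.toEmbedding.comp u, K.isEmb_comp hE hu, heQ⟩
      refine ⟨Q, ⟨hZ.equiv eQ, hP'.trans hPQ⟩, hPQ, _, K.isEmb_comp hE hu, heQ, fun p => ?_⟩
      obtain ⟨z, hz⟩ := hz p
      exact ⟨eQ z, (tp_comp _ hE z).trans hz⟩)
    (fun _ _ _ => True)
    (by
      intro j hj g hg hgg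
      obtain ⟨Q, h1, -, h2⟩ := PStr.exists_sup hK h0 hP₀ hj g hg hgg
      exact ⟨Q, h1, trivial, fun i => Or.inr (h2 i)⟩)
  have hpos : 0 < (Order.succ lam).ord :=
    Cardinal.ord_pos.2 (Order.bot_lt_succ lam)
  have : Nonempty (Set.Iio (Order.succ lam).ord) := ⟨⟨0, hpos⟩⟩
  have hmono : ∀ i j : Set.Iio (Order.succ lam).ord, i ≤ j → (F i).Ext K (F j) := by
    intro i j hij
    rcases hij.eq_or_lt with rfl | hij
    · exact PStr.Ext.refl (hFG i i.2).1.1.1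
    · exact ((hFG j j.2).2.2.2.2.2.2 i hij).1
  obtain ⟨C, hC, hC'⟩ := PStr.exists_union hK (fun i : Set.Iio (Order.succ lam).ord => F i) hmono
  obtain ⟨f0, hf0, -⟩ := hC' ⟨0, hpos⟩
  refine ⟨C.carrier, _, hf0.mem_cod, hU ▸ Cardinal.mk_subtype_le _, ?_, fun S hS p => ?_⟩
  · rw [← (hFG 0 hpos).1.1.2]
    exact Cardinal.mk_le_of_injective f0.injective
  have hx : ∀ x : S, ∃ j : Set.Iio (Order.succ lam).ord, ((x : C.carrier) : U) ∈ (F j).carrier := by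
    intro x
    have : ((x : C.carrier) : U) ∈ ⋃ i : Set.Iio (Order.succ lam).ord, (F i).carrier :=
      hC.subset (x : C.carrier).2
    exact Set.mem_iUnion.1 this
  choose jx hjx using hx
  -- Regularity of `lam⁺` places all of `S` inside a single stage.
  obtain ⟨j, hj, hjj⟩ := exists_ordinal_bound h0 hS.2.le (fun x => (jx x : Ordinal))
    (fun x => (jx x).2)
  obtain ⟨f, hf, hfx⟩ := hC' ⟨j, hj⟩
  have hSf : ∀ x : S, ∃ y : (F j).carrier, f y = x := by
    intro x
    obtain ⟨g, -, hg⟩ := hmono (jx x) ⟨j, hj⟩ (hjj x)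
    refine ⟨g ⟨_, hjx x⟩, Subtype.ext ?_⟩
    rw [hfx, hg]
  have hSle : S ≤ f.toHom.range := fun x hx => by
    obtain ⟨y, hy⟩ := hSf ⟨x, hx⟩
    exact ⟨y, hy⟩
  let s : S ↪[L] (F j).carrier := f.equivRange.symm.toEmbedding.comp (Substructure.inclusion hSle)
  have hs : f.comp s = S.subtype := by
    ext x
    simp only [s, Embedding.comp_apply, Language.Equiv.coe_toEmbedding]
    rw [← Embedding.equivRange_apply f, Language.Equiv.apply_symm_apply]
    rfl
  have hs' : K.IsEmb s := IsEmb.of_comp hK hf (by rw [hs]; exact hS.isEmb)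
  obtain ⟨hFj, hGj, -, ⟨m, hm, hmy, hmp⟩, -⟩ := hFG j hj
  -- The type `p` extends to a type over stage `j`, and that one is realized in `G j`.
  obtain ⟨Z, _, u, hu, z, hZ, hz⟩ := exists_realizing hK hls hap hS.memCard hFj.1 hs' p
  obtain ⟨x, hx⟩ := hmp (tp hu z)
  obtain ⟨g, hg, hgx⟩ : (G j).Ext K C := by
    have hj' := add_one_lt_ord_succ h0 hj
    have h1 := (hFG (j + 1) hj').2.2.2.2.2.1 j (lt_add_one j)
    rcases h1 with h | h
    · rw [h]; exact hC' ⟨j + 1, hj'⟩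
    · exact h.trans (hC' ⟨j + 1, hj'⟩)
  refine ⟨g x, ?_⟩
  rw [← hz, ← restrict_tp hu hs', ← hx, restrict_tp, ← tp_comp _ hg]
  apply tp_congr
  rw [← hs]
  ext y
  simp only [Embedding.comp_apply]
  rw [hgx, hmy, hfx]

end

/-! ### Gluing embeddings -/

/-- The range of the limit map is the directed union of the ranges of the `g i`, so it is strong. -/
theorem exists_glue (hK : K.IsAEC) {ι : Type*} [Small.{u} ι] [Nonempty ι] [LinearOrder ι]
    {D X : Type u} [L.Structure D] [L.Structure X] (B : ι →o L.Substructure D)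
    (g : ∀ i, B i ↪[L] X)
    (hc : ∀ i j (h : i ≤ j) (x : B i), g j (Substructure.inclusion (B.monotone h) x) = g i x)
    (hg : ∀ i, K.IsEmb (g i)) :
    ∃ G : (iSup B : L.Substructure D) ↪[L] X, K.IsEmb G ∧
      ∀ i (x : B i), G (Substructure.inclusion (le_iSup B i) x) = g i x := by
  let l := Language.DirectLimit.lift L ι (fun i => B i)
    (fun _ _ h => Substructure.inclusion (B.monotone h)) g hc
  let G : (iSup B : L.Substructure D) ↪[L] X :=
    l.comp (DirectLimit.Equiv_iSup B).symm.toEmbedding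
  have hG : ∀ i (x : B i), G (Substructure.inclusion (le_iSup B i) x) = g i x := by
    intro i x
    change l ((DirectLimit.Equiv_iSup B).symm (Substructure.inclusion (le_iSup B i) x)) = _
    rw [DirectLimit.Equiv_isup_symm_inclusion_apply]
    exact Language.DirectLimit.lift_of _ _ _
  refine ⟨G, ?_, hG⟩
  have hdir : Directed (· ≤ ·) fun i => (g i).toHom.range := by
    refine Monotone.directed_le fun i j h => ?_
    rintro _ ⟨x, rfl⟩
    exact ⟨Substructure.inclusion (B.monotone h) x, hc i j h x⟩
  have hr : G.toHom.range = ⨆ i, (g i).toHom.range := by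
    ext y
    rw [mem_iSup_iff hdir]
    constructor
    · rintro ⟨⟨x, hx⟩, rfl⟩
      obtain ⟨i, hi⟩ := (mem_iSup_iff B.monotone.directed_le).1 hx
      exact ⟨i, ⟨x, hi⟩, (hG i ⟨x, hi⟩).symm⟩
    · rintro ⟨i, x, rfl⟩
      exact ⟨_, hG i x⟩
  unfold IsEmb
  rw [hr]
  exact strong_iSup hK hdir hg

/-! ### Saturation implies universality -/

/-- An approximation to an embedding: a model on a subset of `U`, with a partial map from `D`. -/
structure PartialMap (L : FirstOrder.Language.{u, u}) (U D : Type u) [L.Structure D] where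
  X : PStr L U
  B : L.Substructure D
  g : B ↪[L] X.carrier

namespace PartialMap

variable {U D : Type u} [L.Structure D]

/-- `q` extends `p`. -/
def Extends (K : AbstractClass L) (p q : PartialMap L U D) : Prop :=
  p.X.Ext K q.X ∧ ∃ h : p.B ≤ q.B, ∀ x : p.B, (q.g (Substructure.inclusion h x) : U) = p.g x

theorem Extends.refl {p : PartialMap L U D} (h : K.Mem p.X.carrier) : p.Extends K p :=
  ⟨PStr.Ext.refl h, le_rfl, fun _ => rfl⟩

theorem Extends.trans {p q r : PartialMap L U D} (h : p.Extends K q) (h' : q.Extends K r) :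
    p.Extends K r := by
  obtain ⟨h1, h2, h3⟩ := h
  obtain ⟨h1', h2', h3'⟩ := h'
  exact ⟨h1.trans h1', h2.trans h2', fun x => (h3' _).trans (h3 x)⟩

/-- The model and the domain are in `K_lam`, and the map is a `K`-embedding. -/
def Good (K : AbstractClass L) (lam : Cardinal.{u}) (p : PartialMap L U D) : Prop :=
  K.MemCard lam p.X.carrier ∧ K.IsSub lam p.B ∧ K.IsEmb p.g

theorem exists_sup (hK : K.IsAEC) (h0 : ℵ₀ ≤ lam) {p₀ : PartialMap L U D} (hp₀ : p₀.Good K lam)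
    {j : Ordinal.{u}} (hj : j < (Order.succ lam).ord) (s : Set.Iio j → PartialMap L U D)
    (hs : ∀ i, (s i).Good K lam ∧ p₀.Extends K (s i))
    (hss : ∀ i i', i < i' → (s i).Extends K (s i'))
    (A : L.Substructure D) (hA₀ : p₀.B ≤ A) (hA : ∀ i, (s i).B ≤ A) :
    ∃ q : PartialMap L U D, (q.Good K lam ∧ p₀.Extends K q) ∧ q.B ≤ A ∧
      ∀ i, (s i).Extends K q := by
  rcases eq_or_ne j 0 with rfl | h
  · exact ⟨p₀, ⟨hp₀, Extends.refl hp₀.1.1⟩, hA₀, fun i => by simpa using i.2⟩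
  have h' := pos_iff_ne_zero.2 h
  have : Nonempty (Set.Iio j) := ⟨⟨0, h'⟩⟩
  obtain ⟨X, ⟨hX, -⟩, -, hX3⟩ := PStr.exists_sup hK h0 hp₀.1 hj (fun i => (s i).X)
    (fun i => ⟨(hs i).1.1, (hs i).2.1⟩) (fun i i' h => (hss i i' h).1)
  have hle : ∀ i i', i ≤ i' → (s i).Extends K (s i') := fun i i' h => by
    rcases h.eq_or_lt with rfl | h
    · exact Extends.refl (hs i).1.1.1
    · exact hss i i' h
  choose f hf hfx using hX3
  let B : Set.Iio j →o L.Substructure D := ⟨fun i => (s i).B, fun i i' h => (hle i i' h).2.1⟩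
  obtain ⟨G, hG, hGx⟩ := exists_glue hK B (fun i => (f i).comp (s i).g) (fun i i' h x => by
      apply Subtype.ext
      rw [Embedding.comp_apply, Embedding.comp_apply, hfx, hfx]
      exact (hle i i' h).2.2 x)
    (fun i => K.isEmb_comp (hf i) (hs i).1.2.2)
  have hext : ∀ i, (s i).Extends K ⟨X, iSup B, G⟩ := fun i =>
    ⟨⟨f i, hf i, hfx i⟩, le_iSup B i, fun x => by rw [hGx, Embedding.comp_apply, hfx]⟩
  exact ⟨⟨X, iSup B, G⟩, ⟨⟨hX, isSub_iSup hK h0 (mk_shrink_Iio_le hj) B.monotone.directed_le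
    fun i => (hs i).1.2.1, hG⟩, (hs ⟨0, h'⟩).2.trans (hext _)⟩, iSup_le hA, hext⟩

end PartialMap

/-- If each `A (k + 1)` realizes all types over `A k` then every extension of `A 0` in `K_lam`
embeds in `A lam` over `A 0`. -/
theorem exists_embedding_of_realizes (hK : K.IsAEC) (hls : K.LS ≤ lam)
    (hap : K.AmalgamationIn lam) {D : Type u} [L.Structure D] (A : Ordinal.{u} → L.Substructure D)
    (hA : ∀ k ≤ lam.ord, K.IsSub lam (A k)) (hmono : ∀ i j, i ≤ j → j ≤ lam.ord → A i ≤ A j)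
    (hreal : ∀ k (hk : k < lam.ord) (p : K.OrbType (A k)), ∃ c ∈ A (k + 1),
      tp (hA k hk.le).isEmb c = p)
    {N : Type u} [L.Structure N] (hN : K.MemCard lam N) (j : A 0 ↪[L] N) (hj : K.IsEmb j) :
    ∃ h : N ↪[L] D, K.IsEmb h ∧ (∀ x, h (j x) = x) ∧ ∀ y, h y ∈ A lam.ord := by
  have h0 := hK.aleph0_le hls
  have hNne : Nonempty N := Cardinal.mk_ne_zero_iff.1
    (by rw [hN.2]; exact (Cardinal.aleph0_pos.trans_le h0).ne')
  obtain ⟨en, hen⟩ := exists_enum_of_mk_le hN.2.le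
  let U := (Order.succ lam).out
  have hU : #U = Order.succ lam := Cardinal.mk_out _
  have : Infinite U := infinite_succ_out h0
  obtain ⟨φ⟩ : Nonempty (N ↪ U) := by
    rw [← Cardinal.le_def, hU, hN.2]; exact Order.le_succ lam
  obtain ⟨X₀, e₀, -⟩ := exists_pStr_of_injective (L := L) φ φ.injective
  have he₀ := K.isEmb_equiv e₀ hN.1
  let p₀ : PartialMap L U D := ⟨X₀, A 0, e₀.toEmbedding.comp j⟩
  have hp₀ : p₀.Good K lam := ⟨hN.equiv e₀, hA 0 zero_le, K.isEmb_comp he₀ hj⟩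
  have : Nonempty (PartialMap L U D) := ⟨p₀⟩
  obtain ⟨F, G, hFG⟩ := exists_chain (Order.succ lam).ord (PartialMap.Extends K (U := U) (D := D))
    (fun _ _ _ h h' => h.trans h')
    (fun k p => (p.Good K lam ∧ p₀.Extends K p) ∧ (k ≤ lam.ord → p.B ≤ A k))
    (fun k p => (p.Good K lam ∧ p₀.Extends K p) ∧ (k < lam.ord → p.B ≤ A (k + 1)))
    (fun k _ q => k < lam.ord → ∃ b : q.B, (q.g b : U) = e₀ (en k))
    (by
      rintro i - p ⟨⟨hp, hp'⟩, hpB⟩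
      by_cases hi : i < lam.ord
      swap
      · exact ⟨p, ⟨⟨hp, hp'⟩, fun h => (hi h).elim⟩, PartialMap.Extends.refl hp.1.1,
          fun h => (hi h).elim⟩
      have hBi := hpB hi.le
      have hi1 := Order.add_one_le_of_lt hi
      -- The domain is first enlarged to all of `A i`. The `i`-th element of `N` then has a type
      -- over `A i`, realized by some `c ∈ A (i + 1)`, and a second amalgamation identifies the two
      -- while enlarging the domain to `A (i + 1)`.
      obtain ⟨X', _, u, v, hX', hu, hv, huv⟩ := hap _ _ _ _ _ hp.2.1.memCard (hA i hi.le).memCard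
        hp.1 (isEmb_inclusion hK hp.2.1.1 (hA i hi.le).1 hBi) hp.2.2
      obtain ⟨f₀, hf₀, hf₀x⟩ := hp'.1
      obtain ⟨c, hc, hct⟩ := hreal i hi (tp hu (v (f₀ (e₀ (en i)))))
      obtain ⟨Z, _, u', v', hZ, hu', hv', huv', hx'⟩ := exists_amalgam_of_tp_eq hK hls hap
        (hA i hi.le).memCard hX' hu (hA i hi.le).isEmb hct.symm (hA _ hi1)
        (fun y => hmono i (i + 1) (le_self_add) hi1 y.2) hc
      obtain ⟨Q, eQ, heQ⟩ := p.X.exists_extension (u'.comp v) (by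
        rw [hZ.2, hU]; exact Order.lt_succ lam)
      have hE := K.isEmb_equiv eQ hZ.1
      have hext : p.Extends K ⟨Q, A (i + 1), eQ.toEmbedding.comp v'⟩ := by
        refine ⟨⟨eQ.toEmbedding.comp (u'.comp v), K.isEmb_comp hE (K.isEmb_comp hu' hv), heQ⟩,
          hBi.trans (hmono i (i + 1) le_self_add hi1), fun b => ?_⟩
        rw [← heQ (p.g b), Embedding.comp_apply, Embedding.comp_apply, ← huv, ← huv']
        rfl
      refine ⟨⟨Q, A (i + 1), eQ.toEmbedding.comp v'⟩,
        ⟨⟨⟨hZ.equiv eQ, hA _ hi1, K.isEmb_comp hE hv'⟩, hp'.trans hext⟩, fun _ => le_rfl⟩,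
        hext, fun _ => ⟨⟨c, hc⟩, ?_⟩⟩
      rw [← hf₀x, ← heQ, Embedding.comp_apply, Embedding.comp_apply, hx']
      rfl)
    (fun _ _ _ => True)
    (by
      intro k hk s hs hss
      -- Beyond stage `lam.ord` no bound on the domain is needed, so `⊤` stands in for it.
      obtain ⟨q, h1, h2, h3⟩ := PartialMap.exists_sup hK h0 hp₀ hk s (fun i => (hs i).1) hss
        (if k ≤ lam.ord then A k else ⊤) (by
          split_ifs with h
          · exact hmono 0 k zero_le h
          · exact le_top) (fun i => by
          split_ifs with h
          · exact ((hs i).2 (i.2.trans_le h)).trans (hmono _ _ (Order.add_one_le_of_lt i.2) h)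
          · exact le_top)
      exact ⟨q, ⟨h1, fun h => by rwa [if_pos h] at h2⟩, trivial, fun i => Or.inr (h3 i)⟩)
  obtain ⟨⟨⟨hQ, hQ0⟩, hQB⟩, -, -, -, -, hlt, -⟩ := hFG lam.ord ord_lt_ord_succ
  obtain ⟨⟨f, hf, hfx⟩, hB0, hB0x⟩ := hQ0
  -- The maps go from submodels of `D` into extensions of `N`. At stage `lam.ord` the range covers
  -- `N`, and inverting the map there gives the embedding.
  have hsurj : ∀ y : N, ∃ b : (F lam.ord).B, (F lam.ord).g b = f (e₀ y) := by
    intro y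
    obtain ⟨k, hk, rfl⟩ := hen y
    obtain ⟨b, hb⟩ := (hFG k (hk.trans ord_lt_ord_succ)).2.2.2.1 hk
    obtain ⟨-, h1, h2⟩ : (G k).Extends K (F lam.ord) := by
      rcases hlt k hk with h | h
      · rw [h]; exact PartialMap.Extends.refl hQ.1.1
      · exact h
    refine ⟨Substructure.inclusion h1 b, Subtype.ext ?_⟩
    rw [h2, hb, hfx]
  have hle : (f.comp e₀.toEmbedding).toHom.range ≤ (F lam.ord).g.toHom.range := by
    rintro _ ⟨y, rfl⟩
    obtain ⟨b, hb⟩ := hsurj y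
    exact ⟨b, hb⟩
  have hfe := K.isEmb_comp hf he₀
  let h₁ : N ↪[L] (F lam.ord).B := (F lam.ord).g.equivRange.symm.toEmbedding.comp
    ((Substructure.inclusion hle).comp (f.comp e₀.toEmbedding).equivRange.toEmbedding)
  have hh₁ : ∀ y, (F lam.ord).g (h₁ y) = f (e₀ y) := fun y => by
    simp only [h₁, Embedding.comp_apply, Language.Equiv.coe_toEmbedding]
    rw [← Embedding.equivRange_apply (F lam.ord).g, Language.Equiv.apply_symm_apply]
    rfl
  have hh₁' : K.IsEmb h₁ := IsEmb.of_comp hK hQ.2.2 (by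
    convert hfe
    ext y
    exact congrArg Subtype.val (hh₁ y))
  refine ⟨(F lam.ord).B.subtype.comp h₁, K.isEmb_comp hQ.2.1.isEmb hh₁', fun x => ?_,
    fun y => hQB le_rfl (h₁ y).2⟩
  have : h₁ (j x) = Substructure.inclusion hB0 x := by
    apply (F lam.ord).g.injective
    apply Subtype.ext
    rw [hh₁, hfx, hB0x]
    rfl
  rw [Embedding.comp_apply, this]
  rfl

/-! ### A model-homogeneous model -/

/-- `C` realizes all types over its submodels in `K_lam`. -/
def Saturated (K : AbstractClass L) (lam : Cardinal.{u}) (C : Type u) [L.Structure C] : Prop :=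
  ∀ (S : L.Substructure C) (hS : K.IsSub lam S) (p : K.OrbType S), ∃ c : C, tp hS.isEmb c = p

section

variable {C : Type u} [L.Structure C]

theorem Saturated.exists_realizes_all (hsat : Saturated K lam C) (hK : K.IsAEC)
    (hls : K.LS ≤ lam) (hst : K.StableIn lam) (hC : K.Mem C) {S : L.Substructure C}
    (hS : K.IsSub lam S) :
    ∃ T : L.Substructure C, K.IsSub lam T ∧ S ≤ T ∧
      ∀ p : K.OrbType S, ∃ c ∈ T, tp hS.isEmb c = p := by
  have h0 := hK.aleph0_le hls
  have hne : Nonempty S := Cardinal.mk_ne_zero_iff.1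
    (by rw [hS.2]; exact (Cardinal.aleph0_pos.trans_le h0).ne')
  have : Nonempty (K.OrbType S) := ⟨tp hS.isEmb hne.some⟩
  obtain ⟨e, he⟩ := exists_enum_orbType hst hS.memCard
  choose c hc using fun p => hsat S hS p
  have hA : #(⋃ i : Set.Iio lam.ord, ({c (e i)} : Set C)) ≤ lam :=
    mk_iUnion_le_of_le h0 (mk_shrink_Iio_le ord_lt_ord_succ) fun i => by
      rw [Cardinal.mk_singleton]; exact Cardinal.one_le_aleph0.trans h0
  obtain ⟨T, hT, h1, h2⟩ := hK.exists_isSub_range hls hC S.subtype hS.2 _ hA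
  refine ⟨T, hT, fun x hx => h1 ⟨x, hx⟩, fun p => ⟨c p, ?_, hc p⟩⟩
  obtain ⟨k, hk, rfl⟩ := he p
  exact h2 (Set.mem_iUnion.2 ⟨⟨k, hk⟩, rfl⟩)

theorem exists_isSub_sup (hK : K.IsAEC) (h0 : ℵ₀ ≤ lam) {j : Ordinal.{u}}
    (hj : j < (Order.succ lam).ord) (g : Set.Iio j → L.Substructure C)
    (hg : ∀ i, K.IsSub lam (g i)) (hgg : ∀ i i', i < i' → g i ≤ g i') (hj0 : j ≠ 0) :
    K.IsSub lam (⨆ i, g i) ∧ Directed (· ≤ ·) g := by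
  have : Nonempty (Set.Iio j) := ⟨⟨0, pos_iff_ne_zero.2 hj0⟩⟩
  have hm : Monotone g := fun i i' h => by
    rcases h.eq_or_lt with rfl | h
    · exact le_rfl
    · exact hgg i i' h
  exact ⟨isSub_iSup hK h0 (mk_shrink_Iio_le hj) hm.directed_le hg, hm.directed_le⟩

theorem Saturated.exists_chain_realizing (hsat : Saturated K lam C) (hK : K.IsAEC)
    (hls : K.LS ≤ lam) (hst : K.StableIn lam) (hC : K.Mem C) {S : L.Substructure C}
    (hS : K.IsSub lam S) :
    ∃ A : Ordinal.{u} → L.Substructure C, A 0 = S ∧ ∃ hA : ∀ k ≤ lam.ord, K.IsSub lam (A k),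
      (∀ i j, i ≤ j → j ≤ lam.ord → A i ≤ A j) ∧
      ∀ k (hk : k < lam.ord) (p : K.OrbType (A k)), ∃ c ∈ A (k + 1),
        tp (hA k hk.le).isEmb c = p := by
  have h0 := hK.aleph0_le hls
  obtain ⟨F, G, hFG⟩ := exists_chain (Order.succ lam).ord
    (fun S T : L.Substructure C => S ≤ T) (fun _ _ _ h h' => h.trans h') (fun _ => K.IsSub lam)
    (fun _ => K.IsSub lam)
    (fun _ M N => ∀ hM : K.IsSub lam M, ∀ p, ∃ c ∈ N, tp hM.isEmb c = p)
    (fun _ _ M hM => by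
      obtain ⟨N, h1, h2, h3⟩ := hsat.exists_realizes_all hK hls hst hC hM
      exact ⟨N, h1, h2, fun _ => h3⟩)
    (fun j _ q => j = 0 → q = S)
    (fun j hj g hg hgg => by
      rcases eq_or_ne j 0 with rfl | h
      · exact ⟨S, hS, fun _ => rfl, fun i => by simpa using i.2⟩
      · exact ⟨⨆ i, g i, (exists_isSub_sup hK h0 hj g hg hgg h).1, fun h' => (h h').elim,
          fun i => Or.inr (le_iSup g i)⟩)
  have hlt : ∀ k ≤ lam.ord, k < (Order.succ lam).ord := fun k hk => hk.trans_lt ord_lt_ord_succ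
  refine ⟨F, (hFG 0 (hlt 0 zero_le)).2.2.2.2.1 rfl, fun k hk => (hFG k (hlt k hk)).1, ?_, ?_⟩
  · intro i j hij hj
    rcases hij.eq_or_lt with rfl | h
    · exact le_rfl
    · exact ((hFG j (hlt j hj)).2.2.2.2.2.2 i h).1
  · intro k hk p
    obtain ⟨c, hc, hp⟩ := (hFG k (hlt k hk.le)).2.2.2.1 (hFG k (hlt k hk.le)).1 p
    refine ⟨c, ?_, hp⟩
    -- The realizations found at stage `k` lie in `G k`, which is contained in `F (k + 1)`.
    rcases (hFG (k + 1) (hlt _ (Order.add_one_le_of_lt hk))).2.2.2.2.2.1 k (lt_add_one k) with h | h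
    · rwa [← h]
    · exact h hc

theorem Saturated.exists_universal_sub (hsat : Saturated K lam C) (hK : K.IsAEC)
    (hls : K.LS ≤ lam) (hst : K.StableIn lam) (hap : K.AmalgamationIn lam) (hC : K.Mem C)
    {S : L.Substructure C} (hS : K.IsSub lam S) :
    ∃ T : L.Substructure C, K.IsSub lam T ∧ S ≤ T ∧
      ∀ (N : Type u) [L.Structure N] (j : S ↪[L] N), K.MemCard lam N → K.IsEmb j →
        ∃ h : N ↪[L] C, K.IsEmb h ∧ (∀ x, h (j x) = x) ∧ ∀ y, h y ∈ T := by
  obtain ⟨A, rfl, hA, hmono, hreal⟩ := hsat.exists_chain_realizing hK hls hst hC hS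
  exact ⟨A lam.ord, hA _ le_rfl, hmono _ _ zero_le le_rfl, fun N _ j hN hj =>
    exists_embedding_of_realizes hK hls hap A hA hmono hreal hN j hj⟩

end

/-- Every `K`-embedding of a model in `K_lam` into `C` extends to every extension in `K_lam`. -/
def Homogeneous (K : AbstractClass L) (lam : Cardinal.{u}) (C : Type u) [L.Structure C] : Prop :=
  ∀ {X N : Type u} [L.Structure X] [L.Structure N] (w : X ↪[L] C) (j : X ↪[L] N),
    K.MemCard lam X → K.MemCard lam N → K.IsEmb w → K.IsEmb j →
    ∃ g : N ↪[L] C, K.IsEmb g ∧ ∀ x, g (j x) = w x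

/-! ### Extending isomorphisms of submodels to automorphisms -/

section BackAndForth

variable {C : Type u} [L.Structure C]

theorem isEmb_partialEquiv {p : C ≃ₚ[L] C} (h : K.Strong p.dom) (h' : K.Strong p.cod) :
    K.IsEmb p.toEmbedding :=
  K.isEmb_comp (isEmb_subtype.2 h') (K.isEmb_equiv p.toEquiv (K.mem_of_strong h).2)

theorem exists_partialEquiv_extension (hK : K.IsAEC) (hls : K.LS ≤ lam) (hC : K.Mem C)
    (hhom : Homogeneous K lam C) {p : C ≃ₚ[L] C} (h : K.IsSub lam p.dom) (h' : K.IsSub lam p.cod)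
    (c : C) : ∃ q : C ≃ₚ[L] C, K.IsSub lam q.dom ∧ K.IsSub lam q.cod ∧ p ≤ q ∧ c ∈ q.dom := by
  obtain ⟨A, hA, h1, h2⟩ := hK.exists_isSub_range hls hC p.dom.subtype h.2 {c}
    (by rw [Cardinal.mk_singleton]; exact Cardinal.one_le_aleph0.trans (hK.aleph0_le hls))
  have hle : p.dom ≤ A := fun x hx => h1 ⟨x, hx⟩
  obtain ⟨g, hg, hgx⟩ := hhom p.toEmbedding (Substructure.inclusion hle) h.memCard hA.memCard
    (isEmb_partialEquiv h.1 h'.1) (isEmb_inclusion hK h.1 hA.1 hle)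
  refine ⟨⟨A, g.toHom.range, g.equivRange⟩, hA, hg.isSub_range hA.2, ⟨hle, ?_⟩, h2 rfl⟩
  ext x
  exact hgx x

/-- A back-and-forth of length `lam⁺`: this is enough to treat every element of `C`, and each stage
still has domain and codomain of size `lam`, where homogeneity applies. -/
theorem exists_equiv_of_homogeneous (hK : K.IsAEC) (hls : K.LS ≤ lam) (hC : K.Mem C)
    (hcard : #C ≤ Order.succ lam) (hhom : Homogeneous K lam C) {S T : L.Substructure C}
    (hS : K.IsSub lam S) (hT : K.IsSub lam T) (e : S ≃[L] T) :
    ∃ σ : C ≃[L] C, ∀ x : S, σ x = e x := by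
  have h0 := hK.aleph0_le hls
  have hne : Nonempty S := Cardinal.mk_ne_zero_iff.1
    (by rw [hS.2]; exact (Cardinal.aleph0_pos.trans_le h0).ne')
  have : Nonempty C := ⟨hne.some⟩
  obtain ⟨en, hen⟩ := exists_enum_of_mk_le hcard
  let p₀ : C ≃ₚ[L] C := ⟨S, T, e⟩
  have : Nonempty (C ≃ₚ[L] C) := ⟨p₀⟩
  let I : (C ≃ₚ[L] C) → Prop := fun p => K.IsSub lam p.dom ∧ K.IsSub lam p.cod ∧ p₀ ≤ p
  obtain ⟨F, G, hFG⟩ := exists_chain (Order.succ lam).ord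
    (fun p q : C ≃ₚ[L] C => p ≤ q) (fun _ _ _ h h' => h.trans h') (fun _ => I) (fun _ => I)
    (fun i _ q => en i ∈ q.dom ∧ en i ∈ q.cod)
    (by
      rintro i - p ⟨h1, h2, h3⟩
      obtain ⟨q, hq1, hq2, hq3, hq4⟩ :=
        exists_partialEquiv_extension hK hls hC hhom h1 h2 (en i)
      -- The back step is the forth step for the inverse.
      obtain ⟨r, hr1, hr2, hr3, hr4⟩ :=
        exists_partialEquiv_extension (p := q.symm) hK hls hC hhom hq2 hq1 (en i)
      have hqr : q ≤ r.symm := PartialEquiv.symm_le_iff.1 hr3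
      exact ⟨r.symm, ⟨hr2, hr1, h3.trans (hq3.trans hqr)⟩, hq3.trans hqr,
        PartialEquiv.dom_le_dom hqr hq4, hr4⟩)
    (fun _ _ _ => True)
    (by
      intro j hj g hg hgg
      rcases eq_or_ne j 0 with rfl | h
      · exact ⟨p₀, ⟨hS, hT, le_rfl⟩, trivial, fun i => (not_lt_zero (Set.mem_Iio.1 i.2)).elim⟩
      · have h' := pos_iff_ne_zero.2 h
        have : Nonempty (Set.Iio j) := ⟨⟨0, h'⟩⟩
        let g' : Set.Iio j →o (C ≃ₚ[L] C) := ⟨g, fun i i' h => by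
          rcases h.eq_or_lt with rfl | h
          · exact le_rfl
          · exact hgg i i' h⟩
        have hle := DirectLimit.le_partialEquivLimit g'
        refine ⟨DirectLimit.partialEquivLimit g', ⟨?_, ?_, (hg ⟨0, h'⟩).2.2.trans (hle _)⟩,
          trivial, fun i => Or.inr (hle i)⟩
        · exact isSub_iSup hK h0 (mk_shrink_Iio_le hj)
            (Monotone.directed_le fun i i' h => PartialEquiv.dom_le_dom (g'.monotone h))
            fun i => (hg i).1
        · exact isSub_iSup hK h0 (mk_shrink_Iio_le hj)
            (Monotone.directed_le fun i i' h => PartialEquiv.cod_le_cod (g'.monotone h))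
            fun i => (hg i).2.1)
  have hpos : 0 < (Order.succ lam).ord :=
    Cardinal.ord_pos.2 (Order.bot_lt_succ lam)
  have : Nonempty (Set.Iio (Order.succ lam).ord) := ⟨⟨0, hpos⟩⟩
  let F' : Set.Iio (Order.succ lam).ord →o (C ≃ₚ[L] C) := ⟨fun i => G i, fun i j h => by
    rcases h.eq_or_lt with rfl | h
    · exact le_rfl
    · exact ((hFG j j.2).2.2.2.2.2.2 i h).2⟩
  let l := DirectLimit.partialEquivLimit F'
  have hle := DirectLimit.le_partialEquivLimit F'
  have hdom : l.dom = ⊤ := by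
    refine eq_top_iff.2 fun x _ => ?_
    obtain ⟨k, hk, rfl⟩ := hen x
    exact PartialEquiv.dom_le_dom (hle ⟨k, hk⟩) (hFG k hk).2.2.2.1.1
  have hcod : l.cod = ⊤ := by
    refine eq_top_iff.2 fun x _ => ?_
    obtain ⟨k, hk, rfl⟩ := hen x
    exact PartialEquiv.cod_le_cod (hle ⟨k, hk⟩) (hFG k hk).2.2.2.1.2
  refine ⟨PartialEquiv.toEquivOfEqTop hdom hcod, fun x => ?_⟩
  have h1 : p₀ ≤ l := (hFG 0 hpos).2.1.2.2.trans (hle ⟨0, hpos⟩)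
  have h2 := PartialEquiv.toEquiv_inclusion_apply h1 x
  rw [← Language.Equiv.coe_toEmbedding, PartialEquiv.toEquivOfEqTop_toEmbedding,
    PartialEquiv.toEmbeddingOfEqTop_apply]
  exact congrArg Subtype.val h2

end BackAndForth

/-- A model that is homogeneous for `K_lam`, and in which types are orbits. -/
structure Monster (K : AbstractClass L) (lam : Cardinal.{u}) (C : Type u) [L.Structure C] :
    Prop where
  aec : K.IsAEC
  ls_le : K.LS ≤ lam
  amalgamation : K.AmalgamationIn lam
  mem : K.Mem C
  le_card : lam ≤ #C
  homog : Homogeneous K lam C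
  extend : ∀ {S T : L.Substructure C}, K.IsSub lam S → K.IsSub lam T → ∀ e : S ≃[L] T,
    ∃ σ : C ≃[L] C, ∀ x : S, σ x = e x
  exists_universal : ∀ {S : L.Substructure C}, K.IsSub lam S →
    ∃ T : L.Substructure C, K.IsSub lam T ∧ S ≤ T ∧
      ∀ (N : Type u) [L.Structure N] (j : S ↪[L] N), K.MemCard lam N → K.IsEmb j →
        ∃ h : N ↪[L] C, K.IsEmb h ∧ (∀ x, h (j x) = x) ∧ ∀ y, h y ∈ T

theorem exists_monster (hK : K.IsAEC) (hss : K.Superstable lam) :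
    ∃ (C : Type u) (_ : L.Structure C), Monster K lam C := by
  have hls := hss.ls_le
  obtain ⟨C, _, hC, hc1, hc2, hsat⟩ :=
    exists_saturated hK hls hss.amalgamation hss.stable hss.nonempty
  have huniv : ∀ {S : L.Substructure C}, K.IsSub lam S → _ := fun hS =>
    Saturated.exists_universal_sub hsat hK hls hss.stable hss.amalgamation hC hS
  have hhom : Homogeneous K lam C := by
    intro X N _ _ w j hX hN hw hj
    obtain ⟨T, -, -, h⟩ := huniv (hw.isSub_range hX.2)
    obtain ⟨g, hg, hgx, -⟩ := h N (j.comp w.equivRange.symm.toEmbedding) hN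
      (K.isEmb_comp hj (K.isEmb_equiv _ (K.mem_of_strong hw).2))
    refine ⟨g, hg, fun x => ?_⟩
    have := hgx (w.equivRange x)
    rwa [Embedding.comp_apply, Language.Equiv.coe_toEmbedding, Language.Equiv.symm_apply_apply,
      Embedding.equivRange_apply] at this
  exact ⟨C, _, hK, hls, hss.amalgamation, hC, hc2, hhom,
    fun hS hT e => exists_equiv_of_homogeneous hK hls hC hc1 hhom hS hT e, huniv⟩

section Orbits

variable {C : Type u} [L.Structure C]

/-! ### Automorphisms of the monster -/

/-- `σ` fixes `M` pointwise. -/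
def Fixes (σ : C ≃[L] C) (M : L.Substructure C) : Prop := ∀ x ∈ M, σ x = x

/-- The image of `M` under an automorphism. -/
def img (σ : C ≃[L] C) (M : L.Substructure C) : L.Substructure C := M.map σ.toHom

theorem mem_img {σ : C ≃[L] C} {M : L.Substructure C} {y : C} : y ∈ img σ M ↔ σ.symm y ∈ M := by
  constructor
  · rintro ⟨x, hx, rfl⟩
    simpa using hx
  · intro h
    exact ⟨σ.symm y, h, σ.apply_symm_apply y⟩

theorem apply_mem_img {σ : C ≃[L] C} {M : L.Substructure C} {x : C} (h : x ∈ M) :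
    σ x ∈ img σ M := ⟨x, h, rfl⟩

theorem img_mono (σ : C ≃[L] C) {M N : L.Substructure C} (h : M ≤ N) : img σ M ≤ img σ N :=
  Substructure.monotone_map h

theorem img_comp (σ τ : C ≃[L] C) (M : L.Substructure C) :
    img (σ.comp τ) M = img σ (img τ M) := (Substructure.map_map M σ.toHom τ.toHom).symm

theorem img_symm_img (σ : C ≃[L] C) (M : L.Substructure C) : img σ.symm (img σ M) = M := by
  ext x; simp [mem_img]

theorem img_img_symm (σ : C ≃[L] C) (M : L.Substructure C) : img σ (img σ.symm M) = M := by
  ext x; simp [mem_img]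

theorem img_le_iff {σ : C ≃[L] C} {M N : L.Substructure C} :
    img σ M ≤ N ↔ M ≤ img σ.symm N :=
  ⟨fun h => by rw [← img_symm_img σ M]; exact img_mono _ h,
    fun h => by rw [← img_img_symm σ N]; exact img_mono _ h⟩

theorem img_congr {σ τ : C ≃[L] C} {M : L.Substructure C} (h : ∀ x ∈ M, σ x = τ x) :
    img σ M = img τ M := by
  ext y
  constructor
  · rintro ⟨x, hx, rfl⟩; exact ⟨x, hx, (h x hx).symm⟩
  · rintro ⟨x, hx, rfl⟩; exact ⟨x, hx, h x hx⟩

theorem Fixes.img_eq {σ : C ≃[L] C} {M : L.Substructure C} (h : Fixes σ M) : img σ M = M := by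
  have : img σ M = img (Language.Equiv.refl L C) M := img_congr h
  rw [this]
  ext y
  exact mem_img

theorem Fixes.mono {σ : C ≃[L] C} {M N : L.Substructure C} (h : Fixes σ N) (hMN : M ≤ N) :
    Fixes σ M := fun x hx => h x (hMN hx)

theorem Fixes.symm {σ : C ≃[L] C} {M : L.Substructure C} (h : Fixes σ M) : Fixes σ.symm M :=
  fun x hx => by
    have := congrArg σ.symm (h x hx)
    rw [Language.Equiv.symm_apply_apply] at this
    exact this.symm

theorem Fixes.comp {σ τ : C ≃[L] C} {M : L.Substructure C} (h : Fixes σ M) (h' : Fixes τ M) :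
    Fixes (σ.comp τ) M := fun x hx => by rw [Language.Equiv.comp_apply, h' x hx, h x hx]

theorem Fixes.conj {σ : C ≃[L] C} {M : L.Substructure C} (h : Fixes σ M) (ρ : C ≃[L] C) :
    Fixes (ρ.comp (σ.comp ρ.symm)) (img ρ M) := fun x hx => by
  simp only [Language.Equiv.comp_apply]
  rw [h _ (mem_img.1 hx), Language.Equiv.apply_symm_apply]

theorem IsSub.img {M : L.Substructure C} (h : K.IsSub lam M) (hC : K.Mem C) (σ : C ≃[L] C) :
    K.IsSub lam (img σ M) := h.map (f := σ.toEmbedding) (K.isEmb_equiv σ hC)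

/-! ### Types as orbits -/

/-- `a` and `b` are conjugate over `M`. -/
def SameType (M : L.Substructure C) (a b : C) : Prop := ∃ σ : C ≃[L] C, Fixes σ M ∧ σ a = b

variable {M N M' N' P Q : L.Substructure C} {a b c : C}

theorem SameType.symm (h : SameType M a b) : SameType M b a := by
  obtain ⟨σ, h1, rfl⟩ := h
  exact ⟨σ.symm, h1.symm, σ.symm_apply_apply a⟩

theorem SameType.trans (h : SameType M a b) (h' : SameType M b c) : SameType M a c := by
  obtain ⟨σ, h1, rfl⟩ := h
  obtain ⟨τ, h2, rfl⟩ := h'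
  exact ⟨τ.comp σ, h2.comp h1, rfl⟩

theorem SameType.mono (h : SameType N a b) (hMN : M ≤ N) : SameType M a b := by
  obtain ⟨σ, h1, h2⟩ := h
  exact ⟨σ, h1.mono hMN, h2⟩

theorem SameType.img (h : SameType M a b) (ρ : C ≃[L] C) : SameType (img ρ M) (ρ a) (ρ b) := by
  obtain ⟨σ, h1, rfl⟩ := h
  exact ⟨ρ.comp (σ.comp ρ.symm), h1.conj ρ, by simp [Language.Equiv.comp_apply]⟩

theorem sameType_img_iff {ρ : C ≃[L] C} :
    SameType (AbstractClass.img ρ M) (ρ a) (ρ b) ↔ SameType M a b :=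
  ⟨fun h => by
    have := h.img ρ.symm
    simpa [img_symm_img] using this, fun h => h.img ρ⟩

theorem Fixes.sameType {σ : C ≃[L] C} (h : Fixes σ M) (a : C) : SameType M a (σ a) :=
  ⟨σ, h, rfl⟩

/-! ### Universality, splitting and forking in the monster -/

/-- `N` is universal over `M`. -/
def Univ (K : AbstractClass L) (lam : Cardinal.{u}) (M N : L.Substructure C) : Prop :=
  K.IsSub lam M ∧ K.IsSub lam N ∧ M ≤ N ∧
    ∀ M' : L.Substructure C, K.IsSub lam M' → M ≤ M' → ∃ σ : C ≃[L] C, Fixes σ M ∧ img σ M' ≤ N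

/-- The type of `a` over `N` does not split over `M`. -/
def NS (K : AbstractClass L) (lam : Cardinal.{u}) (M N : L.Substructure C) (a : C) : Prop :=
  M ≤ N ∧ ∀ σ : C ≃[L] C, Fixes σ M → ∀ N₁ : L.Substructure C, K.IsSub lam N₁ → M ≤ N₁ → N₁ ≤ N →
    img σ N₁ ≤ N → SameType (img σ N₁) (σ a) a

/-- The type of `a` over `N` does not fork over `M`. -/
def NF (K : AbstractClass L) (lam : Cardinal.{u}) (M N : L.Substructure C) (a : C) : Prop :=
  M ≤ N ∧ K.IsSub lam N ∧ ∃ M' : L.Substructure C, Univ K lam M' M ∧ NS K lam M' N a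

theorem Univ.img (h : Univ K lam M N) (hC : K.Mem C) (ρ : C ≃[L] C) :
    Univ K lam (img ρ M) (img ρ N) := by
  obtain ⟨h1, h2, h3, h4⟩ := h
  refine ⟨h1.img hC ρ, h2.img hC ρ, img_mono ρ h3, fun M' hM' hle => ?_⟩
  have hle' : M ≤ AbstractClass.img ρ.symm M' := img_le_iff.1 hle
  obtain ⟨σ, hσ, hσ'⟩ := h4 _ (hM'.img hC ρ.symm) hle'
  refine ⟨_, hσ.conj ρ, ?_⟩
  rw [img_comp, img_comp]
  exact img_mono ρ hσ'

theorem Univ.mono_right (h : Univ K lam M N) (hN' : K.IsSub lam N') (hle : N ≤ N') :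
    Univ K lam M N' :=
  ⟨h.1, hN', h.2.2.1.trans hle, fun M' hM' hMM' => by
    obtain ⟨σ, h1, h2⟩ := h.2.2.2 M' hM' hMM'
    exact ⟨σ, h1, h2.trans hle⟩⟩

theorem Monster.exists_isSub (hC : Monster K lam C) (A : Set C) (hA : #A ≤ lam) :
    ∃ S : L.Substructure C, K.IsSub lam S ∧ A ⊆ S :=
  hC.aec.exists_isSub hC.ls_le hC.mem hC.le_card A hA

theorem Monster.aleph0_le (hC : Monster K lam C) : ℵ₀ ≤ lam := hC.aec.aleph0_le hC.ls_le

theorem Monster.exists_isSub_sup (hC : Monster K lam C) (hM : K.IsSub lam M) (hN : K.IsSub lam N)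
    (a : C) : ∃ S : L.Substructure C, K.IsSub lam S ∧ M ≤ S ∧ N ≤ S ∧ a ∈ S := by
  have h0 := hC.aleph0_le
  obtain ⟨S, h1, h2⟩ := hC.exists_isSub ((M : Set C) ∪ (N : Set C) ∪ {a}) (by
    refine (Cardinal.mk_union_le _ _).trans (Cardinal.add_le_of_le h0
      ((Cardinal.mk_union_le _ _).trans (Cardinal.add_le_of_le h0 hM.2.le hN.2.le)) ?_)
    rw [Cardinal.mk_singleton]; exact Cardinal.one_le_aleph0.trans h0)
  exact ⟨S, h1, fun x hx => h2 (Or.inl (Or.inl hx)), fun x hx => h2 (Or.inl (Or.inr hx)),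
    h2 (Or.inr rfl)⟩

/-- An extension `P` of `M'` need not contain `M`, so it is first enlarged to some `W` that does.
Empty `C` is split off only because `exists_isSub_sup` takes an element. -/
theorem Univ.mono_left (hC : Monster K lam C) (h : Univ K lam M N) (hM' : K.IsSub lam M')
    (hle : M' ≤ M) : Univ K lam M' N :=
  ⟨hM', h.2.1, hle.trans h.2.2.1, fun P hP hMP => by
    by_cases hne : Nonempty C
    · obtain ⟨W, hW, h1, h2, -⟩ := hC.exists_isSub_sup h.1 hP hne.some
      obtain ⟨σ, hσ, hσ'⟩ := h.2.2.2 W hW h1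
      exact ⟨σ, hσ.mono hle, (img_mono σ h2).trans hσ'⟩
    · exact ⟨Language.Equiv.refl L C, fun _ _ => rfl, fun x => (hne ⟨x⟩).elim⟩⟩

theorem Monster.exists_univ (hC : Monster K lam C) (hM : K.IsSub lam M) :
    ∃ N, Univ K lam M N := by
  obtain ⟨T, hT, hMT, h⟩ := hC.exists_universal hM
  refine ⟨T, hM, hT, hMT, fun M' hM' hle => ?_⟩
  obtain ⟨g, hg, hgx, hgT⟩ := h M' (Substructure.inclusion hle) hM'.memCard
    (isEmb_inclusion hC.aec hM.1 hM'.1 hle)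
  obtain ⟨σ, hσ⟩ := hC.extend hM' (hg.isSub_range hM'.2) g.equivRange
  refine ⟨σ, fun x hx => ?_, ?_⟩
  · exact (hσ ⟨x, hle hx⟩).trans (hgx ⟨x, hx⟩)
  · rintro _ ⟨x, hx, rfl⟩
    exact (hσ ⟨x, hx⟩ : σ x = _) ▸ hgT _

theorem NS.mono (h : NS K lam M N a) (h1 : M ≤ M') (h2 : M' ≤ N') (h3 : N' ≤ N) :
    NS K lam M' N' a :=
  ⟨h2, fun σ hσ N₁ hN₁ h4 h5 h6 => h.2 σ (hσ.mono h1) N₁ hN₁ (h1.trans h4) (h5.trans h3)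
    (h6.trans h3)⟩

theorem NS.congr (h : NS K lam M N a) (hab : SameType N a b) : NS K lam M N b :=
  ⟨h.1, fun σ hσ N₁ hN₁ h1 h2 h3 => (((hab.mono h2).symm.img σ).trans (h.2 σ hσ N₁ hN₁ h1 h2 h3)).trans
    (hab.mono h3)⟩

theorem NS.img (h : NS K lam M N a) (hC : K.Mem C) (ρ : C ≃[L] C) :
    NS K lam (img ρ M) (img ρ N) (ρ a) := by
  refine ⟨img_mono ρ h.1, fun σ hσ N₁ hN₁ h1 h2 h3 => ?_⟩
  have h4 := h.2 (ρ.symm.comp (σ.comp ρ))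
    (fun x hx => by
      simp only [Language.Equiv.comp_apply]
      rw [hσ _ (apply_mem_img hx), Language.Equiv.symm_apply_apply])
    (AbstractClass.img ρ.symm N₁) (hN₁.img hC ρ.symm) (img_le_iff.1 h1)
    (by rw [img_le_iff]; exact h2)
    (by rw [img_comp, img_comp, img_img_symm, img_le_iff]; exact h3)
  have h5 := h4.img ρ
  rw [img_comp, img_comp, img_img_symm, img_img_symm] at h5
  simpa [Language.Equiv.comp_apply] using h5

/-- Types that do not split over `M` are determined by their restriction to a model that is
universal over `M`. -/
theorem NS.unique (hU : Univ K lam M N) (hN' : K.IsSub lam N') (hle : N ≤ N')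
    (ha : NS K lam M N' a) (hb : NS K lam M N' b) (hab : SameType N a b) : SameType N' a b := by
  -- Universality squeezes `N'` into `N` over `M`. Nonsplitting identifies `a` with `σ a` and `b`
  -- with `σ b` over the squeezed copy, where `a` and `b` agree already.
  obtain ⟨σ, hσ, hσN⟩ := hU.2.2.2 N' hN' (hU.2.2.1.trans hle)
  have h1 := ha.2 σ hσ N' hN' ha.1 le_rfl (hσN.trans hle)
  have h2 := hb.2 σ hσ N' hN' ha.1 le_rfl (hσN.trans hle)
  exact sameType_img_iff.1 ((h1.trans (hab.mono hσN)).trans h2.symm)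

/-- If `σ` squeezes `N'` into `N` over `M`, then `σ.symm a` is the required realization. -/
theorem NS.exists_extension (hC : K.Mem C) (hU : Univ K lam M N) (hN' : K.IsSub lam N')
    (hle : N ≤ N') (ha : NS K lam M N a) : ∃ b, SameType N a b ∧ NS K lam M N' b := by
  obtain ⟨σ, hσ, hσN⟩ := hU.2.2.2 N' hN' (hU.2.2.1.trans hle)
  refine ⟨σ.symm a, ?_, ?_⟩
  · have h1 := ha.2 σ hσ N hU.2.1 ha.1 le_rfl ((img_mono σ hle).trans hσN)
    have h2 := h1.img σ.symm
    rwa [img_symm_img, Language.Equiv.symm_apply_apply] at h2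
  · have h1 := ha.img hC σ.symm
    rw [hσ.symm.img_eq] at h1
    exact h1.mono le_rfl (hU.2.2.1.trans hle) (img_le_iff.1 hσN)

theorem NF.mono (h : NF K lam M N a) (h1 : M ≤ M') (h2 : M' ≤ N') (h3 : N' ≤ N)
    (hM' : K.IsSub lam M') (hN' : K.IsSub lam N') : NF K lam M' N' a := by
  obtain ⟨-, -, M₀, hU, hns⟩ := h
  exact ⟨h2, hN', M₀, hU.mono_right hM' h1, hns.mono le_rfl ((hU.2.2.1.trans h1).trans h2) h3⟩

theorem NF.isSub_left (h : NF K lam M N a) : K.IsSub lam M := by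
  obtain ⟨-, -, M₀, hU, -⟩ := h
  exact hU.2.1

theorem NF.congr (h : NF K lam M N a) (hab : SameType N a b) : NF K lam M N b := by
  obtain ⟨h1, h2, M₀, hU, hns⟩ := h
  exact ⟨h1, h2, M₀, hU, hns.congr hab⟩

theorem NF.img (h : NF K lam M N a) (hC : K.Mem C) (ρ : C ≃[L] C) :
    NF K lam (img ρ M) (img ρ N) (ρ a) := by
  obtain ⟨h1, h2, M₀, hU, hns⟩ := h
  exact ⟨img_mono ρ h1, h2.img hC ρ, _, hU.img hC ρ, hns.img hC ρ⟩

theorem NF.exists_extension (h : NF K lam M N a) (hC : K.Mem C) (hN' : K.IsSub lam N')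
    (hle : N ≤ N') : ∃ b, SameType N a b ∧ NF K lam M N' b := by
  obtain ⟨h1, h2, M₀, hU, hns⟩ := h
  obtain ⟨b, hb, hns'⟩ := hns.exists_extension hC (hU.mono_right h2 h1) hN' hle
  exact ⟨b, hb, h1.trans hle, hN', M₀, hU, hns'⟩

/-- A nonforking extension can be realized by `a` itself after moving the larger model. -/
theorem NF.exists_extension_img (h : NF K lam M N a) (hC : K.Mem C) (hN' : K.IsSub lam N')
    (hle : N ≤ N') : ∃ σ : C ≃[L] C, Fixes σ N ∧ NF K lam M (AbstractClass.img σ N') a := by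
  obtain ⟨b, ⟨τ, hτ, rfl⟩, hb⟩ := h.exists_extension hC hN' hle
  refine ⟨τ.symm, hτ.symm, ?_⟩
  have := hb.img hC τ.symm
  rwa [(hτ.symm.mono h.1).img_eq, Language.Equiv.symm_apply_apply] at this

end Orbits

/-! ### Nonforking -/

section

variable {C : Type u} [L.Structure C]

/-- A monster model of a superstable class with symmetry that is categorical in `lam`. -/
structure GoodMonster (K : AbstractClass L) (lam : Cardinal.{u}) (C : Type u) [L.Structure C] :
    Prop extends Monster K lam C where
  exists_img_eq : ∀ {M N : L.Substructure C}, K.IsSub lam M → K.IsSub lam N →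
    ∃ σ : C ≃[L] C, img σ M = N
  localChar : ∀ (δ : Ordinal.{u}) (F : Ordinal.{u} → L.Substructure C), Order.IsSuccLimit δ →
    δ < (Order.succ lam).ord → (∀ i ≤ δ, K.IsSub lam (F i)) → (∀ i j, i ≤ j → j ≤ δ → F i ≤ F j) →
    (∀ i ≤ δ, Order.IsSuccLimit i → (F i : Set C) = ⋃ j : Set.Iio i, (F j : Set C)) →
    (∀ i < δ, Univ K lam (F i) (F (i + 1))) → ∀ a, ∃ i < δ, NS K lam (F i) (F δ) a
  symmetry : ∀ {M W : L.Substructure C} {a b : C}, NF K lam M W a → b ∈ W →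
    ∃ W', NF K lam M W' b ∧ a ∈ W'

variable {M N M' N' P Q R : L.Substructure C} {a b c : C}

theorem Univ.trans (h : Univ K lam M N) (h' : Univ K lam N P) : Univ K lam M P :=
  h.mono_right h'.2.1 h'.2.2.1

/-- Dependent choice. -/
theorem exists_seq {α : Type*} (I : ℕ → α → Prop) (r : ℕ → α → α → Prop) {x : α} (hx : I 0 x)
    (h : ∀ n x, I n x → ∃ y, I (n + 1) y ∧ r n x y) :
    ∃ f : ℕ → α, f 0 = x ∧ ∀ n, I n (f n) ∧ r n (f n) (f (n + 1)) := by
  choose g hg using h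
  let f : ∀ n, {x // I n x} := fun n => Nat.rec ⟨x, hx⟩ (fun n y => ⟨g n y.1 y.2, (hg n y.1 y.2).1⟩) n
  exact ⟨fun n => (f n).1, rfl, fun n => ⟨(f n).2, (hg n (f n).1 (f n).2).2⟩⟩

theorem Monster.exists_glue_nat (hC : Monster K lam C) {A : ℕ → L.Substructure C}
    (hA : ∀ n, K.IsSub lam (A n)) (hmono : Monotone A) (σ : ℕ → C ≃[L] C)
    (hσ : ∀ n, ∀ x ∈ A n, σ (n + 1) x = σ n x) :
    ∃ τ : C ≃[L] C, ∀ n, ∀ x ∈ A n, τ x = σ n x := by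
  have h0 := hC.aleph0_le
  have hσ' : ∀ n m, n ≤ m → ∀ x ∈ A n, σ m x = σ n x := fun n m h => by
    induction m, h using Nat.le_induction with
    | base => exact fun _ _ => rfl
    | succ m h ih => exact fun x hx => (hσ m x (hmono h hx)).trans (ih x hx)
  have hS : K.IsSub lam (⨆ n, A n) := isSub_iSup hC.aec h0 (by
    rw [← Cardinal.lift_le.{0}, Cardinal.lift_mk_shrink]
    simpa using h0) hmono.directed_le hA
  obtain ⟨G, hG, hGx⟩ := exists_glue hC.aec ⟨A, hmono⟩
    (fun n => (σ n).toEmbedding.comp (A n).subtype) (fun n m h x => hσ' n m h x x.2)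
    (fun n => K.isEmb_comp (K.isEmb_equiv _ hC.mem) (hA n).isEmb)
  obtain ⟨τ, hτ⟩ := hC.extend hS (hG.isSub_range hS.2) G.equivRange
  exact ⟨τ, fun n x hx => (hτ ⟨x, le_iSup A n hx⟩).trans (hGx n ⟨x, hx⟩)⟩

theorem monotone_of_univ {A : ℕ → L.Substructure C} (h : ∀ n, Univ K lam (A n) (A (n + 1))) :
    Monotone A := monotone_nat_of_le_succ fun n => (h n).2.2.1

/-- Unions of universal `ω`-chains over the same model are isomorphic over it. -/
theorem Monster.exists_img_iSup_eq (hC : Monster K lam C) {A B : ℕ → L.Substructure C}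
    (hA : ∀ n, Univ K lam (A n) (A (n + 1))) (hB : ∀ n, Univ K lam (B n) (B (n + 1)))
    (h0 : A 0 = B 0) : ∃ σ : C ≃[L] C, Fixes σ (A 0) ∧ img σ (⨆ n, A n) = ⨆ n, B n := by
  obtain ⟨σ, hσ0, hσ⟩ := exists_seq (fun n (σ : C ≃[L] C) => img σ (A n) ≤ B n)
    (fun n σ τ => (∀ x ∈ A n, τ x = σ x) ∧ B n ≤ img τ (A (n + 1)))
    (x := Language.Equiv.refl L C) (by
      have : Fixes (Language.Equiv.refl L C) (A 0) := fun _ _ => rfl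
      rw [this.img_eq, h0]) (by
      intro n σ hσ
      -- Universality of `A (n + 1)` over `A n` makes the next image cover `B n`; universality of `B
      -- (n + 1)` over `B n` then puts that image inside `B (n + 1)`. Both corrections leave the
      -- values on `A n` unchanged.
      obtain ⟨g, hg, hgA⟩ := (hA n).2.2.2 (img σ.symm (B n)) ((hB n).1.img hC.mem _)
        (img_le_iff.1 hσ)
      have h1 : B n ≤ img (σ.comp g.symm) (A (n + 1)) := by
        rw [img_comp, ← Language.Equiv.symm_symm σ, ← img_le_iff,
          ← img_le_iff]
        exact hgA
      obtain ⟨k, hk, hkB⟩ := (hB n).2.2.2 (img (σ.comp g.symm) (A (n + 1)))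
        ((hA n).2.1.img hC.mem _) h1
      refine ⟨k.comp (σ.comp g.symm), by rwa [img_comp], fun x hx => ?_, ?_⟩
      · simp only [Language.Equiv.comp_apply]
        rw [hg.symm x hx]
        exact hk _ (hσ (apply_mem_img hx))
      · rw [img_comp]
        have := img_mono k h1
        rwa [hk.img_eq] at this)
  have hmA := monotone_of_univ hA
  have hmB := monotone_of_univ hB
  obtain ⟨τ, hτ⟩ := hC.exists_glue_nat (fun n => (hA n).1) hmA σ (fun n => (hσ n).2.1)
  refine ⟨τ, fun x hx => by rw [hτ 0 x hx, hσ0]; rfl, ?_⟩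
  ext y
  rw [mem_iSup_iff hmB.directed_le]
  constructor
  · rintro ⟨x, hx, rfl⟩
    obtain ⟨n, hn⟩ := (mem_iSup_iff hmA.directed_le).1 hx
    exact ⟨n, (hσ n).1 ((hτ n x hn).symm ▸ apply_mem_img hn : τ x ∈ img (σ n) (A n))⟩
  · rintro ⟨n, hn⟩
    obtain ⟨x, hx, rfl⟩ := (hσ n).2.2 hn
    exact ⟨x, le_iSup A (n + 1) hx, hτ (n + 1) x hx⟩

/-- The types of `a` and of some `t` over `B` are distinct, agree over `A`, and do not split
over `U` and over some `V` respectively. -/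
def Diverges (K : AbstractClass L) (lam : Cardinal.{u}) (a : C) (A U : L.Substructure C) : Prop :=
  ∃ (B V : L.Substructure C) (t : C), Univ K lam A B ∧ NS K lam U B a ∧ NS K lam V B t ∧
    Univ K lam U A ∧ Univ K lam V A ∧ SameType A a t ∧ ¬ SameType B a t

/-! ### Local character, uniqueness, transitivity and continuity of nonforking -/

namespace GoodMonster

variable (hC : GoodMonster K lam C)
include hC

/-- Local character along a universal chain that need not be continuous. -/
theorem exists_NS_iSup {j : Ordinal.{u}} (hj : Order.IsSuccLimit j) (hj' : j < (Order.succ lam).ord)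
    (G : Ordinal.{u} → L.Substructure C)
    (hG : ∀ i i', i < i' → i' < j → Univ K lam (G i) (G i')) (a : C) :
    ∃ i < j, NS K lam (G i) (⨆ i : Set.Iio j, G i) a := by
  classical
  have h0 := hC.aleph0_le
  have hsucc : ∀ i < j, i + 1 < j := fun i hi => hj.add_one_lt hi
  have hsub : ∀ i < j, K.IsSub lam (G i) := fun i hi => (hG i _ (lt_add_one i) (hsucc i hi)).1
  have hmono : ∀ i i', i ≤ i' → i' < j → G i ≤ G i' := fun i i' h h' => by
    rcases h.eq_or_lt with rfl | h
    · exact le_rfl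
    · exact (hG i i' h h').2.2.1
  -- The chain is made continuous by replacing its members at limits with unions. These are smaller,
  -- so the next member stays universal over them.
  let F : Ordinal.{u} → L.Substructure C := fun i =>
    if Order.IsSuccLimit i then ⨆ k : Set.Iio i, G k else G i
  have hFl : ∀ i, Order.IsSuccLimit i → F i = ⨆ k : Set.Iio i, G k := fun i h => if_pos h
  have hFn : ∀ i, ¬ Order.IsSuccLimit i → F i = G i := fun i h => if_neg h
  have hns : ∀ i : Ordinal.{u}, ¬ Order.IsSuccLimit (i + 1) := fun i h =>
    absurd (h.add_one_lt (lt_add_one i)) (lt_irrefl _)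
  have hdir : ∀ i ≤ j, Directed (· ≤ ·) fun k : Set.Iio i => G k := fun i hi =>
    Monotone.directed_le fun k k' h => hmono _ _ h (k'.2.trans_le hi)
  have hFG : ∀ i < j, F i ≤ G i := fun i hi => by
    by_cases h : Order.IsSuccLimit i
    · rw [hFl i h]; exact iSup_le fun k => hmono _ _ k.2.le hi
    · rw [hFn i h]
  have hGF : ∀ i i', i < i' → i' ≤ j → G i ≤ F i' := fun i i' h h' => by
    by_cases hl : Order.IsSuccLimit i'
    · rw [hFl i' hl]; exact le_iSup (fun k : Set.Iio i' => G k) ⟨i, h⟩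
    · rw [hFn i' hl]
      rcases h'.eq_or_lt with rfl | h'
      · exact (hl hj).elim
      · exact hmono _ _ h.le h'
  have hFsub : ∀ i ≤ j, K.IsSub lam (F i) := fun i hi => by
    by_cases h : Order.IsSuccLimit i
    · rw [hFl i h]
      have : Nonempty (Set.Iio i) := ⟨⟨0, h.bot_lt⟩⟩
      exact isSub_iSup hC.aec h0 (mk_shrink_Iio_le (hi.trans_lt hj')) (hdir i hi)
        fun k => hsub k (k.2.trans_le hi)
    · rw [hFn i h]
      rcases hi.eq_or_lt with rfl | hi
      · exact (h hj).elim
      · exact hsub i hi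
  have hFmono : ∀ i i', i ≤ i' → i' ≤ j → F i ≤ F i' := fun i i' h h' => by
    rcases h.eq_or_lt with rfl | h
    · exact le_rfl
    · exact (hFG i (h.trans_le h')).trans (hGF i i' h h')
  obtain ⟨i, hi, hns⟩ := hC.localChar j F hj hj' hFsub hFmono (fun i hi h => by
      have : Nonempty (Set.Iio i) := ⟨⟨0, h.bot_lt⟩⟩
      ext x
      rw [SetLike.mem_coe, hFl i h, mem_iSup_iff (hdir i hi), Set.mem_iUnion]
      constructor
      · rintro ⟨k, hk⟩
        exact ⟨⟨k + 1, h.add_one_lt k.2⟩, hGF k _ (lt_add_one _)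
          ((h.add_one_lt k.2).le.trans hi) hk⟩
      · rintro ⟨k, hk⟩
        exact ⟨k, hFG k (k.2.trans_le hi) hk⟩)
    (fun i hi => by
      rw [hFn _ (hns i)]
      exact (hG i _ (lt_add_one i) (hsucc i hi)).mono_left hC.toMonster (hFsub i hi.le) (hFG i hi))
    a
  rw [hFl j hj] at hns
  exact ⟨i, hi, hns.mono (hFG i hi) (le_iSup (fun k : Set.Iio j => G k) ⟨i, hi⟩) le_rfl⟩

theorem exists_NS_nat {A : ℕ → L.Substructure C} (hA : ∀ n, Univ K lam (A n) (A (n + 1))) (a : C) :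
    ∃ n, NS K lam (A n) (⨆ n, A n) a := by
  have h0 := hC.aleph0_le
  have hnat : ∀ i : Ordinal.{u}, i < Ordinal.omega0 → ∃ n : ℕ, i = n :=
    fun i hi => Ordinal.lt_omega0.1 hi
  have hA' : ∀ n m, n < m → Univ K lam (A n) (A m) := fun n m h => by
    induction m, Nat.succ_le_of_lt h using Nat.le_induction with
    | base => exact hA n
    | succ m h ih => exact (ih (by omega)).trans (hA m)
  obtain ⟨i, hi, h⟩ := hC.exists_NS_iSup Ordinal.isSuccLimit_omega0
    (j := Ordinal.omega0) (by
      rw [← Cardinal.ord_aleph0, Cardinal.ord_lt_ord]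
      exact Order.lt_succ_of_le h0)
    -- Taking `Cardinal.toNat` of the cardinality reads a finite ordinal as a natural number.
    (fun i => A (Cardinal.toNat i.card)) (by
      intro i i' h h'
      obtain ⟨n, rfl⟩ := hnat _ (h.trans h')
      obtain ⟨m, rfl⟩ := hnat _ h'
      simp only [Ordinal.card_nat, Cardinal.toNat_natCast]
      exact hA' n m (by exact_mod_cast h)) a
  obtain ⟨n, rfl⟩ := hnat _ hi
  refine ⟨n, ?_⟩
  simp only [Ordinal.card_nat, Cardinal.toNat_natCast] at h
  convert h using 1
  apply le_antisymm
  · refine iSup_le fun m => ?_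
    refine le_trans ?_ (le_iSup _ (⟨(m : Ordinal), Ordinal.natCast_lt_omega0 m⟩ : Set.Iio Ordinal.omega0))
    simp
  · exact iSup_le fun i => le_iSup A _

/-- Some submodel is the union of a universal `ω`-chain, and by categoricity an automorphism carries
it to `M`. -/
theorem exists_univ_chain (hM : K.IsSub lam M) :
    ∃ A : ℕ → L.Substructure C, (∀ n, Univ K lam (A n) (A (n + 1))) ∧ ⨆ n, A n = M := by
  have h0 := hC.aleph0_le
  obtain ⟨A, -, hA⟩ := exists_seq (fun _ => K.IsSub lam) (fun _ => Univ K lam) hM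
    (fun _ S hS => by
      obtain ⟨N, hN⟩ := hC.exists_univ hS
      exact ⟨N, hN.2.1, hN⟩)
  have hA' := fun n => (hA n).2
  have hS : K.IsSub lam (⨆ n, A n) := isSub_iSup hC.aec h0 (by
    rw [← Cardinal.lift_le.{0}, Cardinal.lift_mk_shrink]
    simpa using h0) (monotone_of_univ hA').directed_le (fun n => (hA n).1)
  obtain ⟨σ, hσ⟩ := hC.exists_img_eq hS hM
  refine ⟨fun n => img σ (A n), fun n => (hA' n).img hC.mem σ, ?_⟩
  rw [← hσ]
  exact (Substructure.map_iSup _ _).symm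

theorem NF_self (hM : K.IsSub lam M) (a : C) : NF K lam M M a := by
  obtain ⟨A, hA, rfl⟩ := hC.exists_univ_chain hM
  obtain ⟨n, hn⟩ := hC.exists_NS_nat hA a
  exact ⟨le_rfl, hM, A n, (hA n).mono_right hM (le_iSup A (n + 1)), hn⟩

/-- Let `g` squeeze `B` into `A` over `V`, and let `ρ` fix `A` and send `g.symm t`, which has the
type of `t` over `B`, to `a`. Then `π = ρ ∘ g.symm` preserves `V`, sends `t` to `a`, and sends `A`
to a model containing `ρ[B]`. The image of the configuration under `π` is again a divergence, in
which `a` takes the role of `t` with witness `V`. The old disagreement survives between `a` and `s =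
ρ a` over `ρ[B]`. -/
theorem Diverges.step {A U : L.Substructure C} (h : Diverges K lam a A U) :
    ∃ A' U', Diverges K lam a A' U' ∧ Univ K lam A A' ∧ U' ≤ A ∧
      ∃ (B : L.Substructure C) (s : C), K.IsSub lam B ∧ A ≤ B ∧ B ≤ A' ∧ NS K lam U B s ∧
        SameType A s a ∧ ¬ SameType B s a := by
  obtain ⟨B, V, t, hAB, ha, ht, hU, hV, hat, hne⟩ := h
  have hm := hC.mem
  obtain ⟨g, hg, hgB⟩ := hV.2.2.2 B hAB.2.1 (hV.2.2.1.trans hAB.2.2.1)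
  have hts : SameType B t (g.symm t) := by
    have h1 := (ht.2 g hg B hAB.2.1 ht.1 le_rfl (hgB.trans hAB.2.2.1)).img g.symm
    rwa [img_symm_img, Language.Equiv.symm_apply_apply] at h1
  obtain ⟨ρ, hρ, hρa⟩ := (hat.trans (hts.mono hAB.2.2.1)).symm
  let π := ρ.comp g.symm
  have hπt : π t = a := hρa
  have hπV : img π V = V := by
    rw [img_comp, hg.symm.img_eq, (hρ.mono hV.2.2.1).img_eq]
  have hBA : img ρ B ≤ img π A := by
    rw [img_comp]; exact img_mono ρ (img_le_iff.1 hgB)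
  have hAρB : Univ K lam A (img ρ B) := by
    have := hAB.img hm ρ
    rwa [hρ.img_eq] at this
  have h1 := ht.img hm π
  rw [hπV, hπt] at h1
  have h2 := hV.img hm π
  rw [hπV] at h2
  have h3 := ha.img hm ρ
  rw [(hρ.mono hU.2.2.1).img_eq] at h3
  refine ⟨img π A, V, ⟨img π B, img π U, π a, hAB.img hm π, h1, ha.img hm π, h2, hU.img hm π, ?_, ?_⟩,
    hAρB.mono_right (hAB.1.img hm π) hBA, hV.2.2.1, img ρ B, ρ a, hAρB.2.1, hAρB.2.2.1, hBA, h3,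
    (hρ.sameType a).symm, fun h => ?_⟩
  · have := (hat.img π).symm
    rwa [hπt] at this
  · intro h
    rw [← hπt, sameType_img_iff, hπt] at h
    exact hne h.symm
  · rw [← hρa, sameType_img_iff, hρa] at h
    exact hne (h.trans hts.symm)

/-- Nonforking extensions are unique, even when they are witnessed by different models. -/
theorem NF_unique (ha : NF K lam M N a) (hb : NF K lam M N b) (hab : SameType M a b) :
    SameType N a b := by
  by_contra hne
  obtain ⟨hMN, hN, U, hU, hnsa⟩ := ha
  obtain ⟨-, -, V, hV, hnsb⟩ := hb
  -- `Diverges` wants its larger model universal over the smaller one, so both types are first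
  -- extended beyond `N`.
  obtain ⟨B, hB⟩ := hC.exists_univ hN
  obtain ⟨a', ha', hnsa'⟩ := hnsa.exists_extension hC.mem (hU.mono_right hN hMN) hB.2.1 hB.2.2.1
  obtain ⟨b', hb', hnsb'⟩ := hnsb.exists_extension hC.mem (hV.mono_right hN hMN) hB.2.1 hB.2.2.1
  have hdiv : Diverges K lam a' M U :=
    ⟨B, V, b', hB.mono_left hC.toMonster hU.2.1 hMN, hnsa', hnsb', hU, hV,
      ((ha'.mono hMN).symm.trans hab).trans (hb'.mono hMN),
      fun h => hne ((ha'.trans (h.mono hB.2.2.1)).trans hb'.symm)⟩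
  obtain ⟨f, -, hf⟩ := exists_seq (α := L.Substructure C × L.Substructure C)
    (fun _ p => Diverges K lam a' p.1 p.2)
    (fun _ p q => Univ K lam p.1 q.1 ∧ q.2 ≤ p.1 ∧
      ∃ (B : L.Substructure C) (s : C), K.IsSub lam B ∧ p.1 ≤ B ∧ B ≤ q.1 ∧ NS K lam p.2 B s ∧
        SameType p.1 s a' ∧ ¬ SameType B s a')
    (x := (M, U)) hdiv (fun _ p hp => by
      obtain ⟨A', U', h1, h2⟩ := Diverges.step hC hp
      exact ⟨(A', U'), h1, h2⟩)
  obtain ⟨k, hk⟩ := hC.exists_NS_nat (A := fun n => (f n).1) (fun n => (hf n).2.1) a'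
  obtain ⟨-, hU1, -⟩ := (hf k).2
  obtain ⟨-, -, B', s, hB', h1, h2, h3, h4, h5⟩ := (hf (k + 1)).2
  have hkk := (hf k).2.1
  have hle : (f k).1 ≤ B' := hkk.2.2.1.trans h1
  -- The witness for `s` lies inside the `k`-th model, so neither `s` nor `a'` splits over that
  -- model. They agree on the next model, which is universal over it, hence also on `B'`.
  exact h5 (NS.unique hkk hB' h1 (h3.mono hU1 hle le_rfl)
    (hk.mono le_rfl hle (h2.trans (le_iSup (fun n => (f n).1) (k + 2)))) h4)

/-- Extend the type of `a` over `N` to `P` without forking over `M`; by uniqueness over `N` this is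
the type of `a` itself. -/
theorem NF_trans (h : NF K lam M N a) (h' : NF K lam N P a) : NF K lam M P a := by
  obtain ⟨b, hb, hMP⟩ := h.exists_extension hC.mem h'.2.1 h'.1
  have h1 : NF K lam N P b := hMP.mono h.1 h'.1 le_rfl h.2.1 h'.2.1
  exact hMP.congr (hC.NF_unique h' h1 hb).symm

/-- Nonforking is continuous along universal chains. -/
theorem NF_iSup {j : Ordinal.{u}} (hj : Order.IsSuccLimit j) (hj' : j < (Order.succ lam).ord)
    (G : Ordinal.{u} → L.Substructure C)
    (hG : ∀ i i', i < i' → i' < j → Univ K lam (G i) (G i')) (a : C)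
    (h : ∀ i < j, NF K lam M (G i) a) : NF K lam M (⨆ i : Set.Iio j, G i) a := by
  obtain ⟨i, hi, hns⟩ := hC.exists_NS_iSup hj hj' G hG a
  have hi' := hj.add_one_lt hi
  have : Nonempty (Set.Iio j) := ⟨⟨i, hi⟩⟩
  -- Nonsplitting over `G i` gives nonforking over `G (i + 1)`, which is universal over it;
  -- transitivity brings the base down to `M`.
  refine hC.NF_trans (h _ hi') ⟨le_iSup (fun k : Set.Iio j => G k) ⟨i + 1, hi'⟩, ?_, G i,
    hG i _ (lt_add_one i) hi', hns⟩
  refine isSub_iSup hC.aec hC.aleph0_le (mk_shrink_Iio_le hj') (Monotone.directed_le ?_)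
    fun k => (h k k.2).2.1
  intro k k' hk
  rcases hk.eq_or_lt with rfl | hk
  · exact le_rfl
  · exact (hG k k' hk k'.2).2.2.1

/-- Amalgamation of `R` and `P` over `Q`, such that `b ∈ R` and `c ∈ P` do not fork over `Q`. -/
theorem exists_symmetric_amalgam (hQ : K.IsSub lam Q) (hR : K.IsSub lam R) (hP : K.IsSub lam P)
    (hQR : Q ≤ R) (hQP : Q ≤ P) (b : C) (hc : c ∈ P) :
    ∃ σ : C ≃[L] C, Fixes σ Q ∧ NF K lam Q P (σ b) ∧ NF K lam Q (img σ R) c := by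
  obtain ⟨b', ⟨ρ, hρ, hρb⟩, hb'⟩ := (hC.NF_self hQ b).exists_extension hC.mem hP hQP
  obtain ⟨W, hW, hbW⟩ := hC.symmetry hb' hc
  obtain ⟨X, hX, hWX, hRX, -⟩ := hC.exists_isSub_sup hW.2.1 (hR.img hC.mem ρ) c
  -- Symmetry controls `c` only over some `W` containing `b'`. The image of `R` is moved over `W`,
  -- which leaves `b'` in place, to a position over which `c` does not fork.
  obtain ⟨θ, hθ, hθX⟩ := hW.exists_extension_img hC.mem hX hWX
  have hfix : Fixes (θ.comp ρ) Q := (hθ.mono hW.1).comp hρ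
  refine ⟨θ.comp ρ, hfix, ?_, ?_⟩
  · rw [Language.Equiv.comp_apply, hρb, hθ b' hbW]; exact hb'
  · refine hθX.mono le_rfl ?_ ?_ hQ (hR.img hC.mem _)
    · have := img_mono (θ.comp ρ) hQR
      rwa [hfix.img_eq] at this
    · rw [img_comp]; exact img_mono θ hRX

end GoodMonster

end

section

variable {C : Type u} [L.Structure C] {M N M' N' P Q R : L.Substructure C} {a b c : C}

/-! ### Reduced triples -/

/-- Every nonforking extension of the type of `b` over `M` is over a model that meets `N`
only in `M`. -/
def Reduced (K : AbstractClass L) (lam : Cardinal.{u}) (M N : L.Substructure C) (b : C) : Prop :=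
  M ≤ N ∧ K.IsSub lam N ∧ b ∈ N ∧ ∀ P, NF K lam M P b → N ⊓ P ≤ M

theorem Reduced.img (h : Reduced K lam M N b) (hC : K.Mem C) (ρ : C ≃[L] C) :
    Reduced K lam (img ρ M) (img ρ N) (ρ b) := by
  obtain ⟨h1, h2, h3, h4⟩ := h
  refine ⟨img_mono ρ h1, h2.img hC ρ, apply_mem_img h3, fun P hP => ?_⟩
  have h5 := hP.img hC ρ.symm
  rw [img_symm_img, Language.Equiv.symm_apply_apply] at h5
  rintro x ⟨hx, hx'⟩
  refine mem_img.2 (h4 _ h5 ⟨mem_img.1 hx, apply_mem_img hx'⟩)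

theorem exists_extend_Iio {α : Type*} [Nonempty α] {j : Ordinal.{u}} (g : Set.Iio j → α) :
    ∃ g' : Ordinal.{u} → α, g = fun i : Set.Iio j => g' i :=
  ⟨Function.extend Subtype.val g fun _ => Classical.arbitrary α,
    funext fun i => (Subtype.val_injective.extend_apply g _ i).symm⟩

namespace GoodMonster

variable (hC : GoodMonster K lam C)
include hC

/-- The reduced triple is found over another model `M_β` and carried back to `M`. This is possible
because `M` and `M_β` are unions of universal `ω`-chains over the same `M₀`, and the type of `b`
over each does not fork over `M₀`. -/
theorem exists_reduced (hM : K.IsSub lam M) (b : C) : ∃ N, Reduced K lam M N b := by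
  have h0 := hC.aleph0_le
  have hm := hC.mem
  obtain ⟨A, hA, hAM⟩ := hC.exists_univ_chain hM
  obtain ⟨n, hn⟩ := hC.exists_NS_nat hA b
  rw [hAM] at hn
  have hleM : ∀ n, A n ≤ M := fun n => hAM ▸ le_iSup A n
  -- One index above `n`, so that `A n` witnesses nonforking over `M₀`; the tail of the chain from
  -- `M₀` still has union `M`.
  let M₀ := A (n + 1)
  have hM₀ : K.IsSub lam M₀ := (hA n).2.1
  have hM₀M : NF K lam M₀ M b := ⟨hleM _, hM, A n, hA n, hn⟩
  obtain ⟨N₀, hN₀, h1, -, hbN₀⟩ := hC.exists_isSub_sup hM₀ hM₀ b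
  let r : L.Substructure C × L.Substructure C → L.Substructure C × L.Substructure C → Prop :=
    fun p q => Univ K lam p.1 q.1 ∧ p.2 ≤ q.2
  let I : L.Substructure C × L.Substructure C → Prop := fun p =>
    NF K lam M₀ p.1 b ∧ K.IsSub lam p.2 ∧ p.1 ≤ p.2 ∧ b ∈ p.2
  obtain ⟨F, G, hFG⟩ := exists_chain (Order.succ lam).ord r
    (fun _ _ _ h h' => ⟨h.1.trans h'.1, h.2.trans h'.2⟩) (fun _ => I) (fun _ => I)
    (fun _ p q => ¬ Reduced K lam p.1 p.2 b → ¬ p.2 ⊓ q.1 ≤ p.1)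
    (by
      rintro i - p ⟨hp1, hp2, hp3, hp4⟩
      obtain ⟨X, hX, hred⟩ : ∃ X, NF K lam p.1 X b ∧
          (¬ Reduced K lam p.1 p.2 b → ¬ p.2 ⊓ X ≤ p.1) := by
        by_cases hr : Reduced K lam p.1 p.2 b
        · exact ⟨p.1, hC.NF_self hp1.2.1 b, fun h => (h hr).elim⟩
        · have : ∃ X, NF K lam p.1 X b ∧ ¬ p.2 ⊓ X ≤ p.1 := by
            by_contra! h
            exact hr ⟨hp3, hp2, hp4, h⟩
          obtain ⟨X, h1, h2⟩ := this
          exact ⟨X, h1, fun _ => h2⟩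
      -- Passing to a universal extension keeps the first coordinates a universal chain. Moving it
      -- over `X` keeps `b` nonforking over `M₀`.
      obtain ⟨W, hW⟩ := hC.exists_univ hX.2.1
      obtain ⟨σ, hσ, hσW⟩ := (hC.NF_trans hp1 hX).exists_extension_img hm hW.2.1 hW.2.2.1
      have hU := hW.img hm σ
      rw [hσ.img_eq] at hU
      obtain ⟨N', hN', h3, h4, -⟩ := hC.exists_isSub_sup hp2 hU.2.1 b
      exact ⟨(img σ W, N'), ⟨hσW, hN', h4, h3 hp4⟩,
        ⟨hU.mono_left hC.toMonster hp1.2.1 hX.1, h3⟩,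
        fun h h' => hred h ((inf_le_inf_left _ hU.2.2.1).trans h')⟩)
    (fun j g q => (j = 0 → q.1 = M₀) ∧
      (Order.IsSuccLimit j → q.1 = ⨆ i, (g i).1 ∧ q.2 = ⨆ i, (g i).2))
    (by
      intro j hj g hg hgg
      rcases Ordinal.zero_or_succ_or_isSuccLimit j with rfl | ⟨k, rfl⟩ | hl
      · exact ⟨(M₀, N₀), ⟨hM₀M.mono le_rfl le_rfl hM₀M.1 hM₀ hM₀, hN₀, h1, hbN₀⟩,
          ⟨fun _ => rfl, fun h => (h.ne_bot rfl).elim⟩,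
          fun i => (not_lt_zero (Set.mem_Iio.1 i.2)).elim⟩
      · refine ⟨g ⟨k, Order.lt_succ k⟩, hg _, ⟨fun h => (Order.succ_ne_bot k h).elim,
          fun h => (Order.not_isSuccLimit_succ k h).elim⟩, fun i => ?_⟩
        rcases (Order.lt_succ_iff.1 (Set.mem_Iio.1 i.2)).eq_or_lt with h | h
        · exact Or.inl (congrArg g (Subtype.ext h))
        · exact Or.inr (hgg _ _ h)
      · obtain ⟨g, rfl⟩ := exists_extend_Iio g
        have hne : Nonempty (Set.Iio j) := ⟨⟨0, hl.bot_lt⟩⟩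
        have hd2 : Directed (· ≤ ·) fun i : Set.Iio j => (g i).2 := Monotone.directed_le
          fun i i' h => by
            rcases h.eq_or_lt with rfl | h
            · exact le_rfl
            · exact (hgg i i' h).2
        refine ⟨(⨆ i : Set.Iio j, (g i).1, ⨆ i : Set.Iio j, (g i).2), ⟨?_, ?_, ?_, ?_⟩,
          ⟨fun h => (hl.ne_bot h).elim, fun _ => ⟨rfl, rfl⟩⟩, fun i => Or.inr ⟨?_, ?_⟩⟩
        · exact hC.NF_iSup hl hj (fun i => (g i).1)
            (fun i i' h h' => (hgg ⟨i, h.trans h'⟩ ⟨i', h'⟩ h).1) b (fun i hi => (hg ⟨i, hi⟩).1)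
        · exact isSub_iSup hC.aec h0 (mk_shrink_Iio_le hj) hd2 fun i => (hg i).2.1
        · exact iSup_mono fun i => (hg i).2.2.1
        · exact le_iSup (fun i : Set.Iio j => (g i).2) ⟨0, hl.bot_lt⟩ (hg ⟨0, hl.bot_lt⟩).2.2.2
        · have hi := hl.add_one_lt i.2
          refine (hgg i ⟨i + 1, hi⟩ (lt_add_one (i : Ordinal))).1.mono_right ?_
            (le_iSup (fun i : Set.Iio j => (g i).1) ⟨i + 1, hi⟩)
          exact (hC.NF_iSup hl hj (fun i => (g i).1)
            (fun i i' h h' => (hgg ⟨i, h.trans h'⟩ ⟨i', h'⟩ h).1) b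
            (fun i hi => (hg ⟨i, hi⟩).1)).2.1
        · exact le_iSup (fun i : Set.Iio j => (g i).2) i)
  have hFle : ∀ i j, i < j → j < (Order.succ lam).ord → r (F i) (F j) := fun i j h hj =>
    ((hFG j hj).2.2.2.2.2.2 i h).1
  have hGF : ∀ i j, i < j → j < (Order.succ lam).ord → (G i).1 ≤ (F j).1 ∧ (G i).2 ≤ (F j).2 :=
    fun i j h hj => by
      rcases (hFG j hj).2.2.2.2.2.1 i h with h | h
      · rw [h]; exact ⟨le_rfl, le_rfl⟩
      · exact ⟨h.1.2.2.1, h.2⟩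
  -- There are only `lam` elements in `N_j`, so those that ever enter some `M_i` have all entered by
  -- a single stage `j'`.
  have hbound : ∀ j < (Order.succ lam).ord, ∃ j' < (Order.succ lam).ord, j < j' ∧
      ∀ x ∈ (F j).2, ∀ i < (Order.succ lam).ord, x ∈ (F i).1 → x ∈ (F j').1 := by
    intro j hj
    have : ∀ x : (F j).2, ∃ k < (Order.succ lam).ord,
        ∀ i < (Order.succ lam).ord, (x : C) ∈ (F i).1 → (x : C) ∈ (F k).1 := fun x => by
      by_cases h : ∃ k < (Order.succ lam).ord, (x : C) ∈ (F k).1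
      · obtain ⟨k, hk, hx⟩ := h
        exact ⟨k, hk, fun _ _ _ => hx⟩
      · exact ⟨j, hj, fun i hi hx => (h ⟨i, hi, hx⟩).elim⟩
    choose f hf hfx using this
    obtain ⟨k, hk, hkx⟩ := exists_ordinal_bound h0 (hFG j hj).1.2.1.2.le f hf
    have hk' := add_one_lt_ord_succ h0 (max_lt hj hk)
    refine ⟨max j k + 1, hk', Order.lt_add_one_iff.2 (le_max_left _ _), fun x hx i hi hxi => ?_⟩
    exact (hFle _ _ (Order.lt_add_one_iff.2 ((hkx ⟨x, hx⟩).trans (le_max_right _ _))) hk').1.2.2.1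
      (hfx ⟨x, hx⟩ i hi hxi)
  have hpos : 0 < (Order.succ lam).ord := Cardinal.ord_pos.2 (Order.bot_lt_succ lam)
  obtain ⟨α, hα0, hα⟩ := exists_seq (fun _ j => j < (Order.succ lam).ord)
    (fun _ j j' => j < j' ∧
      ∀ x ∈ (F j).2, ∀ i < (Order.succ lam).ord, x ∈ (F i).1 → x ∈ (F j').1) hpos
    (fun _ j hj => by
      obtain ⟨j', h1, h2⟩ := hbound j hj
      exact ⟨j', h1, h2⟩)
  let β : Ordinal.{u} := ⨆ n : ULift.{u} ℕ, α n.down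
  have hαβ' : ∀ n, α n ≤ β := fun n => Ordinal.le_iSup (fun n : ULift.{u} ℕ => α n.down) ⟨n⟩
  have hαβ : ∀ n, α n < β := fun n => (hα n).2.1.trans_le (hαβ' (n + 1))
  have hβ : β < (Order.succ lam).ord := Ordinal.iSup_lt_of_lt_cof (by
    rw [(Cardinal.isRegular_succ h0).cof_ord]
    exact (Cardinal.mk_le_aleph0.trans h0).trans_lt (Order.lt_succ lam)) fun n => (hα n.down).1
  have hlt : ∀ i < β, ∃ n, i < α n := fun i hi => by
    obtain ⟨n, hn⟩ := (Ordinal.lt_iSup_iff).1 hi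
    exact ⟨n.down, hn⟩
  have hlim : Order.IsSuccLimit β := by
    refine Ordinal.isSuccLimit_iff.2 ⟨(hα0 ▸ hαβ 0).ne', Order.isSuccPrelimit_of_succ_lt fun i hi => ?_⟩
    obtain ⟨n, hn⟩ := hlt i hi
    exact (Order.succ_le_of_lt hn).trans_lt (hαβ n)
  have hFβ := (hFG β hβ).2.2.2.2.1.2 hlim
  have hne : Nonempty (Set.Iio β) := ⟨⟨0, hlim.bot_lt⟩⟩
  -- An element of `N_β` lies in some `N_{α n}`. If it is in `M_{β + 1}`, it was already in `M_{α (n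
  -- + 1)} ≤ M_β`, so stage `β` adds to `M_β` nothing from `N_β`.
  have hredβ : Reduced K lam (F β).1 (F β).2 b := by
    by_contra hr
    refine (hFG β hβ).2.2.2.1 hr ?_
    rintro x ⟨hx, hx'⟩
    rw [hFβ.2] at hx
    have hd2 : Directed (· ≤ ·) fun i : Set.Iio β => (G i).2 := Monotone.directed_le
      fun i i' h => by
        rcases h.eq_or_lt with rfl | h
        · exact le_rfl
        · exact ((hFG i' (i'.2.trans hβ)).2.2.2.2.2.2 i h).2.2
    obtain ⟨i, hi⟩ := (mem_iSup_iff hd2).1 hx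
    obtain ⟨n, hn⟩ := hlt i i.2
    have h3 := (hGF i (α n) hn (hα n).1).2 hi
    have hβ1 := add_one_lt_ord_succ h0 hβ
    exact (hFle _ _ (hαβ (n + 1)) hβ).1.2.2.1
      ((hα n).2.2 x h3 (β + 1) hβ1 ((hGF β (β + 1) (lt_add_one β) hβ1).1 hx'))
  have hUα : ∀ n, Univ K lam (F (α n)).1 (F (α (n + 1))).1 := fun n =>
    (hFle _ _ (hα n).2.1 (hα (n + 1)).1).1
  have hsup : ⨆ n, (F (α n)).1 = (F β).1 := by
    apply le_antisymm
    · exact iSup_le fun n => (hFle _ _ (hαβ n) hβ).1.2.2.1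
    · rw [hFβ.1]
      refine iSup_le fun i => ?_
      obtain ⟨n, hn⟩ := hlt i i.2
      exact (hGF i (α n) hn (hα n).1).1.trans (le_iSup (fun n => (F (α n)).1) n)
  have hsup' : ⨆ k, A (n + 1 + k) = M := by
    rw [← hAM]
    apply le_antisymm
    · exact iSup_le fun k => le_iSup A _
    · exact iSup_le fun k => (monotone_of_univ hA (by omega)).trans
        (le_iSup (fun k => A (n + 1 + k)) k)
  have hF0 : (F (α 0)).1 = M₀ := by rw [hα0]; exact (hFG 0 hpos).2.2.2.2.1.1 rfl
  obtain ⟨σ, hσ, hσM⟩ := hC.exists_img_iSup_eq (A := fun k => A (n + 1 + k))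
    (fun k => hA (n + 1 + k)) hUα hF0.symm
  rw [hsup', hsup] at hσM
  have hσ : Fixes σ M₀ := hσ
  have h2 := hM₀M.img hm σ
  rw [hσ.img_eq, hσM] at h2
  -- Over `M_β` both `σ b` and `b` are nonforking over `M₀`, where they agree. Uniqueness corrects
  -- `σ` to an automorphism that fixes `b`.
  obtain ⟨τ, hτ, hτb⟩ := hC.NF_unique h2 (hFG β hβ).1.1 (hσ.sameType b).symm
  have h3 := hredβ.img hm (τ.comp σ).symm
  have h4 : (τ.comp σ).symm b = b := by
    conv_lhs => rw [← hτb]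
    exact (τ.comp σ).symm_apply_apply b
  have h5 : img (τ.comp σ).symm (F β).1 = M := by
    have : img (τ.comp σ) M = (F β).1 := by rw [img_comp, hσM, hτ.img_eq]
    rw [← this, img_symm_img]
  rw [h4, h5] at h3
  exact ⟨_, h3⟩

/-- A single step of the construction of a disjoint nonforking amalgam. -/
theorem exists_disjoint_step (hM : K.IsSub lam M) (hQ : K.IsSub lam Q) (hP : K.IsSub lam P)
    (hMQ : M ≤ Q) (hQP : Q ≤ P) (hc : c ∈ P) (b : C) :
    ∃ (N : L.Substructure C) (b' : C) (Q' : L.Substructure C), K.IsSub lam N ∧ M ≤ N ∧ b' ∈ N ∧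
      SameType M b b' ∧ N ⊓ P ≤ M ∧ NF K lam M P b' ∧ N ≤ Q' ∧ Univ K lam Q Q' ∧
      NF K lam Q Q' c := by
  have hm := hC.mem
  obtain ⟨N, hN⟩ := hC.exists_reduced hM b
  obtain ⟨b₁, ⟨σ, hσ, hσb⟩, hb₁⟩ := (hC.NF_self hM b).exists_extension hm hQ hMQ
  have hN₁ := hN.img hm σ
  rw [hσ.img_eq, hσb] at hN₁
  obtain ⟨R, hR, hQR, hNR, -⟩ := hC.exists_isSub_sup hQ hN₁.2.1 b
  -- The universal extension is there so that `Q'` will be universal over `Q`, as continuity at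
  -- limits requires.
  obtain ⟨R', hR'⟩ := hC.exists_univ hR
  have hQR' := hR'.mono_left hC.toMonster hQ hQR
  obtain ⟨τ, hτ, h1, h2⟩ := hC.exists_symmetric_amalgam hQ hR'.2.1 hP (hQR.trans hR'.2.2.1) hQP b₁ hc
  have hτM := hτ.mono hMQ
  have hN₂ := hN₁.img hm τ
  rw [hτM.img_eq] at hN₂
  have h3 := hb₁.img hm τ
  rw [hτM.img_eq, hτ.img_eq] at h3
  have h4 := hC.NF_trans h3 h1
  have h5 := hQR'.img hm τ
  rw [hτ.img_eq] at h5
  have h6 : SameType M b b₁ := ⟨σ, hσ, hσb⟩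
  -- By transitivity `τ b₁` does not fork over `M` in `P`, so the reduced triple meets `P` only in
  -- `M`.
  exact ⟨_, τ b₁, img τ R', hN₂.2.1, hN₂.1, hN₂.2.2.1,
    h6.trans (hτM.sameType b₁), hN₂.2.2.2 P h4, h4,
    img_mono τ (hNR.trans hR'.2.2.1), h5, h2⟩

end GoodMonster

end

section

variable {C : Type u} [L.Structure C] {M N M' N' P Q R : L.Substructure C} {a b c : C}

/-! ### Orbital types and orbits -/

namespace Monster

variable (hC : Monster K lam C)
include hC

/-- Over models in `K_lam`, equality of orbital types of elements of `C` is conjugacy. -/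
theorem tp_eq_iff {Y : Type u} [L.Structure Y] (hY : K.MemCard lam Y) {w w' : Y ↪[L] C}
    (hw : K.IsEmb w) (hw' : K.IsEmb w') {a b : C} :
    tp hw a = tp hw' b ↔ ∃ σ : C ≃[L] C, (∀ y, σ (w y) = w' y) ∧ σ a = b := by
  constructor
  · intro h
    have h1 : ∀ x : C, #({x} : Set C) ≤ lam := fun x => by
      rw [Cardinal.mk_singleton]; exact Cardinal.one_le_aleph0.trans hC.aleph0_le
    obtain ⟨X, hX, hwX, ha⟩ := hC.aec.exists_isSub_range hC.ls_le hC.mem w hY.2 {a} (h1 a)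
    obtain ⟨B, hB, hwB, hb⟩ := hC.aec.exists_isSub_range hC.ls_le hC.mem w' hY.2 {b} (h1 b)
    have haX : a ∈ X := ha rfl
    have hbB : b ∈ B := hb rfl
    have hwc := hw.codRestrict hC.aec hX.1 hwX
    have h2 : tp hwc ⟨a, haX⟩ = tp hw' b := by
      rw [← h, ← tp_comp hwc hX.isEmb]; rfl
    -- The amalgam is mapped back into `C` over `B`; the resulting copy of `X` in `C` has `a` at `b`
    -- and extends to an automorphism.
    obtain ⟨Z, _, v, v', hZ, hv, hv', h3, h4⟩ := exists_amalgam_of_tp_eq hC.aec hC.ls_le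
      hC.amalgamation hY hX.memCard hwc hw' h2 hB hwB hbB
    obtain ⟨g, hg, hgx⟩ := hC.homog B.subtype v' hB.memCard hZ hB.isEmb hv'
    have hgv := K.isEmb_comp hg hv
    obtain ⟨σ, hσ⟩ := hC.extend hX (hgv.isSub_range hX.2) (g.comp v).equivRange
    refine ⟨σ, fun y => ?_, ?_⟩
    · refine (hσ ⟨w y, hwX y⟩).trans ?_
      have := hgx ⟨w' y, hwB y⟩
      rw [h3] at this
      exact this
    · refine (hσ ⟨a, haX⟩).trans ?_
      have := hgx ⟨b, hbB⟩
      rw [h4] at this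
      exact this
  · rintro ⟨σ, h1, h2⟩
    exact Quot.sound ⟨C, _, σ.toEmbedding, Embedding.refl L C, K.isEmb_equiv σ hC.mem,
      isEmb_refl hC.mem, h1, h2⟩

theorem exists_tp_eq {Y : Type u} [L.Structure Y] (hY : K.MemCard lam Y) {w : Y ↪[L] C}
    (hw : K.IsEmb w) (p : K.OrbType Y) : ∃ a, tp hw a = p := by
  obtain ⟨Z, _, v, hv, z, hZ, rfl⟩ := exists_realizing hC.aec hC.ls_le hC.amalgamation hY hY
    (isEmb_refl hY.1) p
  obtain ⟨g, hg, hgx⟩ := hC.homog w v hY hZ hw hv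
  refine ⟨g z, ?_⟩
  rw [← tp_comp _ hg]
  exact tp_congr _ _ (by ext x; exact (hgx x).symm) _

theorem tp_isEmb_eq_iff (hM : K.IsSub lam M) : tp hM.isEmb a = tp hM.isEmb b ↔ SameType M a b := by
  rw [hC.tp_eq_iff hM.memCard]
  exact exists_congr fun σ => and_congr_left fun _ =>
    ⟨fun h x hx => h ⟨x, hx⟩, fun h y => h y y.2⟩

/-- A chain of length `lam`, each of whose members realizes all types over the preceding one,
is universal over its first member. -/
theorem univ_of_realizes {A : Ordinal.{u} → L.Substructure C} (hA : ∀ k ≤ lam.ord, K.IsSub lam (A k))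
    (hmono : ∀ i j, i ≤ j → j ≤ lam.ord → A i ≤ A j)
    (hreal : ∀ k < lam.ord, ∀ b, ∃ b' ∈ A (k + 1), SameType (A k) b b') :
    Univ K lam (A 0) (A lam.ord) := by
  have h0 := hA 0 zero_le
  refine ⟨h0, hA _ le_rfl, hmono _ _ zero_le le_rfl, fun X hX hle => ?_⟩
  obtain ⟨g, hg, hgx, hgA⟩ := exists_embedding_of_realizes hC.aec hC.ls_le hC.amalgamation A hA hmono
    (fun k hk p => by
      obtain ⟨b, rfl⟩ := hC.exists_tp_eq (hA k hk.le).memCard (hA k hk.le).isEmb p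
      obtain ⟨b', h1, h2⟩ := hreal k hk b
      exact ⟨b', h1, (hC.tp_isEmb_eq_iff (hA k hk.le)).2 h2.symm⟩)
    hX.memCard (Substructure.inclusion hle) (isEmb_inclusion hC.aec h0.1 hX.1 hle)
  obtain ⟨σ, hσ⟩ := hC.extend hX (hg.isSub_range hX.2) g.equivRange
  refine ⟨σ, fun x hx => ?_, ?_⟩
  · exact (hσ ⟨x, hle hx⟩).trans (hgx ⟨x, hx⟩)
  · rintro _ ⟨x, hx, rfl⟩
    exact (hσ ⟨x, hx⟩ : σ x = _) ▸ hgA _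

theorem exists_mem_sameType (h : Univ K lam M N) (b : C) : ∃ b' ∈ N, SameType M b b' := by
  obtain ⟨S, hS, h1, -, h2⟩ := hC.exists_isSub_sup h.1 h.1 b
  obtain ⟨σ, hσ, hσS⟩ := h.2.2.2 S hS h1
  exact ⟨σ b, hσS (apply_mem_img h2), hσ.sameType b⟩

end Monster

/-! ### Disjoint amalgams -/

/-- A triple of models `N ≤ Q ≤ P` with `c ∈ P`, such that the type of `c` over `Q` does not fork
over `M`. -/
def DisjointTriple (K : AbstractClass L) (lam : Cardinal.{u}) (M : L.Substructure C) (c : C)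
    (s : L.Substructure C × L.Substructure C × L.Substructure C) : Prop :=
  K.IsSub lam s.1 ∧ K.IsSub lam s.2.2 ∧ s.1 ≤ s.2.1 ∧ s.2.1 ≤ s.2.2 ∧ c ∈ s.2.2 ∧
    NF K lam M s.2.1 c

/-- An extension of triples `(N, Q, P)` that adds to `N` no elements of `P`. -/
def DisjointExt (K : AbstractClass L) (lam : Cardinal.{u})
    (s t : L.Substructure C × L.Substructure C × L.Substructure C) : Prop :=
  s.1 ≤ t.1 ∧ Univ K lam s.2.1 t.2.1 ∧ s.2.2 ≤ t.2.2 ∧ t.1 ⊓ s.2.2 ≤ s.1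

theorem DisjointExt.trans {s t v : L.Substructure C × L.Substructure C × L.Substructure C}
    (h : DisjointExt K lam s t) (h' : DisjointExt K lam t v) : DisjointExt K lam s v :=
  ⟨h.1.trans h'.1, h.2.1.trans h'.2.1, h.2.2.1.trans h'.2.2.1, fun _ hx =>
    h.2.2.2 ⟨h'.2.2.2 ⟨hx.1, h.2.2.1 hx.2⟩, hx.2⟩⟩

namespace GoodMonster

variable (hC : GoodMonster K lam C)
include hC

/-- The disjoint step is applied with `s.1` as its base, so the new model avoids `P` outside `N`.
The element `c` stays nonforking over `M` by transitivity along `Q`. -/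
theorem exists_disjointExt {s : L.Substructure C × L.Substructure C × L.Substructure C}
    (hs : DisjointTriple K lam M c s) (b : C) :
    ∃ t, DisjointTriple K lam M c t ∧ DisjointExt K lam s t ∧ ∃ b' ∈ t.1, SameType s.1 b b' := by
  obtain ⟨h1, h2, h3, h4, h5, h6⟩ := hs
  obtain ⟨N, b', Q, hN, h7, hb', hbb, h8, -, h9, h10, h11⟩ :=
    hC.exists_disjoint_step h1 h6.2.1 h2 h3 h4 h5 b
  obtain ⟨P, hP, h12, h13, -⟩ := hC.exists_isSub_sup h2 h11.2.1 c
  exact ⟨(N, Q, P), ⟨hN, hP, h9, h13, h12 h5, hC.NF_trans h6 h11⟩, ⟨h7, h10, h12, h8⟩,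
    b', hb', hbb⟩

/-- Continuity of nonforking handles the middle coordinate, which is why that coordinate must grow
universally. -/
theorem exists_disjointExt_limit {j : Ordinal.{u}} (hl : Order.IsSuccLimit j)
    (hj : j < (Order.succ lam).ord)
    (g : Set.Iio j → L.Substructure C × L.Substructure C × L.Substructure C)
    (hg : ∀ i, DisjointTriple K lam M c (g i))
    (hgg : ∀ i i', i < i' → DisjointExt K lam (g i) (g i')) :
    ∃ q, DisjointTriple K lam M c q ∧ ∀ i, DisjointExt K lam (g i) q := by
  have h0 := hC.aleph0_le
  obtain ⟨g, rfl⟩ := exists_extend_Iio g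
  have hne : Nonempty (Set.Iio j) := ⟨⟨0, hl.bot_lt⟩⟩
  have hm : ∀ i i' : Set.Iio j, i ≤ i' → (g i).1 ≤ (g i').1 ∧ (g i).2.2 ≤ (g i').2.2 :=
    fun i i' h => by
      rcases h.eq_or_lt with rfl | h
      · exact ⟨le_rfl, le_rfl⟩
      · exact ⟨(hgg i i' h).1, (hgg i i' h).2.2.1⟩
  have hd1 : Directed (· ≤ ·) fun i : Set.Iio j => (g i).1 :=
    Monotone.directed_le fun i i' h => (hm i i' h).1
  have hd3 : Directed (· ≤ ·) fun i : Set.Iio j => (g i).2.2 :=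
    Monotone.directed_le fun i i' h => (hm i i' h).2
  have hNF := hC.NF_iSup hl hj (fun i => (g i).2.1)
    (fun i i' h h' => (hgg ⟨i, h.trans h'⟩ ⟨i', h'⟩ h).2.1) c (M := M)
    (fun i hi => (hg ⟨i, hi⟩).2.2.2.2.2)
  refine ⟨(⨆ i : Set.Iio j, (g i).1, ⨆ i : Set.Iio j, (g i).2.1, ⨆ i : Set.Iio j, (g i).2.2),
    ⟨?_, ?_, ?_, ?_, ?_, hNF⟩, fun i => ⟨?_, ?_, ?_, ?_⟩⟩
  · exact isSub_iSup hC.aec h0 (mk_shrink_Iio_le hj) hd1 fun i => (hg i).1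
  · exact isSub_iSup hC.aec h0 (mk_shrink_Iio_le hj) hd3 fun i => (hg i).2.1
  · exact iSup_mono fun i => (hg i).2.2.1
  · exact iSup_mono fun i => (hg i).2.2.2.1
  · exact le_iSup (fun i : Set.Iio j => (g i).2.2) ⟨0, hl.bot_lt⟩ (hg ⟨0, hl.bot_lt⟩).2.2.2.2.1
  · exact le_iSup (fun i : Set.Iio j => (g i).1) i
  · have hi := hl.add_one_lt i.2
    exact (hgg i ⟨i + 1, hi⟩ (lt_add_one (i : Ordinal))).2.1.mono_right hNF.2.1
      (le_iSup (fun i : Set.Iio j => (g i).2.1) ⟨i + 1, hi⟩)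
  · exact le_iSup (fun i : Set.Iio j => (g i).2.2) i
  · rintro x ⟨hx, hx'⟩
    obtain ⟨k, hk⟩ := (mem_iSup_iff hd1).1 hx
    -- An element of the union that lies in `P_i` either entered by stage `i` or entered later, and
    -- later extensions add nothing from `P_i`.
    rcases le_or_gt k i with h | h
    · exact (hm k i h).1 hk
    · exact (hgg i k h).2.2.2 ⟨hk, hx'⟩

theorem exists_disjointExt_chain {s : L.Substructure C × L.Substructure C × L.Substructure C}
    (hs : DisjointTriple K lam M c s)
    (t : Ordinal.{u} → (_ _ : L.Substructure C × L.Substructure C × L.Substructure C) → Prop)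
    (ht : ∀ k p, DisjointTriple K lam M c p →
      ∃ q, DisjointTriple K lam M c q ∧ DisjointExt K lam p q ∧ t k p q) :
    ∃ F : Ordinal.{u} → L.Substructure C × L.Substructure C × L.Substructure C, F 0 = s ∧
      (∀ k ≤ lam.ord, DisjointTriple K lam M c (F k)) ∧
      (∀ i k, i < k → k ≤ lam.ord → DisjointExt K lam (F i) (F k)) ∧
      ∀ k < lam.ord, t k (F k) (F (k + 1)) := by
  have h0 := hC.aleph0_le
  obtain ⟨F, G, hFG⟩ := exists_chain (Order.succ lam).ord (DisjointExt K lam)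
    (fun _ _ _ h h' => h.trans h') (fun _ => DisjointTriple K lam M c)
    (fun _ => DisjointTriple K lam M c) t (fun k _ p hp => ht k p hp)
    -- At a successor the bound is the previous `G` itself, so `t` links `F k` to `F (k + 1)`.
    (fun j g q => (j = 0 → q = s) ∧ ∀ i : Set.Iio j, (i : Ordinal) + 1 = j → q = g i)
    (by
      intro j hj g hg hgg
      rcases Ordinal.zero_or_succ_or_isSuccLimit j with rfl | ⟨k, rfl⟩ | hl
      · exact ⟨s, hs, ⟨fun _ => rfl, fun i => (not_lt_zero (Set.mem_Iio.1 i.2)).elim⟩,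
          fun i => (not_lt_zero (Set.mem_Iio.1 i.2)).elim⟩
      · refine ⟨g ⟨k, Order.lt_succ k⟩, hg _, ⟨fun h => (Order.succ_ne_bot k h).elim,
          fun i hi => congrArg g (Subtype.ext (Order.succ_injective hi.symm))⟩, fun i => ?_⟩
        rcases (Order.lt_succ_iff.1 (Set.mem_Iio.1 i.2)).eq_or_lt with h | h
        · exact Or.inl (congrArg g (Subtype.ext h))
        · exact Or.inr (hgg _ _ h)
      · obtain ⟨q, h1, h2⟩ := hC.exists_disjointExt_limit hl hj g hg hgg
        exact ⟨q, h1, ⟨fun h => (hl.ne_bot h).elim, fun i hi =>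
          ((hl.add_one_lt i.2).ne hi).elim⟩, fun i => Or.inr (h2 i)⟩)
  have hlt : ∀ k ≤ lam.ord, k < (Order.succ lam).ord := fun k hk => hk.trans_lt ord_lt_ord_succ
  refine ⟨F, (hFG 0 (hlt 0 zero_le)).2.2.2.2.1.1 rfl, fun k hk => (hFG k (hlt k hk)).1,
    fun i k h hk => ((hFG k (hlt k hk)).2.2.2.2.2.2 i h).1, fun k hk => ?_⟩
  rw [(hFG (k + 1) (hlt _ (add_one_lt_ord h0 hk).le)).2.2.2.2.1.2 ⟨k, lt_add_one k⟩ rfl]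
  exact (hFG k (hlt k hk.le)).2.2.2.1

/-- A universal extension `W` of `s.1` has `lam` elements and represents every type over `s.1`, so
`lam` single extensions suffice. The `k`-th one realizes a type over a larger model, which is more
than needed. -/
theorem exists_disjointExt_realizing
    {s : L.Substructure C × L.Substructure C × L.Substructure C}
    (hs : DisjointTriple K lam M c s) :
    ∃ t, DisjointTriple K lam M c t ∧ DisjointExt K lam s t ∧
      ∀ b, ∃ b' ∈ t.1, SameType s.1 b b' := by
  have h0 := hC.aleph0_le
  have hpos : 0 < lam.ord := Cardinal.ord_pos.2 (Cardinal.aleph0_pos.trans_le h0)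
  obtain ⟨W, hW⟩ := hC.exists_univ hs.1
  have hne : Nonempty W := ⟨⟨_, (hC.exists_mem_sameType hW c).choose_spec.1⟩⟩
  obtain ⟨e, he⟩ := exists_enum_of_mk_le hW.2.1.2.le
  obtain ⟨F, rfl, h1, h2, h3⟩ := hC.exists_disjointExt_chain hs
    (fun k p q => ∃ b' ∈ q.1, SameType p.1 (e k) b') (fun k p hp => hC.exists_disjointExt hp (e k))
  have hle : ∀ i k, i ≤ k → k ≤ lam.ord → (F i).1 ≤ (F k).1 := fun i k h hk => by
    rcases h.eq_or_lt with rfl | h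
    · exact le_rfl
    · exact (h2 i k h hk).1
  refine ⟨F lam.ord, h1 _ le_rfl, h2 _ _ hpos le_rfl, fun b => ?_⟩
  obtain ⟨w, hw, hbw⟩ := hC.exists_mem_sameType hW b
  obtain ⟨k, hk, hek⟩ := he ⟨w, hw⟩
  obtain ⟨b', hb', hwb⟩ := h3 k hk
  rw [hek] at hwb
  exact ⟨b', hle _ _ (add_one_lt_ord h0 hk).le le_rfl hb', hbw.trans (hwb.mono (hle _ _ zero_le hk.le))⟩

/-- Disjoint nonforking amalgamation in the monster model. -/
theorem exists_disjoint_amalgam {M₀ M₁ M₂ : L.Substructure C} (h₀ : K.IsSub lam M₀)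
    (h₁ : K.IsSub lam M₁) (h₂ : K.IsSub lam M₂) (h₀₁ : M₀ ≤ M₁) (h₀₂ : M₀ ≤ M₂) (a₁ : C) {a₂ : C}
    (ha₂ : a₂ ∈ M₂) :
    ∃ σ : C ≃[L] C, Fixes σ M₀ ∧ NF K lam M₀ M₂ (σ a₁) ∧ NF K lam M₀ (img σ M₁) a₂ ∧
      img σ M₁ ⊓ M₂ ≤ M₀ := by
  have h0 := hC.aleph0_le
  have hpos : 0 < lam.ord := Cardinal.ord_pos.2 (Cardinal.aleph0_pos.trans_le h0)
  -- The initial triple comes from a disjoint step with `Q = M₀` and `P = M₂`; its `b` is the image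
  -- of `a₁`.
  obtain ⟨N, b, Q, hN, h1, hb, ⟨ρ, hρ, hρb⟩, h3, h4, h5, h6, h7⟩ :=
    hC.exists_disjoint_step h₀ h₀ h₂ le_rfl h₀₂ ha₂ a₁
  obtain ⟨P, hP, h8, h9, -⟩ := hC.exists_isSub_sup h₂ h7.2.1 a₂
  obtain ⟨F, hF, k1, k2, k3⟩ := hC.exists_disjointExt_chain (M := M₀) (c := a₂) (s := (N, Q, P))
    ⟨hN, hP, h5, h9, h8 ha₂, h7⟩ (fun _ p q => ∀ b, ∃ b' ∈ q.1, SameType p.1 b b')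
    (fun _ _ hp => hC.exists_disjointExt_realizing hp)
  have hU := hC.univ_of_realizes (A := fun k => (F k).1) (fun k hk => (k1 k hk).1)
    (fun i k h hk => by
      rcases h.eq_or_lt with rfl | h
      · exact le_rfl
      · exact (k2 i k h hk).1) k3
  have hlast := k1 _ le_rfl
  have hext := k2 _ _ hpos le_rfl
  simp only [hF] at hU hext
  obtain ⟨X, hX, hMX, hNX, -⟩ := hC.exists_isSub_sup (h₁.img hC.mem ρ) hN a₂
  -- Since `τ` fixes `N`, it fixes `b`, and moving `M₁` into the last model does not disturb
  -- nonforking over `M₂`.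
  obtain ⟨τ, hτ, hτX⟩ := hU.2.2.2 X hX hNX
  have hfix : Fixes (τ.comp ρ) M₀ := (hτ.mono h1).comp hρ
  have himg : img (τ.comp ρ) M₁ ≤ (F lam.ord).1 := by
    rw [img_comp]; exact (img_mono τ hMX).trans hτX
  have hle := img_mono (τ.comp ρ) h₀₁
  rw [hfix.img_eq] at hle
  refine ⟨τ.comp ρ, hfix, ?_, ?_, ?_⟩
  · rw [Language.Equiv.comp_apply, hρb, hτ b hb]; exact h4
  · exact hlast.2.2.2.2.2.mono le_rfl hle (himg.trans hlast.2.2.1) h₀ (h₁.img hC.mem _)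
  · rintro x ⟨hx, hx'⟩
    exact h3 ⟨hext.2.2.2 ⟨himg hx, h8 hx'⟩, hx'⟩

end GoodMonster

end

section

variable {M N P : Type u} [L.Structure M] [L.Structure N] [L.Structure P]

/-! ### Substructures and embeddings -/

theorem range_comp_subtype (v : N ↪[L] P) (S : L.Substructure N) :
    (v.comp S.subtype).toHom.range = S.map v.toHom := by
  ext x
  constructor
  · rintro ⟨y, rfl⟩; exact ⟨y, y.2, rfl⟩
  · rintro ⟨y, hy, rfl⟩; exact ⟨⟨y, hy⟩, rfl⟩

theorem map_range (v : N ↪[L] P) (m : M ↪[L] N) :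
    m.toHom.range.map v.toHom = (v.comp m).toHom.range := by
  ext x
  constructor
  · rintro ⟨_, ⟨y, rfl⟩, rfl⟩; exact ⟨y, rfl⟩
  · rintro ⟨y, rfl⟩; exact ⟨_, ⟨y, rfl⟩, rfl⟩

theorem map_comap_of_le (v : N ↪[L] P) {T : L.Substructure P} (h : T ≤ v.toHom.range) :
    (T.comap v.toHom).map v.toHom = T := by
  ext x
  constructor
  · rintro ⟨y, hy, rfl⟩; exact hy
  · intro hx
    obtain ⟨y, rfl⟩ := h hx
    exact ⟨y, hx, rfl⟩

theorem IsEmb.isSub_comap (hK : K.IsAEC) {v : N ↪[L] P} (hv : K.IsEmb v) {T : L.Substructure P}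
    (hT : K.IsSub lam T) (h : T ≤ v.toHom.range) : K.IsSub lam (T.comap v.toHom) :=
  ⟨hv.strong_comap hK hT.1 h, by rw [← mk_map v, map_comap_of_le v h, hT.2]⟩

/-- A `K`-embedding with values in the range of the `K`-embedding `v` factors through `v`. -/
theorem IsEmb.exists_factor (hK : K.IsAEC) {v : N ↪[L] P} (hv : K.IsEmb v) {f : M ↪[L] P}
    (hf : K.IsEmb f) (h : ∀ x, f x ∈ v.toHom.range) :
    ∃ g : M ↪[L] N, K.IsEmb g ∧ ∀ x, v (g x) = f x := by
  refine ⟨v.equivRange.symm.toEmbedding.comp (f.codRestrict _ h),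
    K.isEmb_comp (K.isEmb_equiv _ (K.mem_of_strong hv).2) (hf.codRestrict hK hv h), fun x => ?_⟩
  have := v.equivRange.apply_symm_apply (f.codRestrict _ h x)
  exact congrArg Subtype.val this

end

section

variable {C M N : Type u} [L.Structure C] [L.Structure M] [L.Structure N]

/-! ### Universality, splitting and forking of abstract models -/

theorem exists_isEmb_range_eq (hcat : K.CategoricalIn lam) (hM : K.MemCard lam M)
    {S : L.Substructure C} (hS : K.IsSub lam S) :
    ∃ v : M ↪[L] C, K.IsEmb v ∧ v.toHom.range = S := by
  obtain ⟨e⟩ := hcat.2 M S hM hS.memCard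
  refine ⟨S.subtype.comp e.toEmbedding, K.isEmb_comp hS.isEmb (K.isEmb_equiv e hM.1), ?_⟩
  ext x
  constructor
  · rintro ⟨y, rfl⟩; exact (e y).2
  · intro hx; exact ⟨e.symm ⟨x, hx⟩, congrArg Subtype.val (e.apply_symm_apply ⟨x, hx⟩)⟩

namespace Monster

variable (hC : Monster K lam C)
include hC

theorem exists_equiv_extending (hM : #M = lam) {w w' : M ↪[L] C} (hw : K.IsEmb w)
    (hw' : K.IsEmb w') : ∃ σ : C ≃[L] C, ∀ x, σ (w x) = w' x := by
  obtain ⟨σ, hσ⟩ := hC.extend (hw.isSub_range hM) (hw'.isSub_range hM)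
    (w'.equivRange.comp w.equivRange.symm)
  refine ⟨σ, fun x => (hσ (w.equivRange x)).trans ?_⟩
  rw [Language.Equiv.comp_apply, Language.Equiv.symm_apply_apply]
  rfl

/-- Homogeneity realizes every abstract extension inside `C`, and embeddings between models in `C`
extend to automorphisms. -/
theorem universal_iff {m : M ↪[L] N} (hm : K.IsEmb m) (hM : #M = lam) (hN : #N = lam)
    {v : N ↪[L] C} (hv : K.IsEmb v) :
    K.Universal lam m ↔ Univ K lam (v.comp m).toHom.range v.toHom.range := by
  have hvm := K.isEmb_comp hv hm
  constructor
  · rintro ⟨-, -, -, h⟩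
    refine ⟨hvm.isSub_range hM, hv.isSub_range hN, ?_, fun S hS hle => ?_⟩
    · rintro _ ⟨x, rfl⟩; exact ⟨m x, rfl⟩
    have hle' : ∀ x, v.comp m x ∈ S := fun x => hle ⟨x, rfl⟩
    obtain ⟨g, hg, hgx⟩ := h S ((v.comp m).codRestrict S hle') hS.memCard
      (hvm.codRestrict hC.aec hS.1 hle')
    obtain ⟨σ, hσ⟩ := hC.exists_equiv_extending hS.2 hS.isEmb (K.isEmb_comp hv hg)
    refine ⟨σ, ?_, ?_⟩
    · rintro _ ⟨x, rfl⟩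
      exact (hσ ⟨_, hle' x⟩).trans (congrArg v (hgx x))
    · rintro _ ⟨x, hx, rfl⟩
      exact ⟨g ⟨x, hx⟩, (hσ ⟨x, hx⟩).symm⟩
  · rintro ⟨-, -, -, h⟩
    refine ⟨⟨hm.mem_dom, hM⟩, ⟨hv.mem_dom, hN⟩, hm, fun M' _ j hM' hj => ?_⟩
    obtain ⟨g, hg, hgx⟩ := hC.homog (v.comp m) j ⟨hm.mem_dom, hM⟩ hM' hvm hj
    obtain ⟨σ, hσ, hσg⟩ := h g.toHom.range (hg.isSub_range hM'.2) (by
      rintro _ ⟨x, rfl⟩; exact ⟨j x, hgx x⟩)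
    obtain ⟨k, hk, hkx⟩ := hv.exists_factor hC.aec
      (K.isEmb_comp (K.isEmb_equiv σ hC.mem) hg) (fun x => hσg (apply_mem_img ⟨x, rfl⟩))
    refine ⟨k, hk, fun x => v.injective ?_⟩
    rw [hkx]
    exact (congrArg σ (hgx x)).trans (hσ _ ⟨x, rfl⟩)

/-- An isomorphism of submodels of `N` extends to an automorphism of `C`; conversely, an
automorphism that keeps a submodel inside `N` restricts to such an isomorphism. Equality of types is
read as conjugacy. -/
theorem notSplits_iff {m : M ↪[L] N} (hm : K.IsEmb m) {v : N ↪[L] C} (hv : K.IsEmb v) (a : C) :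
    NotSplits lam m (tp hv a) ↔ NS K lam (v.comp m).toHom.range v.toHom.range a := by
  have hle : (v.comp m).toHom.range ≤ v.toHom.range := by
    rintro _ ⟨x, rfl⟩; exact ⟨m x, rfl⟩
  constructor
  · rintro ⟨-, h⟩
    refine ⟨hle, fun σ hσ N₁ hN₁ h1 h2 h3 => ?_⟩
    obtain ⟨n, hn, hnx⟩ := hv.exists_factor hC.aec hN₁.isEmb (fun x => h2 x.2)
    have hnv : ∀ x : n.toHom.range, v x ∈ N₁ := by
      rintro ⟨_, y, rfl⟩; exact (hnx y).symm ▸ y.2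
    have hPs := hn.isSub_range hN₁.2
    obtain ⟨k, hk, hkx⟩ := hv.exists_factor hC.aec
      (K.isEmb_comp (K.isEmb_equiv σ hC.mem) (K.isEmb_comp hv hPs.isEmb))
      (fun x => h3 (apply_mem_img (hnv x)))
    have hQs := hk.isSub_range hPs.2
    have hmP : ∀ x, m x ∈ n.toHom.range := fun x =>
      ⟨⟨v (m x), h1 ⟨x, rfl⟩⟩, v.injective (hnx _)⟩
    have hfix : ∀ x (hx : m x ∈ n.toHom.range), k ⟨m x, hx⟩ = m x := fun x hx =>
      v.injective ((hkx ⟨m x, hx⟩).trans (hσ _ ⟨x, rfl⟩))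
    have h4 := h n.toHom.range k.toHom.range hPs.isEmb hQs.isEmb hQs.memCard hPs.memCard
      (hC.aec.coherence (by rintro _ ⟨x, rfl⟩; exact hmP x) hm hPs.1)
      (hC.aec.coherence (by rintro _ ⟨x, rfl⟩; exact ⟨⟨m x, hmP x⟩, hfix x _⟩) hm hQs.1)
      k.equivRange (by rintro ⟨_, hy⟩ ⟨x, rfl⟩; exact hfix x hy)
    obtain ⟨τ, hτ, hτa⟩ := (hC.tp_eq_iff hQs.memCard
      (K.isEmb_comp (K.isEmb_comp hv hPs.isEmb) (K.isEmb_equiv k.equivRange.symm hQs.memCard.1))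
      (K.isEmb_comp hv hQs.isEmb)).1 h4
    -- On `N₁` the automorphism `τ` agrees with `σ`, but it fixes `a`.
    refine ⟨τ.comp σ.symm, ?_, by simpa using hτa⟩
    rintro _ ⟨x, hx, rfl⟩
    have h5 := hτ (k.equivRange ⟨n ⟨x, hx⟩, ⟨_, rfl⟩⟩)
    simp only [Embedding.comp_apply, Language.Equiv.coe_toEmbedding,
      Language.Equiv.symm_apply_apply, Substructure.subtype_apply, Embedding.equivRange_apply] at h5
    rw [hkx, hnx] at h5
    rw [Language.Equiv.comp_apply]
    refine (congrArg τ (σ.symm_apply_apply x)).trans (h5.trans ?_)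
    exact congrArg σ (hnx ⟨x, hx⟩)
  · rintro ⟨-, h⟩
    refine ⟨hm, fun N₁ N₂ h₁ h₂ hN₂ hN₁ hle₁ hle₂ f hf => ?_⟩
    have hw₁ := K.isEmb_comp hv h₁
    have hw₂ := K.isEmb_comp (K.isEmb_comp hv h₂) (K.isEmb_equiv f hN₁.1)
    obtain ⟨σ, hσ⟩ := hC.exists_equiv_extending hN₁.2 hw₁ hw₂
    have hmN : ∀ x, m x ∈ N₁ := fun x => hle₁.1 ⟨x, rfl⟩
    obtain ⟨τ, hτ, hτa⟩ := h σ
      (by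
        rintro _ ⟨x, rfl⟩
        exact (hσ ⟨m x, hmN x⟩).trans (congrArg v (hf ⟨m x, hmN x⟩ ⟨x, rfl⟩)))
      (v.comp N₁.subtype).toHom.range (hw₁.isSub_range hN₁.2)
      (by rintro _ ⟨x, rfl⟩; exact ⟨⟨m x, hmN x⟩, rfl⟩)
      (by rintro _ ⟨x, rfl⟩; exact ⟨x, rfl⟩)
      (by rintro _ ⟨_, ⟨x, rfl⟩, rfl⟩; exact ⟨f x, (hσ x).symm⟩)
    refine (hC.tp_eq_iff hN₂ (K.isEmb_comp hw₁ (K.isEmb_equiv f.symm hN₂.1))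
      (K.isEmb_comp hv h₂)).2 ⟨τ.comp σ, fun y => ?_, hτa⟩
    have h6 := hσ (f.symm y)
    simp only [Embedding.comp_apply, Language.Equiv.coe_toEmbedding,
      Language.Equiv.apply_symm_apply] at h6
    have h7 := hτ (σ (v (N₁.subtype (f.symm y)))) (apply_mem_img ⟨f.symm y, rfl⟩)
    simp only [Embedding.comp_apply, Language.Equiv.coe_toEmbedding, Language.Equiv.comp_apply]
    rw [h7, h6]

theorem isUniversalChain_comap {v : N ↪[L] C} (hv : K.IsEmb v) {δ : Ordinal.{u}}
    {F : Ordinal.{u} → L.Substructure C} (hδ : Order.IsSuccLimit δ)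
    (hδ' : δ < (Order.succ lam).ord) (hF : ∀ i ≤ δ, K.IsSub lam (F i))
    (hmono : ∀ i j, i ≤ j → j ≤ δ → F i ≤ F j)
    (hcont : ∀ i ≤ δ, Order.IsSuccLimit i → (F i : Set C) = ⋃ j : Set.Iio i, (F j : Set C))
    (huniv : ∀ i < δ, Univ K lam (F i) (F (i + 1))) (htop : F δ = v.toHom.range) :
    K.IsUniversalChain lam δ fun i => (F i).comap v.toHom := by
  have hle : ∀ i ≤ δ, F i ≤ v.toHom.range := fun i hi => htop ▸ hmono i δ hi le_rfl
  have hsub : ∀ i ≤ δ, K.IsSub lam ((F i).comap v.toHom) := fun i hi =>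
    hv.isSub_comap hC.aec (hF i hi) (hle i hi)
  refine ⟨hδ, hδ', fun i hi => (hsub i hi).memCard, fun i j hij hj => ?_, fun i hi hl => ?_,
    fun i hi => ?_, ?_⟩
  · exact hC.aec.coherence (fun x hx => hmono i j hij hj hx) (hsub i (hij.trans hj)).1 (hsub j hj).1
  · have := congrArg (v ⁻¹' ·) (hcont i hi hl)
    simp only [Set.preimage_iUnion] at this
    exact this
  · have hi' := hδ.add_one_lt hi
    have h : (F i).comap v.toHom ≤ (F (i + 1)).comap v.toHom := fun x hx => (huniv i hi).2.2.1 hx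
    refine ⟨h, (hC.universal_iff (isEmb_inclusion hC.aec (hsub i hi.le).1 (hsub _ hi'.le).1 h)
      (hsub i hi.le).2 (hsub _ hi'.le).2 (K.isEmb_comp hv (hsub _ hi'.le).isEmb)).2 ?_⟩
    have h1 : (v.comp ((F (i + 1)).comap v.toHom).subtype).comp (Substructure.inclusion h)
        = v.comp ((F i).comap v.toHom).subtype := rfl
    rw [h1, range_comp_subtype, range_comp_subtype, map_comap_of_le v (hle i hi.le),
      map_comap_of_le v (hle _ hi'.le)]
    exact huniv i hi
  · ext x
    simp [htop]

theorem exists_univ_seq (hM : ∃ M : L.Substructure C, K.IsSub lam M) :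
    ∃ A : ℕ → L.Substructure C, (∀ n, Univ K lam (A n) (A (n + 1))) ∧ K.IsSub lam (⨆ n, A n) := by
  have h0 := hC.aleph0_le
  obtain ⟨M, hM⟩ := hM
  obtain ⟨A, -, hA⟩ := exists_seq (fun _ => K.IsSub lam) (fun _ => Univ K lam) hM
    (fun _ S hS => by
      obtain ⟨N, hN⟩ := hC.exists_univ hS
      exact ⟨N, hN.2.1, hN⟩)
  exact ⟨A, fun n => (hA n).2, isSub_iSup hC.aec h0 (by
    rw [← Cardinal.lift_le.{0}, Cardinal.lift_mk_shrink]
    simpa using h0) (monotone_of_univ fun n => (hA n).2).directed_le (fun n => (hA n).1)⟩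

/-- The union of a universal `ω`-chain in `C` is a limit model, and by categoricity it is isomorphic
to `M`. -/
theorem isLimitModel (hcat : K.CategoricalIn lam) (hM : K.MemCard lam M) :
    K.IsLimitModel lam M := by
  have h0 := hC.aleph0_le
  obtain ⟨S, hS, -⟩ := hC.exists_isSub ∅ (by simp)
  obtain ⟨A, hA, hAS⟩ := hC.exists_univ_seq ⟨S, hS⟩
  obtain ⟨v, hv, hvA⟩ := exists_isEmb_range_eq hcat hM hAS
  have hmA := monotone_of_univ hA
  have hnat : ∀ i : Ordinal.{u}, i < Ordinal.omega0 → ∃ n : ℕ, i = n :=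
    fun i hi => Ordinal.lt_omega0.1 hi
  let F : Ordinal.{u} → L.Substructure C := fun i =>
    if i < Ordinal.omega0 then A (Cardinal.toNat i.card) else ⨆ n, A n
  have hFn : ∀ n : ℕ, F n = A n := fun n => by simp [F]
  have hFω : F Ordinal.omega0 = ⨆ n, A n := if_neg (lt_irrefl _)
  have hω := Ordinal.isSuccLimit_omega0.{u}
  refine ⟨_, Ordinal.omega0, _, hC.isUniversalChain_comap hv (F := F) hω ?_ ?_ ?_ ?_ ?_
    (hFω.trans hvA.symm), rfl⟩
  · rw [← Cardinal.ord_aleph0, Cardinal.ord_lt_ord]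
    exact Order.lt_succ_of_le h0
  · intro i hi
    rcases hi.eq_or_lt with rfl | hi
    · rw [hFω]; exact hAS
    · obtain ⟨n, rfl⟩ := hnat i hi
      rw [hFn]; exact (hA n).1
  · intro i j hij hj
    rcases hj.eq_or_lt with rfl | hj
    · rcases hij.eq_or_lt with rfl | hi
      · exact le_rfl
      · obtain ⟨n, rfl⟩ := hnat i hi
        rw [hFn, hFω]; exact le_iSup A n
    · obtain ⟨n, rfl⟩ := hnat i (hij.trans_lt hj)
      obtain ⟨k, rfl⟩ := hnat j hj
      rw [hFn, hFn]; exact hmA (by exact_mod_cast hij)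
  · intro i hi hl
    obtain rfl : i = Ordinal.omega0 := le_antisymm hi (Ordinal.omega0_le_of_isSuccLimit hl)
    ext x
    rw [SetLike.mem_coe, hFω, mem_iSup_iff hmA.directed_le, Set.mem_iUnion]
    constructor
    · rintro ⟨n, hn⟩
      exact ⟨⟨n, Ordinal.natCast_lt_omega0 n⟩, (hFn n).symm ▸ hn⟩
    · rintro ⟨⟨k, hk⟩, hx⟩
      obtain ⟨n, rfl⟩ := hnat k hk
      exact ⟨n, hFn n ▸ hx⟩
  · intro i hi
    obtain ⟨n, rfl⟩ := hnat i hi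
    have : (n : Ordinal.{u}) + 1 = ((n + 1 : ℕ) : Ordinal.{u}) := by push_cast; rfl
    rw [this, hFn, hFn]
    exact hA n

/-- Categoricity supplies the limit-model clauses; the witness for nonforking is carried along `v`.
-/
theorem tpNotForks_iff (hcat : K.CategoricalIn lam) {v : N ↪[L] C} (hv : K.IsEmb v)
    {A B : L.Substructure N} (hA : K.IsSub lam A) (hB : K.IsSub lam B) (b : N) :
    K.TpNotForks lam A B b ↔ NF K lam (A.map v.toHom) (B.map v.toHom) (v b) := by
  have hvA := K.isEmb_comp hv hA.isEmb
  have hvB := K.isEmb_comp hv hB.isEmb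
  have htp : ∀ hB' : K.IsEmb B.subtype, tp hB' b = tp hvB (v b) := fun hB' => (tp_comp hB' hv b).symm
  constructor
  · rintro ⟨h, hB', -, -, hi, M₀, hU, hns⟩
    have hM₀ := hU.2.2.1
    refine ⟨Substructure.monotone_map h, hB.map hv,
      ((v.comp A.subtype).comp M₀.subtype).toHom.range, ?_, ?_⟩
    · rw [← range_comp_subtype v A]
      exact (hC.universal_iff hM₀ hU.1.2 hA.2 hvA).1 hU
    · rw [htp, hC.notSplits_iff (K.isEmb_comp hi hM₀)] at hns
      rw [range_comp_subtype] at hns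
      exact hns
  · rintro ⟨h, -, M', hU, hns⟩
    have hle : A ≤ B := fun x hx => by
      obtain ⟨y, hy, hyx⟩ := h ⟨x, hx, rfl⟩
      exact v.injective hyx ▸ hy
    have hi := isEmb_inclusion hC.aec hA.1 hB.1 hle
    rw [← range_comp_subtype] at hU hns
    have hM₀ := hvA.isSub_comap hC.aec hU.1 hU.2.2.1
    have hr : ((v.comp A.subtype).comp (M'.comap (v.comp A.subtype).toHom).subtype).toHom.range
        = M' := by rw [range_comp_subtype, map_comap_of_le _ hU.2.2.1]
    refine ⟨hle, hB.isEmb, hC.isLimitModel hcat hA.memCard, hC.isLimitModel hcat hB.memCard, hi,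
      M'.comap (v.comp A.subtype).toHom, ?_, ?_⟩
    · rw [hC.universal_iff hM₀.isEmb hM₀.2 hA.2 hvA, hr]
      exact hU
    · rw [htp, hC.notSplits_iff (K.isEmb_comp hi hM₀.isEmb)]
      have : (v.comp B.subtype).comp ((Substructure.inclusion hle).comp
        (M'.comap (v.comp A.subtype).toHom).subtype) =
        (v.comp A.subtype).comp (M'.comap (v.comp A.subtype).toHom).subtype := rfl
      rw [this, hr]
      exact hns

end Monster

/-! ### From the hypotheses on `K` to a good monster -/

theorem IsLimitModel.memCard (h : K.IsLimitModel lam M) : K.MemCard lam M := by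
  obtain ⟨S, δ, F, hF, -⟩ := h
  have := hF.mem δ le_rfl
  rw [hF.top] at this
  exact this.equiv Substructure.topEquiv

/-- The hypothesis is a symmetry half with ambient model `V ⊇ W` containing `a`. The extension
returned by symmetry is abstract, and homogeneity maps it into `C` over `V`. -/
theorem Monster.exists_symmetric (hC : Monster K lam C) (hsym : K.HasSymmetry lam)
    (hcat : K.CategoricalIn lam) {M W : L.Substructure C} {a b : C} (h : NF K lam M W a)
    (hb : b ∈ W) : ∃ W', NF K lam M W' b ∧ a ∈ W' := by
  obtain ⟨V, hV, hWV, -, haV⟩ := hC.exists_isSub_sup h.2.1 h.2.1 a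
  have hr : V.subtype.toHom.range = V := Substructure.range_subtype V
  have hM := hV.isEmb.isSub_comap hC.aec h.isSub_left (hr.symm ▸ h.1.trans hWV)
  have hW := hV.isEmb.isSub_comap hC.aec h.2.1 (hr.symm ▸ hWV)
  have hMV := map_comap_of_le V.subtype (T := M) (hr.symm ▸ h.1.trans hWV)
  have hid : (M.comap V.subtype.toHom).map (Embedding.refl L V).toHom = M.comap V.subtype.toHom :=
    Substructure.map_id _
  obtain ⟨Nb, _, n, Mb, hn, hMb, hNbl, hMbl, hle, hna, hnf⟩ :=
    (hsym V (M.comap V.subtype.toHom) hM.1 (hC.isLimitModel hcat hV.memCard)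
      (hC.isLimitModel hcat hM.memCard) ⟨a, haV⟩ ⟨b, hWV hb⟩).1
      ⟨V, _, Embedding.refl L V, W.comap V.subtype.toHom, isEmb_refl hV.memCard.1, hW.1,
        hC.isLimitModel hcat hV.memCard, hC.isLimitModel hcat hW.memCard,
        by rw [hid]; exact hC.aec.coherence (fun x hx => h.1 hx) hM.1 hW.1, hb, by
          rw [hid, hC.tpNotForks_iff hcat hV.isEmb hM hW, hMV,
            map_comap_of_le V.subtype (hr.symm ▸ hWV)]
          exact h⟩
  obtain ⟨v, hv, hvx⟩ := hC.homog V.subtype n hV.memCard hNbl.memCard hV.isEmb hn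
  have hvn : v.toHom.comp n.toHom = V.subtype.toHom := by ext x; exact hvx x
  rw [hC.tpNotForks_iff hcat hv (hM.map hn) ⟨hMb, hMbl.memCard.2⟩, Substructure.map_map, hvn, hMV,
    hvx] at hnf
  exact ⟨_, hnf, ⟨n ⟨a, haV⟩, hna, hvx _⟩⟩

theorem exists_goodMonster (hK : K.IsAEC) (hss : K.Superstable lam) (hsym : K.HasSymmetry lam)
    (hcat : K.CategoricalIn lam) : ∃ (C : Type u) (_ : L.Structure C), GoodMonster K lam C := by
  obtain ⟨C, _, hC⟩ := exists_monster hK hss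
  refine ⟨C, _, hC, fun {M N} hM hN => ?_, fun δ F hδ hδ' hF hmono hcont huniv a => ?_,
    fun h hb => hC.exists_symmetric hsym hcat h hb⟩
  · obtain ⟨e⟩ := hcat.2 M N hM.memCard hN.memCard
    obtain ⟨σ, hσ⟩ := hC.extend hM hN e
    refine ⟨σ, ?_⟩
    ext y
    constructor
    · rintro ⟨x, hx, rfl⟩; exact (hσ ⟨x, hx⟩ : σ x = _) ▸ (e _).2
    · intro hy
      exact ⟨e.symm ⟨y, hy⟩, (e.symm ⟨y, hy⟩).2, (hσ _).trans
        (congrArg Subtype.val (e.apply_symm_apply ⟨y, hy⟩))⟩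
  · have hv := (hF δ le_rfl).isEmb
    have hr : (F δ).subtype.toHom.range = F δ := Substructure.range_subtype _
    have hchain := hC.isUniversalChain_comap hv hδ hδ' hF hmono hcont huniv hr.symm
    obtain ⟨i, hi, h⟩ := hss.localCharacter _ δ _ hchain (tp hv a)
    have hle := hmono i δ hi.le le_rfl
    rw [hC.notSplits_iff h.1, range_comp_subtype, map_comap_of_le _ (hr.symm ▸ hle), hr] at h
    exact ⟨i, hi, h⟩

end

end AbstractClass

/-- Disjoint nonforking amalgamation. The inclusions of `M₀` in `M₁` and `M₂` are given as
`K`-embeddings `i₁` and `i₂`. -/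
theorem mainTheorem12 {L : FirstOrder.Language.{u, u}} (K : AbstractClass L) (hK : K.IsAEC)
    (lam : Cardinal.{u}) (hss : K.Superstable lam) (hsym : K.HasSymmetry lam)
    (hcat : K.CategoricalIn lam)
    (M₀ M₁ M₂ : Type u) [L.Structure M₀] [L.Structure M₁] [L.Structure M₂]
    (hM₀ : K.MemCard lam M₀) (hM₁ : K.MemCard lam M₁) (hM₂ : K.MemCard lam M₂)
    (i₁ : M₀ ↪[L] M₁) (i₂ : M₀ ↪[L] M₂) (hi₁ : K.IsEmb i₁) (hi₂ : K.IsEmb i₂)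
    (a₁ : M₁) (a₂ : M₂) :
    ∃ (M₃ : Type u) (_ : L.Structure M₃) (f₁ : M₁ ↪[L] M₃) (f₂ : M₂ ↪[L] M₃),
      K.MemCard lam M₃ ∧ K.IsEmb f₁ ∧ K.IsEmb f₂ ∧
      f₁.comp i₁ = f₂.comp i₂ ∧
      K.TpNotForks lam (f₁.comp i₁).toHom.range f₂.toHom.range (f₁ a₁) ∧
      K.TpNotForks lam (f₁.comp i₁).toHom.range f₁.toHom.range (f₂ a₂) ∧
      Set.range f₁ ∩ Set.range f₂ = Set.range (f₁.comp i₁) := by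
  obtain ⟨C, _, hC⟩ := AbstractClass.exists_goodMonster hK hss hsym hcat
  obtain ⟨S, hS, -⟩ := hC.exists_isSub ∅ (by simp)
  -- By categoricity any submodel in `K_lam` serves as a copy of `M₀`; homogeneity then places `M₁`
  -- and `M₂` over it.
  obtain ⟨w, hw, -⟩ := AbstractClass.exists_isEmb_range_eq hcat hM₀ hS
  obtain ⟨v₁, hv₁, hvx₁⟩ := hC.homog w i₁ hM₀ hM₁ hw hi₁
  obtain ⟨v₂, hv₂, hvx₂⟩ := hC.homog w i₂ hM₀ hM₂ hw hi₂
  have hS₁ := hv₁.isSub_range hM₁.2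
  have hS₂ := hv₂.isSub_range hM₂.2
  obtain ⟨σ, hσ, hnf₁, hnf₂, hdis⟩ := hC.exists_disjoint_amalgam (hw.isSub_range hM₀.2) hS₁ hS₂
    (by rintro _ ⟨x, rfl⟩; exact ⟨i₁ x, hvx₁ x⟩) (by rintro _ ⟨x, rfl⟩; exact ⟨i₂ x, hvx₂ x⟩)
    (v₁ a₁) (a₂ := v₂ a₂) ⟨a₂, rfl⟩
  -- Any submodel of size `lam` containing both images can serve as `M₃`.
  obtain ⟨W, hW, hW₁, hW₂, -⟩ := hC.exists_isSub_sup (hS₁.img hC.mem σ) hS₂ (v₂ a₂)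
  have hσv₁ := K.isEmb_comp (K.isEmb_equiv σ hC.mem) hv₁
  have hr₁ : ∀ x, σ.toEmbedding.comp v₁ x ∈ W := fun x =>
    hW₁ (AbstractClass.apply_mem_img ⟨x, rfl⟩)
  have hr₂ : ∀ x, v₂ x ∈ W := fun x => hW₂ ⟨x, rfl⟩
  have hf₁ := hσv₁.codRestrict hC.aec hW.1 hr₁
  have hf₂ := hv₂.codRestrict hC.aec hW.1 hr₂
  have hwσ : ∀ x, σ (v₁ (i₁ x)) = w x := fun x => by rw [hvx₁]; exact hσ _ ⟨x, rfl⟩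
  have h₀ : (W.subtype.comp (((σ.toEmbedding.comp v₁).codRestrict W hr₁).comp i₁)).toHom.range
      = w.toHom.range := by
    congr 1; ext x; exact hwσ x
  have h₁ : (W.subtype.comp ((σ.toEmbedding.comp v₁).codRestrict W hr₁)).toHom.range
      = AbstractClass.img σ v₁.toHom.range := (AbstractClass.map_range σ.toEmbedding v₁).symm
  have h₂ : (W.subtype.comp (v₂.codRestrict W hr₂)).toHom.range = v₂.toHom.range := rfl
  refine ⟨W, _, (σ.toEmbedding.comp v₁).codRestrict W hr₁, v₂.codRestrict W hr₂, hW.memCard,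
    hf₁, hf₂, ?_, ?_, ?_, ?_⟩
  · ext x
    exact (hwσ x).trans (hvx₂ x).symm
  · rw [hC.tpNotForks_iff hcat hW.isEmb ((K.isEmb_comp hf₁ hi₁).isSub_range hM₀.2)
      (hf₂.isSub_range hM₂.2), AbstractClass.map_range, AbstractClass.map_range, h₀, h₂]
    exact hnf₁
  · rw [hC.tpNotForks_iff hcat hW.isEmb ((K.isEmb_comp hf₁ hi₁).isSub_range hM₀.2)
      (hf₁.isSub_range hM₁.2), AbstractClass.map_range, AbstractClass.map_range, h₀, h₁]
    exact hnf₂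
  · ext y
    constructor
    · rintro ⟨⟨x, rfl⟩, z, hz⟩
      obtain ⟨t, ht⟩ := hdis (x := σ (v₁ x))
        ⟨AbstractClass.apply_mem_img ⟨x, rfl⟩, z, congrArg Subtype.val hz⟩
      exact ⟨t, Subtype.ext ((hwσ t).trans ht)⟩
    · rintro ⟨x, rfl⟩
      exact ⟨⟨i₁ x, rfl⟩, i₂ x, Subtype.ext ((hvx₂ x).trans (hwσ x).symm)⟩
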